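/- **Setting.** Let $\Omega\subset\mathbb R^3$ be a bounded simply connected domain whose boundary is connected and Lipschitz. Let $\kappa>0$, $\beta=(0,0,1)$, ${\bf F}(x)=\tfrac12(-x_2,x_1,0)$ and $p_{\bf A}=-i\nabla+{\bf A}$. For $H>0$ put $$\mathcal E_{\kappa,H}[\psi,{\bf A}]=\int_\Omega\Big\{|p_{\kappa H{\bf A}}\psi|^2-\kappa^2|\psi|^2+\tfrac{\kappa^2}{2}|\psi|^4\Big\}dx+\kappa^2H^2\int_{\mathbb R^3}|\operatorname{curl}{\bf A}-\beta|^2dx$$ for $\psi\in W^{1,2}(\Omega;\mathbb C)$ and ${\bf A}\in{\bf F}+\dot H^1_{\rm div}$, where $\dot H^1_{\rm div}=\{{\bf a}\in\dot H^1(\mathbb R^3;\mathbb R^3):\operatorname{div}{\bf a}=0\}$ and $\dot H^1$ is the closure of $C_0^\infty$ under $\|\nabla f\|_{L^2}$ (realised in $L^6$). Let $\mathcal E^{\rm mod}_{\kappa,H}[\psi,{\bf A}]$ be given by the same expression with the second integral over $\Omega$ instead of $\mathbb R^3$, for $\psi\in W^{1,2}(\Omega;\mathbb C)$ and ${\bf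 A}$ in the gauge-fixed space $$\mathcal A(\Omega)=\{{\bf A}\in L^2(\Omega;\mathbb R^3):\operatorname{curl}{\bf A}\in L^2(\Omega;\mathbb R^3),\ \operatorname{div}{\bf A}=0\text{ in }\Omega,\ N\cdot{\bf A}=0\text{ on }\partial\Omega\}$$ (the last two conditions in the weak sense $\int_\Omega{\bf A}\cdot\nabla v\,dx=0$ for all $v\in C_0^\infty(\mathbb R^3)$; if $\partial\Omega$ is smooth, then $\mathcal A(\Omega)=\{{\bf A}\in W^{1,2}(\Omega;\mathbb R^3):\operatorname{div}{\bf A}=0,\ N\cdot{\bf A}|_{\partial\Omega}=0\}$). The functionals take values in $(-\infty,+\infty]$. Let ${\bf F}_\Omega$ denote a field in $\mathcal A(\Omega)$ with $\operatorname{curl}{\bf F}_\Omega=\beta$ in $\Omega$. Define the following critical fields as infima in $[0,+\infty]$, with $\inf\emptyset=+\infty$: $$\begin{aligned} \underline H_{C_3}(\kappa)&=\inf\{H>0:({0},{\bf F})\text{ is a minimizer of }\mathcal E_{\kappa,H}\},\\ \overline H_{C_3}(\kappa)&=\inf\{H>0:\text{for all }H'>H,\ (0,{\bf F})\text{ is the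 unique minimizer of }\mathcal E_{\kappa,H'}\},\\ \underline H^{\rm mod}_{C_3}(\kappa)&=\inf\{H>0:(0,{\bf F}_\Omega)\text{ is a minimizer of }\mathcal E^{\rm mod}_{\kappa,H}\},\\ \overline H^{\rm mod}_{C_3}(\kappa)&=\inf\{H>0:\text{for all }H'>H,\ (0,{\bf F}_\Omega)\text{ is the unique minimizer of }\mathcal E^{\rm mod}_{\kappa,H'}\},\\ \underline H^{\rm loc}_{C_3}(\kappa)&=\inf\{H>0:\operatorname{Hess}\mathcal E_{\kappa,H}|_{(0,{\bf F})}\ge0\},\\ \overline H^{\rm loc}_{C_3}(\kappa)&=\inf\{H>0:\text{for all }H'>H,\ \operatorname{Hess}\mathcal E_{\kappa,H'}|_{(0,{\bf F})}\ge0\}, \end{aligned}$$ where $\operatorname{Hess}\mathcal E_{\kappa,H}|_{(0,{\bf F})}\ge0$ means $\frac{d^2}{ds^2}\big|_{s=0}\mathcal E_{\kappa,H}[s\phi,{\bf F}+s{\bf a}]\ge0$ for all $\phi\in W^{1,2}(\Omega;\mathbb C)$ and ${\bf a}\in\dot H^1_{\rm div}$. **Proposition.** For every such $\Omega$ and every $\kappa>0$,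 a field ${\bf F}_\Omega$ as above exists, and (for every such ${\bf F}_\Omega$) $$\underline H^{\rm loc}_{C_3}(\kappa)\le\underline H_{C_3}(\kappa)\le\underline H^{\rm mod}_{C_3}(\kappa),\qquad \overline H^{\rm loc}_{C_3}(\kappa)\le\overline H_{C_3}(\kappa)\le\overline H^{\rm mod}_{C_3}(\kappa).$$ -/

import Mathlib

open MeasureTheory Filter Set
open scoped ENNReal Topology ContDiff

noncomputable section

namespace GinzburgLandau

/-- Euclidean three-space; it is also the space of values of vector fields. -/
abbrev R3 : Type := EuclideanSpace ℝ (Fin 3)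

/-- Complex vectors with three components, with the Hermitian norm. -/
abbrev C3 : Type := EuclideanSpace ℂ (Fin 3)

/-- Partial derivative of a real function in the `j`-th coordinate direction. -/
def partialDeriv (j : Fin 3) (η : R3 → ℝ) (x : R3) : ℝ :=
  fderiv ℝ η x (EuclideanSpace.single j 1)

/-- Classical curl of a differentiable vector field. -/
def curl (η : R3 → R3) (x : R3) : R3 :=
  !₂[partialDeriv 1 (fun y => η y 2) x - partialDeriv 2 (fun y => η y 1) x,
     partialDeriv 2 (fun y => η y 0) x - partialDeriv 0 (fun y => η y 2) x,
     partialDeriv 0 (fun y => η y 1) x - partialDeriv 1 (fun y => η y 0) x]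

/-! ### The domain -/

/-- The boundary of `Ω` is Lipschitz: near each boundary point, in suitable orthonormal
coordinates, `Ω` is the region strictly above the graph of a Lipschitz function of two
variables. -/
def HasLipschitzBoundary (Ω : Set R3) : Prop :=
  ∀ x ∈ frontier Ω, ∃ (L : R3 ≃ₗᵢ[ℝ] R3) (γ : EuclideanSpace ℝ (Fin 2) → ℝ) (K : NNReal)
    (U : Set R3), LipschitzWith K γ ∧ IsOpen U ∧ x ∈ U ∧
      Ω ∩ U = {y ∈ U | γ !₂[L y 0, L y 1] < L y 2}

/-- A bounded simply connected domain with connected, Lipschitz boundary. -/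
structure IsAdmissibleDomain (Ω : Set R3) : Prop where
  isOpen : IsOpen Ω
  isConnected : IsConnected Ω
  isBounded : Bornology.IsBounded Ω
  isSimplyConnected : IsSimplyConnected Ω
  isConnected_frontier : IsConnected (frontier Ω)
  lipschitz : HasLipschitzBoundary Ω

/-! ### Weak derivatives and function spaces -/

/-- `G` is the distributional gradient of `ψ` in the open set `U`. -/
def IsWeakGrad (U : Set R3) (ψ : R3 → ℂ) (G : R3 → C3) : Prop :=
  LocallyIntegrableOn ψ U ∧ LocallyIntegrableOn G U ∧
    ∀ η : R3 → ℝ, ContDiff ℝ ∞ η → HasCompactSupport η → tsupport η ⊆ U →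
      ∀ j : Fin 3, ∫ x in U, (partialDeriv j η x : ℂ) * ψ x = - ∫ x in U, (η x : ℂ) * G x j

/-- `C` is the distributional curl of `A` in the open set `U`. -/
def IsWeakCurl (U : Set R3) (A C : R3 → R3) : Prop :=
  LocallyIntegrableOn A U ∧ LocallyIntegrableOn C U ∧
    ∀ η : R3 → R3, ContDiff ℝ ∞ η → HasCompactSupport η → tsupport η ⊆ U →
      ∫ x in U, inner ℝ (A x) (curl η x) = ∫ x in U, inner ℝ (C x) (η x)

open Classical in
/-- The distributional gradient in `U` (unique almost everywhere in `U` when it exists as a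
locally integrable function). -/
def weakGrad (U : Set R3) (ψ : R3 → ℂ) : R3 → C3 :=
  if h : ∃ G, IsWeakGrad U ψ G then h.choose else 0

open Classical in
/-- The distributional curl in `U` (unique almost everywhere in `U` when it exists as a
locally integrable function). -/
def weakCurl (U : Set R3) (A : R3 → R3) : R3 → R3 :=
  if h : ∃ C, IsWeakCurl U A C then h.choose else 0

/-- The Sobolev space `W^{1,2}(Ω; ℂ)`. -/
def MemW12 (Ω : Set R3) (ψ : R3 → ℂ) : Prop :=
  MemLp ψ 2 (volume.restrict Ω) ∧
    ∃ G, IsWeakGrad Ω ψ G ∧ MemLp G 2 (volume.restrict Ω)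

/-- The homogeneous Sobolev space `Ḣ¹(ℝ³; ℝ³)`: the closure of the smooth compactly supported
fields under the norm `a ↦ ‖∇a‖_{L²}`, realised as a space of functions by means of the Sobolev
inequality `‖a‖_{L⁶} ≤ C ‖∇a‖_{L²}`. -/
def MemHdot1 (a : R3 → R3) : Prop :=
  MemLp a 6 volume ∧
    ∃ (u : ℕ → R3 → R3) (D : R3 → R3 →L[ℝ] R3),
      (∀ n, ContDiff ℝ ∞ (u n) ∧ HasCompactSupport (u n)) ∧ MemLp D 2 volume ∧
      Tendsto (fun n => eLpNorm (u n - a) 6 volume) atTop (𝓝 0) ∧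
      Tendsto (fun n => eLpNorm (fderiv ℝ (u n) - D) 2 volume) atTop (𝓝 0)

/-- The space `Ḣ¹_div` of divergence free fields in `Ḣ¹(ℝ³; ℝ³)`. -/
def MemHdot1Div (a : R3 → R3) : Prop :=
  MemHdot1 a ∧ ∀ v : R3 → ℝ, ContDiff ℝ ∞ v → HasCompactSupport v →
    ∫ x, inner ℝ (a x) (gradient v x) = 0

/-- The space of gauge-fixed vector potentials on `Ω`: fields in `L²(Ω; ℝ³)` with curl in
`L²(Ω; ℝ³)`, and with `div A = 0` in `Ω` and `N · A = 0` on `∂Ω`. The last two conditions are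
expressed together by testing against functions that need not vanish on `∂Ω`. -/
def MemGauge (Ω : Set R3) (A : R3 → R3) : Prop :=
  MemLp A 2 (volume.restrict Ω) ∧
    (∃ C, IsWeakCurl Ω A C ∧ MemLp C 2 (volume.restrict Ω)) ∧
    ∀ v : R3 → ℝ, ContDiff ℝ ∞ v → HasCompactSupport v →
      ∫ x in Ω, inner ℝ (A x) (gradient v x) = 0

/-! ### The functionals -/

/-- The constant exterior field. -/
def beta : R3 := !₂[0, 0, 1]

/-- The vector potential `F(x) = (-x₂, x₁, 0) / 2`. -/
def F (x : R3) : R3 := !₂[-(x 1) / 2, x 0 / 2, 0]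

/-- The magnetic gradient `(-i∇ + b A) ψ` in `Ω`. -/
def magneticGrad (Ω : Set R3) (b : ℝ) (A : R3 → R3) (ψ : R3 → ℂ) (x : R3) : C3 :=
  WithLp.toLp 2 fun j => -Complex.I * weakGrad Ω ψ x j + ((b * A x j : ℝ) : ℂ) * ψ x

/-- The energy
`∫_Ω (|(-i∇ + κHA)ψ|² - κ²|ψ|² + (κ²/2)|ψ|⁴) + κ²H² ∫_U |curl A - β|²`,
with the field energy taken over `U`. The non-negative terms are integrated in `[0, ∞]`, and
the negative term is finite for `ψ ∈ L²(Ω)`. -/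
def energy (Ω U : Set R3) (κ H : ℝ) (ψ : R3 → ℂ) (A : R3 → R3) : EReal :=
  (((∫⁻ x in Ω, ‖magneticGrad Ω (κ * H) A ψ x‖ₑ ^ 2)
      + ENNReal.ofReal (κ ^ 2 / 2) * (∫⁻ x in Ω, ‖ψ x‖ₑ ^ 4)
      + ENNReal.ofReal (κ ^ 2 * H ^ 2) * (∫⁻ x in U, ‖weakCurl U A x - beta‖ₑ ^ 2) : ℝ≥0∞) : EReal)
    - ((ENNReal.ofReal (κ ^ 2) * ∫⁻ x in Ω, ‖ψ x‖ₑ ^ 2 : ℝ≥0∞) : EReal)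

/-- The Ginzburg-Landau functional, with the field energy over all of space. -/
def glEnergy (Ω : Set R3) (κ H : ℝ) (ψ : R3 → ℂ) (A : R3 → R3) : EReal :=
  energy Ω univ κ H ψ A

/-- The modified Ginzburg-Landau functional, with the field energy over `Ω` only. -/
def glEnergyMod (Ω : Set R3) (κ H : ℝ) (ψ : R3 → ℂ) (A : R3 → R3) : EReal :=
  energy Ω Ω κ H ψ A

/-- The states `(ψ, A) ∈ W^{1,2}(Ω; ℂ) × (F + Ḣ¹_div)`. -/
def IsState (Ω : Set R3) (ψ : R3 → ℂ) (A : R3 → R3) : Prop :=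
  MemW12 Ω ψ ∧ MemHdot1Div (fun x => A x - F x)

/-- The states of the modified functional. -/
def IsStateMod (Ω : Set R3) (ψ : R3 → ℂ) (A : R3 → R3) : Prop :=
  MemW12 Ω ψ ∧ MemGauge Ω A

/-- `(ψ, A)` is a (global) minimizer of the Ginzburg-Landau functional. -/
def IsMinimizer (Ω : Set R3) (κ H : ℝ) (ψ : R3 → ℂ) (A : R3 → R3) : Prop :=
  IsState Ω ψ A ∧ ∀ φ B, IsState Ω φ B → glEnergy Ω κ H ψ A ≤ glEnergy Ω κ H φ B

/-- `(ψ, A)` is a (global) minimizer of the modified Ginzburg-Landau functional. -/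
def IsMinimizerMod (Ω : Set R3) (κ H : ℝ) (ψ : R3 → ℂ) (A : R3 → R3) : Prop :=
  IsStateMod Ω ψ A ∧ ∀ φ B, IsStateMod Ω φ B → glEnergyMod Ω κ H ψ A ≤ glEnergyMod Ω κ H φ B

/-- `(0, F)` is the unique minimizer of the Ginzburg-Landau functional. -/
def IsUniqueMinimizer (Ω : Set R3) (κ H : ℝ) : Prop :=
  IsMinimizer Ω κ H 0 F ∧ ∀ ψ A, IsMinimizer Ω κ H ψ A →
    ψ =ᵐ[volume.restrict Ω] 0 ∧ A =ᵐ[volume] F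

/-- `(0, FΩ)` is the unique minimizer of the modified Ginzburg-Landau functional. -/
def IsUniqueMinimizerMod (Ω : Set R3) (κ H : ℝ) (FΩ : R3 → R3) : Prop :=
  IsMinimizerMod Ω κ H 0 FΩ ∧ ∀ ψ A, IsMinimizerMod Ω κ H ψ A →
    ψ =ᵐ[volume.restrict Ω] 0 ∧ A =ᵐ[volume.restrict Ω] FΩ

/-- `FΩ` is the gauge-fixed vector potential in `Ω` that generates the constant field. -/
def IsNormalPotential (Ω : Set R3) (FΩ : R3 → R3) : Prop :=
  MemGauge Ω FΩ ∧ IsWeakCurl Ω FΩ (fun _ => beta)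

/-- The Hessian of the Ginzburg-Landau functional at the normal state `(0, F)` is non-negative:
the second derivative at `s = 0` of `s ↦ E[sφ, F + s a]` is non-negative in every direction. -/
def HessNonneg (Ω : Set R3) (κ H : ℝ) : Prop :=
  ∀ (φ : R3 → ℂ) (a : R3 → R3), MemW12 Ω φ → MemHdot1Div a →
    0 ≤ iteratedDeriv 2
      (fun s : ℝ => (glEnergy Ω κ H (fun x => (s : ℂ) * φ x) (fun x => F x + s • a x)).toReal) 0

/-! ### The critical fields -/

/-- `inf {H > 0 : P H}` in the extended reals; the infimum of the empty set is `+∞`. -/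
def lowerField (P : ℝ → Prop) : EReal :=
  sInf ((fun H : ℝ => (H : EReal)) '' {H | 0 < H ∧ P H})

/-- `inf {H > 0 : P H' for all H' > H}` in the extended reals. -/
def upperField (P : ℝ → Prop) : EReal :=
  sInf ((fun H : ℝ => (H : EReal)) '' {H | 0 < H ∧ ∀ H', H < H' → P H'})

/-- The lower critical field. -/
def lowerHC3 (Ω : Set R3) (κ : ℝ) : EReal := lowerField fun H => IsMinimizer Ω κ H 0 F

/-- The upper critical field. -/
def upperHC3 (Ω : Set R3) (κ : ℝ) : EReal := upperField fun H => IsUniqueMinimizer Ω κ H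

/-- The lower local critical field. -/
def lowerHC3Loc (Ω : Set R3) (κ : ℝ) : EReal := lowerField fun H => HessNonneg Ω κ H

/-- The upper local critical field. -/
def upperHC3Loc (Ω : Set R3) (κ : ℝ) : EReal := upperField fun H => HessNonneg Ω κ H

/-- The lower critical field of the modified functional. -/
def lowerHC3Mod (Ω : Set R3) (κ : ℝ) (FΩ : R3 → R3) : EReal :=
  lowerField fun H => IsMinimizerMod Ω κ H 0 FΩ

/-- The upper critical field of the modified functional. -/
def upperHC3Mod (Ω : Set R3) (κ : ℝ) (FΩ : R3 → R3) : EReal :=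
  upperField fun H => IsUniqueMinimizerMod Ω κ H FΩ

end GinzburgLandau

end

/-! All four inequalities follow from implications at a fixed field `H > 0`, because a weaker
condition is met by more values of `H` and so has a smaller infimum. What must be shown is that
minimality of the normal state implies a non-negative Hessian (`hessNonneg_of_isMinimizer`), and
that minimality, or unique minimality, for the modified functional implies the same for the full one
(`isMinimizer_of_mod`, `isUniqueMinimizer_of_mod`). The normal state has energy zero for both
functionals, so minimality means that every energy is non-negative.

To pass from the full functional to the modified one, restrict the potential to `Ω` and remove its
`L²` projection `P` onto the closure of the gradients (`exists_gradient_limit`). The field `P` is a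
limit of gradients of smooth functions which, after subtraction of constants, converge almost
everywhere to a gauge function `χ` (`exists_tendsto_sub_const`). Multiplication of `ψ` by `exp(i κ H
χ)` preserves the moduli of `ψ` and of the magnetic gradient, and restricting the field energy to
`Ω` can only lower it (`exists_gauge`, `exists_stateMod`). The same projection, applied to `F`,
produces the normal potential in `Ω`.

The field `P` is only square integrable, so the product `ψ P` is controlled when `ψ` is bounded. For
this, `ψ` is composed with a `C¹` contraction of the plane that commutes with rotations and fixes
the unit disc. It lowers the kinetic and the potential energy (`norm_magField_trunc_le`,
`potential_trunc_le`), so it is enough to treat bounded order parameters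
(`negEnergy_le_posEnergy_of_trunc`).

For uniqueness, a minimizer has energy at most zero. Equality in the truncation estimate then forces
`|ψ| ≤ 1`, the gauge transform of the minimizer is a minimizer of the modified functional, and so `ψ
= 0`. What is left of the energy is the field energy on all of space, so `A - F` is free of curl and
divergence and vanishes by the div-curl estimate and Sobolev's inequality
(`MemHdot1Div.ae_eq_zero`).

For the Hessian, the energy along `(s φ, F + s a)` is either a polynomial `a s² + b s³ + c s⁴` or
infinite for every `s ≠ 0`. -/

noncomputable section
namespace GinzburgLandau

variable {U Ω : Set R3}

/-! ### Locally integrable functions paired with test functions -/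

section LocallyIntegrable

variable {E E' : Type*} [NormedAddCommGroup E] [NormedSpace ℝ E]
  [NormedAddCommGroup E'] [NormedSpace ℝ E']

theorem integrable_smul_of_tsupport_subset {f : R3 → E} {η : R3 → ℝ} (hf : LocallyIntegrableOn f U)
    (hη : Continuous η) (hc : HasCompactSupport η) (hs : tsupport η ⊆ U) :
    Integrable (fun x => η x • f x) := by
  have h1 : IntegrableOn f (tsupport η) := hf.integrableOn_compact_subset hs hc
  have h2 : IntegrableOn (fun x => η x • f x) (tsupport η) :=
    h1.continuousOn_smul hη.continuousOn hc
  rwa [integrableOn_iff_integrable_of_support_subset] at h2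
  intro x hx
  apply subset_tsupport
  intro h0
  apply hx
  simp [h0]

theorem setIntegral_smul_eq_integral {f : R3 → E} {η : R3 → ℝ} (hs : tsupport η ⊆ U) :
    ∫ x in U, η x • f x = ∫ x, η x • f x := by
  apply setIntegral_eq_integral_of_forall_compl_eq_zero
  intro x hx
  rw [image_eq_zero_of_notMem_tsupport (fun h => hx (hs h)), zero_smul]

theorem LocallyIntegrableOn.clm_comp {f : R3 → E} (hf : LocallyIntegrableOn f U) (L : E →L[ℝ] E') :
    LocallyIntegrableOn (fun x => L (f x)) U := by
  intro x hx
  obtain ⟨s, hs, hi⟩ := hf x hx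
  exact ⟨s, hs, L.integrable_comp hi⟩

/-- The fundamental lemma of the calculus of variations. Through it weak gradients and curls are
unique almost everywhere, which makes the representatives chosen in `weakGrad` and `weakCurl`
harmless. -/
theorem ae_restrict_eq_of_integral_smul_eq [CompleteSpace E] {f g : R3 → E} (hU : IsOpen U)
    (hf : LocallyIntegrableOn f U) (hg : LocallyIntegrableOn g U)
    (h : ∀ η : R3 → ℝ, ContDiff ℝ ∞ η → HasCompactSupport η → tsupport η ⊆ U →
      ∫ x in U, η x • f x = ∫ x in U, η x • g x) :
    f =ᵐ[volume.restrict U] g := by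
  have := hU.ae_eq_zero_of_integral_contDiff_smul_eq_zero (μ := volume) (f := f - g) (hf.sub hg) ?_
  · rw [← ae_restrict_iff' hU.measurableSet] at this
    filter_upwards [this] with x hx
    exact sub_eq_zero.1 hx
  · intro η h1 h2 h3
    have e := h η h1 h2 h3
    rw [setIntegral_smul_eq_integral h3, setIntegral_smul_eq_integral h3] at e
    simp only [Pi.sub_apply, smul_sub]
    rw [integral_sub, e, sub_self]
    · exact integrable_smul_of_tsupport_subset hf h1.continuous h2 h3
    · exact integrable_smul_of_tsupport_subset hg h1.continuous h2 h3

end LocallyIntegrable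

theorem LocallyIntegrableOn.C3_apply {G : R3 → C3} (hG : LocallyIntegrableOn G U) (j : Fin 3) :
    LocallyIntegrableOn (fun x => G x j) U :=
  LocallyIntegrableOn.clm_comp hG
    ((EuclideanSpace.proj j : C3 →L[ℂ] ℂ).restrictScalars ℝ)

theorem LocallyIntegrableOn.R3_apply {G : R3 → R3} (hG : LocallyIntegrableOn G U) (j : Fin 3) :
    LocallyIntegrableOn (fun x => G x j) U :=
  LocallyIntegrableOn.clm_comp hG (EuclideanSpace.proj j : R3 →L[ℝ] ℝ)

/-! ### Partial derivatives -/

theorem partialDeriv_contDiff {η : R3 → ℝ} (h : ContDiff ℝ ∞ η) (j : Fin 3) :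
    ContDiff ℝ ∞ (partialDeriv j η) :=
  (h.fderiv_right (m := ∞) (by simp)).clm_apply contDiff_const

theorem tsupport_partialDeriv_subset (η : R3 → ℝ) (j : Fin 3) :
    tsupport (partialDeriv j η) ⊆ tsupport η :=
  tsupport_fderiv_apply_subset ℝ _

theorem hasCompactSupport_partialDeriv {η : R3 → ℝ} (h : HasCompactSupport η) (j : Fin 3) :
    HasCompactSupport (partialDeriv j η) :=
  h.fderiv_apply ℝ _

theorem partialDeriv_eq_zero {η : R3 → ℝ} {x : R3} (hx : x ∉ tsupport η) (j : Fin 3) :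
    partialDeriv j η x = 0 :=
  image_eq_zero_of_notMem_tsupport fun h => hx (tsupport_partialDeriv_subset η j h)

theorem partialDeriv_mul {f g : R3 → ℝ} (hf : ContDiff ℝ ∞ f) (hg : ContDiff ℝ ∞ g) (j : Fin 3)
    (x : R3) :
    partialDeriv j (fun y => f y * g y) x = partialDeriv j f x * g x + f x * partialDeriv j g x := by
  unfold partialDeriv
  rw [fderiv_fun_mul (hf.differentiable (by simp) x) (hg.differentiable (by simp) x)]
  simp
  ring

theorem partialDeriv_comm {f : R3 → ℝ} (hf : ContDiff ℝ ∞ f) (j k : Fin 3) (x : R3) :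
    partialDeriv j (partialDeriv k f) x = partialDeriv k (partialDeriv j f) x := by
  have hs : IsSymmSndFDerivAt ℝ f x :=
    (hf.of_le (m := 2) (by norm_cast)).contDiffAt.isSymmSndFDerivAt (by simp)
  have hd : DifferentiableAt ℝ (fderiv ℝ f) x :=
    (hf.fderiv_right (m := ∞) (by simp)).differentiable (by simp) x
  have key : ∀ a b : Fin 3, partialDeriv a (partialDeriv b f) x =
      fderiv ℝ (fderiv ℝ f) x (EuclideanSpace.single a 1) (EuclideanSpace.single b 1) := by
    intro a b
    unfold partialDeriv
    rw [fderiv_clm_apply hd (differentiableAt_const _)]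
    simp
  rw [key, key]
  exact hs _ _

theorem integrable_mul_of_hasCompactSupport {f g : R3 → ℝ} (hf : Continuous f) (hg : Continuous g)
    (h : HasCompactSupport g) : Integrable (fun x => f x * g x) :=
  (hf.mul hg).integrable_of_hasCompactSupport h.mul_left

theorem integral_mul_partialDeriv {f g : R3 → ℝ} (hf : ContDiff ℝ ∞ f) (hg : ContDiff ℝ ∞ g)
    (h : HasCompactSupport g) (j : Fin 3) :
    ∫ x, f x * partialDeriv j g x = - ∫ x, partialDeriv j f x * g x :=
  integral_mul_fderiv_eq_neg_fderiv_mul_of_integrable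
    (integrable_mul_of_hasCompactSupport (partialDeriv_contDiff hf j).continuous hg.continuous h)
    (integrable_mul_of_hasCompactSupport hf.continuous (partialDeriv_contDiff hg j).continuous
      (hasCompactSupport_partialDeriv h j))
    (integrable_mul_of_hasCompactSupport hf.continuous hg.continuous h)
    (fun x _ => hf.differentiable (by simp) x) (fun x _ => hg.differentiable (by simp) x)

/-- The null form `∂ⱼf ∂ₖg - ∂ₖf ∂ⱼg` integrates to zero. -/
theorem integral_partialDeriv_mul_comm {f g : R3 → ℝ} (hf : ContDiff ℝ ∞ f) (hg : ContDiff ℝ ∞ g)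
    (h : HasCompactSupport g) (j k : Fin 3) :
    ∫ x, partialDeriv j f x * partialDeriv k g x =
      ∫ x, partialDeriv k f x * partialDeriv j g x := by
  have e : ∀ a b : Fin 3, ∫ x, partialDeriv a f x * partialDeriv b g x =
      - ∫ x, f x * partialDeriv a (partialDeriv b g) x := by
    intro a b
    rw [integral_mul_partialDeriv hf (partialDeriv_contDiff hg b)
      (hasCompactSupport_partialDeriv h b), neg_neg]
  rw [e, e]
  simp only [partialDeriv_comm hg j k]

theorem gradient_apply {v : R3 → ℝ} (x : R3) (j : Fin 3) :
    gradient v x j = partialDeriv j v x := by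
  have : inner ℝ (gradient v x) (EuclideanSpace.single j (1 : ℝ)) = partialDeriv j v x := by
    unfold gradient partialDeriv
    rw [InnerProductSpace.toDual_symm_apply]
  rw [← this, EuclideanSpace.inner_single_right]
  simp

theorem inner_R3 (x y : R3) : inner ℝ x y = x 0 * y 0 + x 1 * y 1 + x 2 * y 2 := by
  rw [PiLp.inner_apply, Fin.sum_univ_three]
  simp [mul_comm]

theorem contDiff_apply {n : WithTop ℕ∞} {η : R3 → R3} (h : ContDiff ℝ n η) (j : Fin 3) :
    ContDiff ℝ n fun x => η x j :=
  (contDiff_piLp 2).1 h j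

theorem hasCompactSupport_apply {η : R3 → R3} (h : HasCompactSupport η) (j : Fin 3) :
    HasCompactSupport fun x => η x j :=
  h.comp_left (g := fun y : R3 => y j) rfl

theorem tsupport_apply_subset (η : R3 → R3) (j : Fin 3) :
    (tsupport fun x => η x j) ⊆ tsupport η := by
  apply closure_mono
  intro x hx h0
  apply hx
  simp [h0]

theorem contDiff_curl {η : R3 → R3} (h : ContDiff ℝ ∞ η) : ContDiff ℝ ∞ (curl η) := by
  rw [contDiff_piLp 2]
  intro j
  have := fun a b => partialDeriv_contDiff (contDiff_apply h a) b
  fin_cases j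
  · exact (this 2 1).sub (this 1 2)
  · exact (this 0 2).sub (this 2 0)
  · exact (this 1 0).sub (this 0 1)

theorem curl_eq_zero {η : R3 → R3} {x : R3} (hx : x ∉ tsupport η) : curl η x = 0 := by
  have : ∀ j k, partialDeriv j (fun y => η y k) x = 0 := fun j k =>
    partialDeriv_eq_zero (fun h => hx (tsupport_apply_subset η k h)) j
  ext j
  fin_cases j <;> simp [curl, this]

theorem tsupport_curl_subset (η : R3 → R3) : tsupport (curl η) ⊆ tsupport η :=
  closure_minimal (fun _ hx => by_contra fun h => hx (curl_eq_zero h)) (isClosed_tsupport η)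

theorem hasCompactSupport_curl {η : R3 → R3} (h : HasCompactSupport η) :
    HasCompactSupport (curl η) :=
  h.mono' (subset_tsupport _ |>.trans (tsupport_curl_subset η))

/-- The integrand is a sum of three null forms. Compact support is needed for `η` alone. -/
theorem integral_inner_gradient_curl {v : R3 → ℝ} {η : R3 → R3} (hv : ContDiff ℝ ∞ v)
    (hη : ContDiff ℝ ∞ η) (hc : HasCompactSupport η) :
    ∫ x, inner ℝ (gradient v x) (curl η x) = 0 := by
  have hi : ∀ j k l, Integrable fun x => partialDeriv j v x * partialDeriv k (fun y => η y l) x :=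
    fun j k l => integrable_mul_of_hasCompactSupport (partialDeriv_contDiff hv j).continuous
      (partialDeriv_contDiff (contDiff_apply hη l) k).continuous
      (hasCompactSupport_partialDeriv (hasCompactSupport_apply hc l) k)
  have hcm := fun j k l => integral_partialDeriv_mul_comm hv (contDiff_apply hη l)
    (hasCompactSupport_apply hc l) j k
  let D : Fin 3 → Fin 3 → Fin 3 → R3 → ℝ := fun j k l x =>
    partialDeriv j v x * partialDeriv k (fun y => η y l) x
      - partialDeriv k v x * partialDeriv j (fun y => η y l) x
  have hd : ∀ j k l, Integrable (D j k l) := fun j k l => (hi j k l).sub (hi k j l)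
  have h0 : ∀ j k l, ∫ x, D j k l x = 0 := fun j k l => by
    rw [integral_sub (hi j k l) (hi k j l), hcm j k l, sub_self]
  have e : ∀ x, inner ℝ (gradient v x) (curl η x) = (D 0 1 2 + D 1 2 0 + D 2 0 1) x := by
    intro x
    rw [inner_R3]
    simp only [gradient_apply, curl, D, Pi.add_apply]
    simp
    ring
  rw [integral_congr_ae (Eventually.of_forall e),
    integral_add' ((hd 0 1 2).add (hd 1 2 0)) (hd 2 0 1), integral_add' (hd 0 1 2) (hd 1 2 0),
    h0, h0, h0]
  simp

/-! ### Weak derivatives -/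

theorem IsWeakGrad.ae_eq {ψ : R3 → ℂ} {G G' : R3 → C3} (hU : IsOpen U) (h : IsWeakGrad U ψ G)
    (h' : IsWeakGrad U ψ G') : G =ᵐ[volume.restrict U] G' := by
  have : ∀ j, (fun x => G x j) =ᵐ[volume.restrict U] fun x => G' x j := by
    intro j
    refine ae_restrict_eq_of_integral_smul_eq hU (LocallyIntegrableOn.C3_apply h.2.1 j)
      (LocallyIntegrableOn.C3_apply h'.2.1 j) ?_
    intro η h1 h2 h3
    have e := (h.2.2 η h1 h2 h3 j).symm.trans (h'.2.2 η h1 h2 h3 j)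
    simpa [neg_inj] using e
  filter_upwards [ae_all_iff.2 this] with x hx
  ext j
  exact hx j

theorem IsWeakGrad.ae_eq_weakGrad {ψ : R3 → ℂ} {G : R3 → C3} (hU : IsOpen U)
    (h : IsWeakGrad U ψ G) : weakGrad U ψ =ᵐ[volume.restrict U] G := by
  have hex : ∃ G, IsWeakGrad U ψ G := ⟨G, h⟩
  rw [weakGrad, dif_pos hex]
  exact hex.choose_spec.ae_eq hU h

theorem inner_smul_single (y : R3) (c : ℝ) (j : Fin 3) :
    inner ℝ y (c • (EuclideanSpace.single j 1 : R3)) = c * y j := by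
  rw [inner_smul_right, EuclideanSpace.inner_single_right]
  simp

theorem tsupport_smul_const_subset (g : R3 → ℝ) (e : R3) :
    (tsupport fun x => g x • e) ⊆ tsupport g := by
  apply closure_mono
  intro x hx h0
  apply hx
  simp [h0]

theorem IsWeakCurl.ae_eq {A C C' : R3 → R3} (hU : IsOpen U) (h : IsWeakCurl U A C)
    (h' : IsWeakCurl U A C') : C =ᵐ[volume.restrict U] C' := by
  have : ∀ j, (fun x => C x j) =ᵐ[volume.restrict U] fun x => C' x j := by
    intro j
    refine ae_restrict_eq_of_integral_smul_eq hU (LocallyIntegrableOn.R3_apply h.2.1 j)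
      (LocallyIntegrableOn.R3_apply h'.2.1 j) ?_
    intro η h1 h2 h3
    have a1 : ContDiff ℝ ∞ fun x => η x • (EuclideanSpace.single j 1 : R3) :=
      h1.smul contDiff_const
    have a2 : HasCompactSupport fun x => η x • (EuclideanSpace.single j 1 : R3) := h2.smul_right
    have a3 := (tsupport_smul_const_subset η (EuclideanSpace.single j 1)).trans h3
    have e := (h.2.2 _ a1 a2 a3).symm.trans (h'.2.2 _ a1 a2 a3)
    simpa only [inner_smul_single, smul_eq_mul] using e
  filter_upwards [ae_all_iff.2 this] with x hx
  ext j
  exact hx j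

theorem IsWeakCurl.ae_eq_weakCurl {A C : R3 → R3} (hU : IsOpen U)
    (h : IsWeakCurl U A C) : weakCurl U A =ᵐ[volume.restrict U] C := by
  have hex : ∃ C, IsWeakCurl U A C := ⟨C, h⟩
  rw [weakCurl, dif_pos hex]
  exact hex.choose_spec.ae_eq hU h

theorem setIntegral_inner_eq_integral {f η : R3 → R3} (hs : tsupport η ⊆ U) :
    ∫ x in U, inner ℝ (f x) (η x) = ∫ x, inner ℝ (f x) (η x) := by
  apply setIntegral_eq_integral_of_forall_compl_eq_zero
  intro x hx
  rw [image_eq_zero_of_notMem_tsupport (fun h => hx (hs h)), inner_zero_right]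

/-- A test field supported in the smaller set gives the same integrals over `U`, over `V` and over
the whole space. -/
theorem IsWeakCurl.mono {A C : R3 → R3} {V : Set R3} (hUV : U ⊆ V)
    (h : IsWeakCurl V A C) : IsWeakCurl U A C := by
  refine ⟨h.1.mono_set hUV, h.2.1.mono_set hUV, fun η h1 h2 h3 => ?_⟩
  have := h.2.2 η h1 h2 (h3.trans hUV)
  rwa [setIntegral_inner_eq_integral (h3.trans hUV),
    setIntegral_inner_eq_integral ((tsupport_curl_subset η).trans (h3.trans hUV)),
    ← setIntegral_inner_eq_integral h3,
    ← setIntegral_inner_eq_integral ((tsupport_curl_subset η).trans h3)] at this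

theorem integrable_inner_of_tsupport_subset {f η : R3 → R3} (hf : LocallyIntegrableOn f U)
    (hη : Continuous η) (hc : HasCompactSupport η) (hs : tsupport η ⊆ U) :
    Integrable (fun x => inner ℝ (f x) (η x)) := by
  have : ∀ j : Fin 3, Integrable fun x => η x j • f x j := fun j =>
    integrable_smul_of_tsupport_subset (LocallyIntegrableOn.R3_apply hf j)
      (by fun_prop) (hasCompactSupport_apply hc j)
      ((tsupport_apply_subset η j).trans hs)
  refine (((this 0).add (this 1)).add (this 2)).congr (Eventually.of_forall fun x => ?_)
  simp only [Pi.add_apply, smul_eq_mul, inner_R3]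
  ring

theorem IsWeakCurl.add {A A' C C' : R3 → R3} (h : IsWeakCurl U A C) (h' : IsWeakCurl U A' C') :
    IsWeakCurl U (fun x => A x + A' x) (fun x => C x + C' x) := by
  refine ⟨h.1.add h'.1, h.2.1.add h'.2.1, fun η h1 h2 h3 => ?_⟩
  have hk : ∀ f : R3 → R3, LocallyIntegrableOn f U →
      Integrable (fun x => inner ℝ (f x) (η x)) (volume.restrict U) := fun f hf =>
    (integrable_inner_of_tsupport_subset hf h1.continuous h2 h3).integrableOn
  have hk' : ∀ f : R3 → R3, LocallyIntegrableOn f U →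
      Integrable (fun x => inner ℝ (f x) (curl η x)) (volume.restrict U) := fun f hf =>
    (integrable_inner_of_tsupport_subset hf (contDiff_curl h1).continuous
      (hasCompactSupport_curl h2) ((tsupport_curl_subset η).trans h3)).integrableOn
  simp only [inner_add_left]
  rw [integral_add (hk' A h.1) (hk' A' h'.1), integral_add (hk C h.2.1) (hk C' h'.2.1),
    h.2.2 η h1 h2 h3, h'.2.2 η h1 h2 h3]

theorem IsWeakCurl.const_smul {A C : R3 → R3} (h : IsWeakCurl U A C) (c : ℝ) :
    IsWeakCurl U (fun x => c • A x) (fun x => c • C x) := by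
  refine ⟨h.1.smul c, h.2.1.smul c, fun η h1 h2 h3 => ?_⟩
  simp only [inner_smul_left]
  rw [integral_const_mul, integral_const_mul, h.2.2 η h1 h2 h3]

theorem IsWeakGrad.const_mul {ψ : R3 → ℂ} {G : R3 → C3} (h : IsWeakGrad U ψ G) (c : ℂ) :
    IsWeakGrad U (fun x => c * ψ x) (fun x => c • G x) := by
  refine ⟨h.1.smul c, h.2.1.smul c, fun η h1 h2 h3 j => ?_⟩
  simp only [PiLp.smul_apply, smul_eq_mul, mul_left_comm _ c]
  rw [integral_const_mul, integral_const_mul, h.2.2 η h1 h2 h3, mul_neg]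

theorem isWeakGrad_zero : IsWeakGrad U 0 0 := by
  refine ⟨fun x _ => integrableAtFilter_zero, ?_, ?_⟩
  · exact fun x _ => integrableAtFilter_zero
  · intro η _ _ _ j
    simp

/-! ### Passing to the limit in pairings -/

/-- By Hölder's inequality the integrands converge in `L¹`. The exponents used later are `(6, 6/5)`
for fields in `Ḣ¹`, and `(2, 2)` for gradients. -/
theorem tendsto_integral_bilin {α E F G : Type*} [MeasurableSpace α] {μ : Measure α}
    [NormedAddCommGroup E] [NormedSpace ℝ E] [NormedAddCommGroup F] [NormedSpace ℝ F]
    [NormedAddCommGroup G] [NormedSpace ℝ G] {p q : ℝ≥0∞} [hpq : ENNReal.HolderTriple p q 1]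
    (L : E →L[ℝ] F →L[ℝ] G) {f : ℕ → α → E} {f₀ : α → E} {g : α → F}
    (hf : ∀ n, MemLp (f n) p μ) (hf₀ : MemLp f₀ p μ) (hg : MemLp g q μ)
    (h : Tendsto (fun n => eLpNorm (f n - f₀) p μ) atTop (𝓝 0)) :
    Tendsto (fun n => ∫ x, L (f n x) (g x) ∂μ) atTop (𝓝 (∫ x, L (f₀ x) (g x) ∂μ)) := by
  have hb : ∀ {u : α → E}, AEStronglyMeasurable u μ →
      eLpNorm (fun x => L (u x) (g x)) 1 μ ≤ ‖L‖₊ * eLpNorm u p μ * eLpNorm g q μ := by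
    intro u hu
    refine eLpNorm_le_eLpNorm_mul_eLpNorm_of_nnnorm hu hg.1 (fun a b => L a b) ‖L‖₊ ?_
    exact Eventually.of_forall fun x => L.le_opNorm₂ _ _
  have hint : ∀ u : α → E, MemLp u p μ → Integrable (fun x => L (u x) (g x)) μ := by
    intro u hu
    rw [← memLp_one_iff_integrable]
    exact ⟨L.aestronglyMeasurable_comp₂ hu.1 hg.1,
      (hb hu.1).trans_lt (ENNReal.mul_lt_top (ENNReal.mul_lt_top ENNReal.coe_lt_top hu.2) hg.2)⟩
  have h0 : Tendsto (fun n => ‖L‖₊ * eLpNorm (f n - f₀) p μ * eLpNorm g q μ) atTop (𝓝 0) := by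
    have := ENNReal.Tendsto.mul_const (ENNReal.Tendsto.const_mul (a := (‖L‖₊ : ℝ≥0∞)) h
      (Or.inr ENNReal.coe_ne_top)) (Or.inr hg.2.ne) (b := eLpNorm g q μ)
    simpa using this
  have e : ∀ n, eLpNorm ((fun x => L (f n x) (g x)) - fun x => L (f₀ x) (g x)) 1 μ ≤
      ‖L‖₊ * eLpNorm (f n - f₀) p μ * eLpNorm g q μ := by
    intro n
    have h1 : ((fun x => L (f n x) (g x)) - fun x => L (f₀ x) (g x)) =
        fun x => L ((f n - f₀) x) (g x) := by
      ext x
      simp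
    rw [h1]
    exact hb ((hf n).sub hf₀).1
  exact tendsto_integral_of_L1' _ (hint f₀ hf₀).1 (Eventually.of_forall fun n => hint (f n) (hf n))
    (tendsto_of_tendsto_of_tendsto_of_le_of_le tendsto_const_nhds h0 (fun n => bot_le) e)

theorem memLp_of_contDiff {E : Type*} [NormedAddCommGroup E] [NormedSpace ℝ E] {f : R3 → E}
    (hf : ContDiff ℝ ∞ f) (h : HasCompactSupport f) (p : ℝ≥0∞) : MemLp f p :=
  hf.continuous.memLp_of_hasCompactSupport h

theorem MemLp.locallyIntegrableOn {E : Type*} [NormedAddCommGroup E] {f : R3 → E} {p : ℝ≥0∞}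
    (hp : 1 ≤ p) (hU : IsOpen U) (hf : MemLp f p (volume.restrict U)) :
    LocallyIntegrableOn f U := by
  intro x hx
  obtain ⟨ε, hε, hb⟩ := Metric.isOpen_iff.1 hU x hx
  refine ⟨Metric.ball x ε, mem_nhdsWithin_of_mem_nhds (Metric.ball_mem_nhds x hε), ?_⟩
  have : IsFiniteMeasure (volume.restrict (Metric.ball x ε)) := ⟨by
    rw [Measure.restrict_apply_univ]; exact Metric.isBounded_ball.measure_lt_top⟩
  exact (hf.mono_measure (Measure.restrict_mono hb le_rfl)).integrable hp

/-! ### Curl and divergence of matrices -/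

/-- The curl of the linear field `x ↦ L x`. -/
def linCurl (L : R3 →L[ℝ] R3) : R3 :=
  !₂[L (EuclideanSpace.single 1 1) 2 - L (EuclideanSpace.single 2 1) 1,
     L (EuclideanSpace.single 2 1) 0 - L (EuclideanSpace.single 0 1) 2,
     L (EuclideanSpace.single 0 1) 1 - L (EuclideanSpace.single 1 1) 0]

/-- As a continuous linear map on matrices, the curl passes to `L²` limits of gradients; `divCLM`
serves the same purpose for the divergence. -/
def curlCLM : (R3 →L[ℝ] R3) →L[ℝ] R3 :=
  LinearMap.toContinuousLinearMap
    { toFun := linCurl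
      map_add' := fun L M => by
        ext j
        fin_cases j <;> simp [linCurl] <;> ring
      map_smul' := fun c L => by
        ext j
        fin_cases j <;> simp [linCurl] <;> ring }

/-- The trace of a linear map, as a continuous linear functional. -/
def divCLM : (R3 →L[ℝ] R3) →L[ℝ] ℝ :=
  LinearMap.toContinuousLinearMap
    { toFun := fun L => L (EuclideanSpace.single 0 1) 0 + L (EuclideanSpace.single 1 1) 1
        + L (EuclideanSpace.single 2 1) 2
      map_add' := fun L M => by simp; ring
      map_smul' := fun c L => by simp; ring }

theorem curlCLM_apply (L : R3 →L[ℝ] R3) : curlCLM L = linCurl L := rfl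

theorem divCLM_apply (L : R3 →L[ℝ] R3) : divCLM L = L (EuclideanSpace.single 0 1) 0
    + L (EuclideanSpace.single 1 1) 1 + L (EuclideanSpace.single 2 1) 2 := rfl

theorem partialDeriv_apply {u : R3 → R3} (hu : ContDiff ℝ ∞ u) (j k : Fin 3) (x : R3) :
    partialDeriv j (fun y => u y k) x = fderiv ℝ u x (EuclideanSpace.single j 1) k := by
  have h := (hu.differentiable (by simp) x).hasFDerivAt
  have := ((EuclideanSpace.proj k : R3 →L[ℝ] ℝ).hasFDerivAt.comp x h).fderiv
  unfold partialDeriv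
  change fderiv ℝ ((EuclideanSpace.proj k : R3 →L[ℝ] ℝ) ∘ u) x _ = _
  rw [this]
  rfl

theorem curl_eq_curlCLM {u : R3 → R3} (hu : ContDiff ℝ ∞ u) (x : R3) :
    curl u x = curlCLM (fderiv ℝ u x) := by
  rw [curlCLM_apply]
  simp only [curl, linCurl, partialDeriv_apply hu]

theorem isWeakCurl_of_contDiff {A : R3 → R3} (hA : ContDiff ℝ ∞ A) :
    IsWeakCurl U A (curl A) := by
  refine IsWeakCurl.mono (subset_univ U) ⟨?_, ?_, ?_⟩
  · exact (hA.continuous.locallyIntegrable).locallyIntegrableOn _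
  · exact ((contDiff_curl hA).continuous.locallyIntegrable).locallyIntegrableOn _
  · intro η h1 h2 _
    rw [setIntegral_univ, setIntegral_univ]
    have hi : ∀ j k l, Integrable fun x => A x j * partialDeriv k (fun y => η y l) x :=
      fun j k l => integrable_mul_of_hasCompactSupport (contDiff_apply hA j).continuous
        (partialDeriv_contDiff (contDiff_apply h1 l) k).continuous
        (hasCompactSupport_partialDeriv (hasCompactSupport_apply h2 l) k)
    have hi' : ∀ j k l, Integrable fun x => partialDeriv k (fun y => A y j) x * η x l :=
      fun j k l => integrable_mul_of_hasCompactSupport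
        (partialDeriv_contDiff (contDiff_apply hA j) k).continuous
        (contDiff_apply h1 l).continuous (hasCompactSupport_apply h2 l)
    -- `D j k l` is `∂ₖ(Aⱼ ηₗ)`. The difference of the two pairings is the divergence of `η × A`, an
    -- alternating sum of six such terms.
    let D : Fin 3 → Fin 3 → Fin 3 → R3 → ℝ := fun j k l x =>
      A x j * partialDeriv k (fun y => η y l) x + partialDeriv k (fun y => A y j) x * η x l
    have hd : ∀ j k l, Integrable (D j k l) := fun j k l => (hi j k l).add (hi' j k l)
    have h0 : ∀ j k l, ∫ x, D j k l x = 0 := fun j k l => by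
      rw [integral_add (hi j k l) (hi' j k l), integral_mul_partialDeriv (contDiff_apply hA j)
        (contDiff_apply h1 l) (hasCompactSupport_apply h2 l), neg_add_cancel]
    have e : ∀ x, inner ℝ (A x) (curl η x) - inner ℝ (curl A x) (η x) =
        ((D 0 1 2 - D 0 2 1) + (D 1 2 0 - D 1 0 2) + (D 2 0 1 - D 2 1 0)) x := by
      intro x
      rw [inner_R3, inner_R3]
      simp only [curl, D, Pi.add_apply, Pi.sub_apply]
      simp
      ring
    rw [← sub_eq_zero, ← integral_sub, integral_congr_ae (Eventually.of_forall e),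
      integral_add' (((hd _ _ _).sub (hd _ _ _)).add ((hd _ _ _).sub (hd _ _ _)))
        ((hd _ _ _).sub (hd _ _ _)),
      integral_add' ((hd _ _ _).sub (hd _ _ _)) ((hd _ _ _).sub (hd _ _ _)),
      integral_sub' (hd _ _ _) (hd _ _ _), integral_sub' (hd _ _ _) (hd _ _ _),
      integral_sub' (hd _ _ _) (hd _ _ _)]
    · simp only [h0]
      simp
    · exact integrable_inner_of_tsupport_subset
        ((hA.continuous.locallyIntegrable).locallyIntegrableOn univ) (contDiff_curl h1).continuous
        (hasCompactSupport_curl h2) (subset_univ _)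
    · exact integrable_inner_of_tsupport_subset
        (((contDiff_curl hA).continuous.locallyIntegrable).locallyIntegrableOn univ) h1.continuous
        h2 (subset_univ _)

/-! ### The reference potential `F` -/

theorem contDiff_F : ContDiff ℝ ∞ F := by
  rw [contDiff_piLp 2]
  intro j
  have h : ∀ i : Fin 3, ContDiff ℝ ∞ fun x : R3 => x i := fun i =>
    contDiff_apply contDiff_id i
  fin_cases j
  · exact (h 1).neg.div_const 2
  · exact (h 0).div_const 2
  · exact contDiff_const

theorem curl_F (x : R3) : curl F x = beta := by
  have hp : ∀ j i : Fin 3, partialDeriv j (fun y : R3 => y i) x = if i = j then 1 else 0 := by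
    intro j i
    rw [partialDeriv_apply (u := fun y => y) contDiff_id]
    simp
  have hd : ∀ i : Fin 3, DifferentiableAt ℝ (fun y : R3 => y i) x := fun i =>
    (contDiff_apply contDiff_id i : ContDiff ℝ 1 fun y : R3 => y i).differentiable (by simp) x
  have h0 : ∀ j, partialDeriv j (fun y => F y 0) x = if 1 = j then -(1/2) else 0 := by
    intro j
    have : (fun y => F y 0) = fun y => (-(1/2) : ℝ) * y 1 := by
      ext y; simp [F]; ring
    rw [this, partialDeriv, fderiv_const_mul (hd 1)]
    have := hp j 1
    rw [partialDeriv] at this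
    simp only [smul_apply, this]
    split_ifs <;> simp
  have h1 : ∀ j, partialDeriv j (fun y => F y 1) x = if 0 = j then (1/2) else 0 := by
    intro j
    have : (fun y => F y 1) = fun y => ((1/2) : ℝ) * y 0 := by
      ext y; simp [F]; ring
    rw [this, partialDeriv, fderiv_const_mul (hd 0)]
    have := hp j 0
    rw [partialDeriv] at this
    simp only [smul_apply, this]
    split_ifs <;> simp
  have h2 : ∀ j, partialDeriv j (fun y => F y 2) x = 0 := by
    intro j
    have : (fun y => F y 2) = fun y => (0 : ℝ) := by
      ext y; simp [F]
    rw [this, partialDeriv]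
    simp
  simp only [curl, h0, h1, h2, beta]
  ext j
  fin_cases j <;> norm_num [Fin.ext_iff]

theorem isWeakCurl_F : IsWeakCurl U F fun _ => beta := by
  have := isWeakCurl_of_contDiff (U := U) contDiff_F
  rwa [funext curl_F] at this

/-! ### Fields in `Ḣ¹` -/

theorem holderTriple_six : ENNReal.HolderTriple 6 (6 / 5) 1 := ⟨by
  rw [inv_one, ENNReal.inv_div (by simp) (by simp), div_eq_mul_inv]
  calc (6 : ℝ≥0∞)⁻¹ + 5 * 6⁻¹ = (1 + 5) * 6⁻¹ := by rw [add_mul, one_mul]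
    _ = 6 * 6⁻¹ := by norm_num
    _ = 1 := ENNReal.mul_inv_cancel (by simp) (by simp)⟩

/-- The distributional curl of a field in `Ḣ¹` is the curl of its distributional gradient. -/
theorem isWeakCurl_of_tendsto {a : R3 → R3} {u : ℕ → R3 → R3} {D : R3 → R3 →L[ℝ] R3}
    (ha6 : MemLp a 6 volume) (hu : ∀ n, ContDiff ℝ ∞ (u n) ∧ HasCompactSupport (u n))
    (hD : MemLp D 2 volume) (hua : Tendsto (fun n => eLpNorm (u n - a) 6 volume) atTop (𝓝 0))
    (huD : Tendsto (fun n => eLpNorm (fderiv ℝ (u n) - D) 2 volume) atTop (𝓝 0)) :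
    IsWeakCurl univ a fun x => curlCLM (D x) := by
  have hC : MemLp (fun x => curlCLM (D x)) 2 volume := curlCLM.comp_memLp' hD
  refine ⟨?_, ?_, ?_⟩
  · exact MemLp.locallyIntegrableOn (p := 6) (by norm_num) isOpen_univ (by simpa using ha6)
  · exact MemLp.locallyIntegrableOn (p := 2) (by norm_num) isOpen_univ (by simpa using hC)
  · intro η h1 h2 _
    rw [setIntegral_univ, setIntegral_univ]
    have : ENNReal.HolderTriple 6 (6 / 5) 1 := holderTriple_six
    have t1 := tendsto_integral_bilin (p := 6) (q := 6 / 5) (μ := volume) (innerSL ℝ (E := R3))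
      (fun n => memLp_of_contDiff (hu n).1 (hu n).2 6) ha6
      (memLp_of_contDiff (contDiff_curl h1) (hasCompactSupport_curl h2) (6 / 5)) hua
    have t2 := tendsto_integral_bilin (p := 2) (q := 2) (μ := volume)
      ((innerSL ℝ (E := R3)).comp curlCLM)
      (fun n => memLp_of_contDiff ((hu n).1.fderiv_right (m := ∞) (by simp))
        ((hu n).2.fderiv ℝ) 2) hD (memLp_of_contDiff h1 h2 2) huD
    have e : ∀ n, ∫ x, (innerSL ℝ (u n x)) (curl η x) =
        ∫ x, ((innerSL ℝ (E := R3)).comp curlCLM) (fderiv ℝ (u n) x) (η x) := by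
      intro n
      have := (isWeakCurl_of_contDiff (U := univ) (hu n).1).2.2 η h1 h2 (subset_univ _)
      rw [setIntegral_univ, setIntegral_univ] at this
      simpa [curl_eq_curlCLM (hu n).1] using this
    simp only [e] at t1
    exact tendsto_nhds_unique t1 t2

theorem MemHdot1.isWeakCurl {a : R3 → R3} (ha : MemHdot1 a) :
    ∃ C, IsWeakCurl univ a C ∧ MemLp C 2 volume := by
  obtain ⟨ha6, u, D, hu, hD, hua, huD⟩ := ha
  exact ⟨_, isWeakCurl_of_tendsto ha6 hu hD hua huD, curlCLM.comp_memLp' hD⟩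

theorem MemHdot1Div.zero : MemHdot1Div 0 := by
  refine ⟨⟨MemLp.zero, fun _ => 0, 0, fun n => ⟨contDiff_const, HasCompactSupport.zero⟩,
    memLp_of_contDiff contDiff_const HasCompactSupport.zero 2, ?_, ?_⟩, ?_⟩
  · have e : eLpNorm ((0 : R3 → R3) - 0) 6 volume = 0 := by rw [sub_self, eLpNorm_zero]
    exact (tendsto_const_nhds (x := (0 : ℝ≥0∞))).congr fun _ => e.symm
  · have e : fderiv ℝ (0 : R3 → R3) - (fun _ => (0 : R3 →L[ℝ] R3)) = fun _ => 0 := by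
      ext1 x
      simp
    have e' : eLpNorm (fderiv ℝ (0 : R3 → R3) - (fun _ => (0 : R3 →L[ℝ] R3))) 2 volume = 0 := by
      rw [e]
      exact (eLpNorm_congr_norm_ae (g := fun _ : R3 => (0 : ℝ))
        (Eventually.of_forall fun _ => by simp)).trans eLpNorm_zero'
    exact (tendsto_const_nhds (x := (0 : ℝ≥0∞))).congr fun _ => e'.symm
  · intro v _ _
    simp

/-! ### The div-curl estimate on the whole space -/

/-- The operator norm is at most the Hilbert-Schmidt norm, by Cauchy-Schwarz. The definition of `Ḣ¹`
uses the former, while the div-curl identity computes the latter. -/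
theorem opNorm_sq_le (L : R3 →L[ℝ] R3) :
    ‖L‖ ^ 2 ≤ ∑ j : Fin 3, ‖L (EuclideanSpace.single j 1)‖ ^ 2 := by
  have h : ‖L‖ ≤ √(∑ j : Fin 3, ‖L (EuclideanSpace.single j 1)‖ ^ 2) := by
    refine L.opNorm_le_bound (Real.sqrt_nonneg _) fun x => ?_
    have hx : x = ∑ j : Fin 3, x j • (EuclideanSpace.single j 1 : R3) := by
      ext i
      simp [Pi.single_apply]
    have : ‖L x‖ ≤ ∑ j : Fin 3, ‖L (EuclideanSpace.single j 1)‖ * ‖x j‖ := by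
      conv_lhs => rw [hx, map_sum]
      refine (norm_sum_le _ _).trans (Finset.sum_le_sum fun j _ => ?_)
      rw [map_smul, norm_smul, mul_comm]
    refine this.trans ((Real.sum_mul_le_sqrt_mul_sqrt _ _ _).trans ?_)
    rw [EuclideanSpace.norm_eq]
  calc ‖L‖ ^ 2 ≤ _ := pow_le_pow_left₀ (norm_nonneg _) h 2
    _ = _ := Real.sq_sqrt (by positivity)

/-- Pointwise, the squared Hilbert-Schmidt norm of the gradient equals `|curl u|² + |div u|²` minus
twice the sum of three null forms, and these integrate to zero. -/
theorem integral_sq_fderiv_le {u : R3 → R3} (hu : ContDiff ℝ ∞ u) (hc : HasCompactSupport u) :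
    ∫ x, ‖fderiv ℝ u x‖ ^ 2 ≤
      (∫ x, ‖curlCLM (fderiv ℝ u x)‖ ^ 2) + ∫ x, ‖divCLM (fderiv ℝ u x)‖ ^ 2 := by
  have hDc : Continuous (fderiv ℝ u) := (hu.fderiv_right (m := ∞) (by simp)).continuous
  have hDs : HasCompactSupport (fderiv ℝ u) := hc.fderiv ℝ
  have hci : ∀ g : (R3 →L[ℝ] R3) → ℝ, Continuous g → g 0 = 0 →
      Integrable fun x => g (fderiv ℝ u x) := by
    intro g hg h0
    exact (hg.comp hDc).integrable_of_hasCompactSupport (hDs.comp_left h0)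
  have hi : ∀ j k l m, Integrable fun x =>
      partialDeriv j (fun y => u y k) x * partialDeriv l (fun y => u y m) x :=
    fun j k l m => integrable_mul_of_hasCompactSupport
      (partialDeriv_contDiff (contDiff_apply hu k) j).continuous
      (partialDeriv_contDiff (contDiff_apply hu m) l).continuous
      (hasCompactSupport_partialDeriv (hasCompactSupport_apply hc m) l)
  let D : Fin 3 → Fin 3 → R3 → ℝ := fun j k x =>
    partialDeriv j (fun y => u y j) x * partialDeriv k (fun y => u y k) x
      - partialDeriv k (fun y => u y j) x * partialDeriv j (fun y => u y k) x
  have hd : ∀ j k, Integrable (D j k) := fun j k => (hi _ _ _ _).sub (hi _ _ _ _)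
  have h0 : ∀ j k, ∫ x, D j k x = 0 := fun j k => by
    rw [integral_sub (hi _ _ _ _) (hi _ _ _ _), integral_partialDeriv_mul_comm
      (contDiff_apply hu j) (contDiff_apply hu k) (hasCompactSupport_apply hc k), sub_self]
  have e : ∀ x, ∑ j : Fin 3, ‖fderiv ℝ u x (EuclideanSpace.single j 1)‖ ^ 2 =
      (((fun x => ‖curlCLM (fderiv ℝ u x)‖ ^ 2) + (fun x => ‖divCLM (fderiv ℝ u x)‖ ^ 2))
        - (D 0 1 + D 0 2 + D 1 2 + D 0 1 + D 0 2 + D 1 2)) x := by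
    intro x
    simp only [Pi.add_apply, Pi.sub_apply, D, partialDeriv_apply hu, divCLM_apply, curlCLM_apply,
      EuclideanSpace.norm_sq_eq, linCurl, Fin.sum_univ_three, Real.norm_eq_abs, sq_abs]
    simp
    ring
  have hs : Integrable (D 0 1 + D 0 2 + D 1 2 + D 0 1 + D 0 2 + D 1 2) :=
    (((((hd 0 1).add (hd 0 2)).add (hd 1 2)).add (hd 0 1)).add (hd 0 2)).add (hd 1 2)
  have hs0 : ∫ x, (D 0 1 + D 0 2 + D 1 2 + D 0 1 + D 0 2 + D 1 2) x = 0 := by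
    rw [integral_add' ((((((hd 0 1).add (hd 0 2)).add (hd 1 2)).add (hd 0 1)).add (hd 0 2)))
      (hd 1 2), integral_add' ((((hd 0 1).add (hd 0 2)).add (hd 1 2)).add (hd 0 1)) (hd 0 2),
      integral_add' (((hd 0 1).add (hd 0 2)).add (hd 1 2)) (hd 0 1),
      integral_add' ((hd 0 1).add (hd 0 2)) (hd 1 2), integral_add' (hd 0 1) (hd 0 2)]
    simp [h0]
  have i1 := hci (fun L => ‖curlCLM L‖ ^ 2) (curlCLM.continuous.norm.pow 2) (by simp)
  have i2 := hci (fun L => ‖divCLM L‖ ^ 2) (divCLM.continuous.norm.pow 2) (by simp)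
  calc ∫ x, ‖fderiv ℝ u x‖ ^ 2
      ≤ ∫ x, ∑ j : Fin 3, ‖fderiv ℝ u x (EuclideanSpace.single j 1)‖ ^ 2 := by
        refine integral_mono (hci (fun L => ‖L‖ ^ 2) (continuous_norm.pow 2) (by simp)) ?_ fun x => opNorm_sq_le _
        refine integrable_finsetSum _ fun j _ => ?_
        exact hci (fun L => ‖L (EuclideanSpace.single j 1)‖ ^ 2)
          ((ContinuousLinearMap.apply ℝ R3
            (EuclideanSpace.single j 1 : R3)).continuous.norm.pow 2) (by simp)
    _ = _ := by
        rw [integral_congr_ae (Eventually.of_forall e), integral_sub' (i1.add i2) hs,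
          integral_add' i1 i2, hs0, sub_zero]

theorem eLpNorm_two_sq {E : Type*} [NormedAddCommGroup E] {f : R3 → E} (hf : MemLp f 2 volume) :
    eLpNorm f 2 volume ^ 2 = ENNReal.ofReal (∫ x, ‖f x‖ ^ 2) := by
  rw [ofReal_integral_eq_lintegral_ofReal hf.norm.integrable_sq
    (Eventually.of_forall fun x => by positivity)]
  rw [eLpNorm_eq_lintegral_rpow_enorm_toReal (by simp) (by simp), ← ENNReal.rpow_natCast,
    ← ENNReal.rpow_mul]
  simp only [ENNReal.toReal_ofNat, Nat.cast_ofNat]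
  norm_num

theorem eLpNorm_fderiv_le {u : R3 → R3} (hu : ContDiff ℝ ∞ u) (hc : HasCompactSupport u) :
    eLpNorm (fderiv ℝ u) 2 volume ≤ eLpNorm (fun x => curlCLM (fderiv ℝ u x)) 2 volume
      + eLpNorm (fun x => divCLM (fderiv ℝ u x)) 2 volume := by
  have h := memLp_of_contDiff (hu.fderiv_right (m := ∞) (by simp)) (hc.fderiv ℝ) 2
  have h1 : MemLp (fun x => curlCLM (fderiv ℝ u x)) 2 volume := curlCLM.comp_memLp' h
  have h2 : MemLp (fun x => divCLM (fderiv ℝ u x)) 2 volume := divCLM.comp_memLp' h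
  rw [← ENNReal.pow_le_pow_left_iff two_ne_zero]
  calc eLpNorm (fderiv ℝ u) 2 volume ^ 2
      ≤ eLpNorm (fun x => curlCLM (fderiv ℝ u x)) 2 volume ^ 2
        + eLpNorm (fun x => divCLM (fderiv ℝ u x)) 2 volume ^ 2 := by
        rw [eLpNorm_two_sq h, eLpNorm_two_sq h1, eLpNorm_two_sq h2, ← ENNReal.ofReal_add
          (integral_nonneg fun x => by positivity) (integral_nonneg fun x => by positivity)]
        exact ENNReal.ofReal_le_ofReal (integral_sq_fderiv_le hu hc)
    _ ≤ _ := by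
        rw [add_sq]
        exact add_le_add_left (le_add_right le_rfl) _

/-- Since `L D` vanishes almost everywhere, `L (f n)` equals `L (f n - D)`. -/
theorem tendsto_eLpNorm_clm {E : Type*} [NormedAddCommGroup E] [NormedSpace ℝ E]
    {f : ℕ → R3 → R3 →L[ℝ] R3} {D : R3 → R3 →L[ℝ] R3} (L : (R3 →L[ℝ] R3) →L[ℝ] E)
    (h : Tendsto (fun n => eLpNorm (f n - D) 2 volume) atTop (𝓝 0))
    (h0 : (fun x => L (D x)) =ᵐ[volume] 0) :
    Tendsto (fun n => eLpNorm (fun x => L (f n x)) 2 volume) atTop (𝓝 0) := by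
  have h1 : Tendsto (fun n => ‖L‖₊ * eLpNorm (f n - D) 2 volume) atTop (𝓝 0) := by
    simpa using ENNReal.Tendsto.const_mul (a := (‖L‖₊ : ℝ≥0∞)) h (Or.inr ENNReal.coe_ne_top)
  refine tendsto_of_tendsto_of_tendsto_of_le_of_le tendsto_const_nhds h1 (fun n => bot_le) ?_
  intro n
  refine eLpNorm_le_nnreal_smul_eLpNorm_of_ae_le_mul ?_ 2
  filter_upwards [h0] with x hx
  have : L (f n x) = L ((f n - D) x) := by
    rw [Pi.sub_apply, map_sub, show L (D x) = 0 from hx, sub_zero]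
  rw [this]
  exact L.le_opNNNorm _

theorem integral_inner_gradient_eq {u : R3 → R3} {v : R3 → ℝ} (hu : ContDiff ℝ ∞ u)
    (hv : ContDiff ℝ ∞ v) (hc : HasCompactSupport v) :
    ∫ x, inner ℝ (u x) (gradient v x) = - ∫ x, v x * divCLM (fderiv ℝ u x) := by
  have hi : ∀ j, Integrable fun x => u x j * partialDeriv j v x := fun j =>
    integrable_mul_of_hasCompactSupport (contDiff_apply hu j).continuous
      (partialDeriv_contDiff hv j).continuous (hasCompactSupport_partialDeriv hc j)
  have hi' : ∀ j, Integrable fun x => partialDeriv j (fun y => u y j) x * v x := fun j =>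
    integrable_mul_of_hasCompactSupport (partialDeriv_contDiff (contDiff_apply hu j) j).continuous
      hv.continuous hc
  have e : ∀ x, inner ℝ (u x) (gradient v x) = ((fun x => u x 0 * partialDeriv 0 v x) +
      (fun x => u x 1 * partialDeriv 1 v x) + (fun x => u x 2 * partialDeriv 2 v x)) x := by
    intro x
    rw [inner_R3]
    simp [gradient_apply]
  have e' : ∀ x, v x * divCLM (fderiv ℝ u x) = ((fun x => partialDeriv 0 (fun y => u y 0) x * v x)
      + (fun x => partialDeriv 1 (fun y => u y 1) x * v x)
      + (fun x => partialDeriv 2 (fun y => u y 2) x * v x)) x := by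
    intro x
    simp only [Pi.add_apply, divCLM_apply, partialDeriv_apply hu]
    ring
  rw [integral_congr_ae (Eventually.of_forall e), integral_congr_ae (Eventually.of_forall e'),
    integral_add' ((hi 0).add (hi 1)) (hi 2), integral_add' (hi 0) (hi 1),
    integral_add' ((hi' 0).add (hi' 1)) (hi' 2), integral_add' (hi' 0) (hi' 1),
    integral_mul_partialDeriv (contDiff_apply hu 0) hv hc,
    integral_mul_partialDeriv (contDiff_apply hu 1) hv hc,
    integral_mul_partialDeriv (contDiff_apply hu 2) hv hc]
  ring

/-- A divergence free field in `Ḣ¹` with vanishing curl vanishes. -/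
theorem MemHdot1Div.ae_eq_zero {a C : R3 → R3} (ha : MemHdot1Div a) (hC : IsWeakCurl univ a C)
    (h0 : C =ᵐ[volume] 0) : a =ᵐ[volume] 0 := by
  obtain ⟨⟨ha6, u, D, hu, hD, hua, huD⟩, hdiv⟩ := ha
  have hcurl : (fun x => curlCLM (D x)) =ᵐ[volume] 0 := by
    have := (isWeakCurl_of_tendsto ha6 hu hD hua huD).ae_eq isOpen_univ hC
    rw [Measure.restrict_univ] at this
    exact this.trans h0
  have hD' : MemLp (fun x => divCLM (D x)) 2 volume := divCLM.comp_memLp' hD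
  -- The weak divergence condition is on `a`. Integration by parts on the approximants `u n`,
  -- followed by the limit on both sides, transfers it to the trace of `D`.
  have htr : (fun x => divCLM (D x)) =ᵐ[volume] 0 := by
    refine ae_eq_zero_of_integral_contDiff_smul_eq_zero
      (hD'.locallyIntegrable (by norm_num)) fun v hv hc => ?_
    have : ENNReal.HolderTriple 6 (6 / 5) 1 := holderTriple_six
    have hg : ContDiff ℝ ∞ (gradient v) := by
      rw [contDiff_piLp 2]
      intro j
      simpa only [gradient_apply] using partialDeriv_contDiff hv j
    have hgc : HasCompactSupport (gradient v) :=
      (hc.fderiv ℝ).comp_left (g := (InnerProductSpace.toDual ℝ R3).symm) (map_zero _)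
    have t1 := tendsto_integral_bilin (p := 6) (q := 6 / 5) (μ := volume) (innerSL ℝ (E := R3))
      (fun n => memLp_of_contDiff (hu n).1 (hu n).2 6) ha6 (memLp_of_contDiff hg hgc (6 / 5)) hua
    have t2 := tendsto_integral_bilin (p := 2) (q := 2) (μ := volume)
      (((ContinuousLinearMap.mul ℝ ℝ)).comp divCLM)
      (fun n => memLp_of_contDiff ((hu n).1.fderiv_right (m := ∞) (by simp))
        ((hu n).2.fderiv ℝ) 2) hD (memLp_of_contDiff hv hc 2) huD
    have e : ∀ n, ∫ x, (innerSL ℝ (u n x)) (gradient v x) =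
        - ∫ x, ((ContinuousLinearMap.mul ℝ ℝ).comp divCLM) (fderiv ℝ (u n) x) (v x) := by
      intro n
      simpa [mul_comm] using integral_inner_gradient_eq (hu n).1 hv hc
    simp only [e] at t1
    have t3 := tendsto_nhds_unique t1 t2.neg
    have t4 : ∫ x, (innerSL ℝ (a x)) (gradient v x) = 0 := hdiv v hv hc
    rw [t4] at t3
    have := neg_eq_zero.1 t3.symm
    simpa [mul_comm] using this
  -- Curl and divergence of `u n` tend to zero in `L²`, so by the div-curl estimate the full
  -- gradient does too.
  have hDu : Tendsto (fun n => eLpNorm (fderiv ℝ (u n)) 2 volume) atTop (𝓝 0) := by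
    have h := (tendsto_eLpNorm_clm curlCLM huD hcurl).add (tendsto_eLpNorm_clm divCLM huD htr)
    rw [add_zero] at h
    exact tendsto_of_tendsto_of_tendsto_of_le_of_le tendsto_const_nhds h (fun n => bot_le)
      fun n => eLpNorm_fderiv_le (hu n).1 (hu n).2
  -- Sobolev's inequality in dimension three, where `1/6 = 1/2 - 1/3`.
  have hu6 : Tendsto (fun n => eLpNorm (u n) 6 volume) atTop (𝓝 0) := by
    have h1 : Tendsto (fun n => (SNormLESNormFDerivOfEqConst R3 (volume : Measure R3) 2 : ℝ≥0∞)
        * eLpNorm (fderiv ℝ (u n)) 2 volume) atTop (𝓝 0) := by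
      simpa using ENNReal.Tendsto.const_mul
        (a := (SNormLESNormFDerivOfEqConst R3 (volume : Measure R3) 2 : ℝ≥0∞)) hDu
        (Or.inr ENNReal.coe_ne_top)
    refine tendsto_of_tendsto_of_tendsto_of_le_of_le tendsto_const_nhds h1 (fun n => bot_le) ?_
    intro n
    exact eLpNorm_le_eLpNorm_fderiv_of_eq (μ := (volume : Measure R3)) (p := 2) (p' := 6)
      ((hu n).1.of_le (by norm_cast)) (hu n).2 (by norm_num) (by simp) (by simp; norm_num)
  have hz : eLpNorm a 6 volume ≤ 0 := by
    have h := hu6.add hua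
    rw [add_zero] at h
    refine ge_of_tendsto' h fun n => ?_
    have e : a = u n - (u n - a) := by simp
    calc eLpNorm a 6 volume = eLpNorm (u n - (u n - a)) 6 volume := by rw [← e]
      _ ≤ _ := eLpNorm_sub_le (memLp_of_contDiff (hu n).1 (hu n).2 6).1
          ((memLp_of_contDiff (hu n).1 (hu n).2 6).1.sub ha6.1) (by norm_num)
  exact (eLpNorm_eq_zero_iff ha6.1 (by norm_num)).1 (le_antisymm hz bot_le)

/-! ### Integrals over segments -/

/-- The dilation by `τ` has Jacobian `τ³`, and `τ⁻³ ≤ 8`. -/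
theorem lintegral_comp_add_smul_le {h : R3 → ℝ≥0∞} (hh : Measurable h) {τ : ℝ} (hτ : 1 / 2 ≤ τ)
    (c : R3) : ∫⁻ x, h (c + τ • x) ≤ 8 * ∫⁻ x, h x := by
  have hτ0 : τ ≠ 0 := by positivity
  have h1 : ∫⁻ x, h (c + τ • x) = ENNReal.ofReal |(τ ^ 3)⁻¹| * ∫⁻ x, h x := by
    have := lintegral_map (μ := (volume : Measure R3)) (f := fun y => h (c + y))
      (g := fun x => τ • x) (hh.comp (measurable_const_add c)) (measurable_const_smul τ)
    rw [Measure.map_addHaar_smul volume hτ0, lintegral_smul_measure,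
      lintegral_add_left_eq_self] at this
    simpa using this.symm
  rw [h1]
  gcongr
  rw [show (8 : ℝ≥0∞) = ENNReal.ofReal 8 by simp]
  apply ENNReal.ofReal_le_ofReal
  have : (1 / 2 : ℝ) ^ 3 ≤ τ ^ 3 := pow_le_pow_left₀ (by norm_num) hτ 3
  rw [abs_of_pos (by positivity)]
  calc (τ ^ 3)⁻¹ ≤ ((1 / 2 : ℝ) ^ 3)⁻¹ := inv_anti₀ (by norm_num) this
    _ = 8 := by norm_num

/-- By Tonelli, integrate in `x` before `t`: for fixed `y` and `t` the point `y + τ (x - y)` is a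
dilation of `x` by a factor of at least `1/2`. -/
theorem lintegral_segment_le {h : R3 → ℝ≥0∞} (hh : Measurable h) {B : Set R3} {I : Set ℝ}
    (hI : MeasurableSet I) {τ : ℝ → ℝ} (hτm : Measurable τ) (hτ : ∀ t ∈ I, 1 / 2 ≤ τ t) :
    ∫⁻ y in B, ∫⁻ x in B, ∫⁻ t in I, h (y + τ t • (x - y)) ≤
      volume B * (volume I * (8 * ∫⁻ x, h x)) := by
  have hin : ∀ y, ∫⁻ x in B, ∫⁻ t in I, h (y + τ t • (x - y)) ≤
      volume I * (8 * ∫⁻ x, h x) := by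
    intro y
    rw [lintegral_lintegral_swap]
    · calc ∫⁻ t in I, ∫⁻ x in B, h (y + τ t • (x - y))
          ≤ ∫⁻ t in I, 8 * ∫⁻ x, h x := by
            refine setLIntegral_mono' hI fun t ht => ?_
            refine (setLIntegral_le_lintegral _ _).trans ?_
            have := lintegral_comp_add_smul_le hh (hτ t ht) (y - τ t • y)
            refine le_trans (le_of_eq (lintegral_congr fun x => ?_)) this
            congr 1
            rw [smul_sub]
            abel
        _ = _ := by rw [setLIntegral_const, mul_comm]
    · apply Measurable.aemeasurable
      apply hh.comp
      fun_prop
  calc _ ≤ ∫⁻ y in B, volume I * (8 * ∫⁻ x, h x) := lintegral_mono fun y => hin y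
    _ = _ := by rw [setLIntegral_const, mul_comm]

/-- From almost every point of a ball, an integrable density has finite integral along the
segment to almost every other point. -/
theorem exists_lintegral_segment_lt_top {x₀ : R3} {r : ℝ} (hr : 0 < r) {g : R3 → ℝ≥0∞}
    (hg : Measurable g) (hfin : ∫⁻ x in Metric.ball x₀ r, g x ≠ ⊤) :
    ∃ y ∈ Metric.ball x₀ r, ∀ᵐ x ∂volume.restrict (Metric.ball x₀ r),
      ∫⁻ t in Icc (0 : ℝ) 1, g (y + t • (x - y)) < ⊤ := by
  set B := Metric.ball x₀ r with hB
  have hBm : MeasurableSet B := measurableSet_ball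
  have hBv : volume B < ⊤ := measure_ball_lt_top
  -- Extension by zero makes the whole-space estimates applicable. By convexity the segments stay in
  -- the ball, so on them `h` and `g` agree.
  set h := B.indicator g with hh
  have hhm : Measurable h := hg.indicator hBm
  have hhfin : ∫⁻ x, h x < ⊤ := by
    rw [hh, lintegral_indicator hBm]
    exact hfin.lt_top
  have hfinI : ∀ I : Set ℝ, volume I < ⊤ →
      volume B * (volume I * (8 * ∫⁻ x, h x)) < ⊤ := fun I hI =>
    ENNReal.mul_lt_top hBv (ENNReal.mul_lt_top hI (ENNReal.mul_lt_top (by simp) hhfin))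
  have hmeas : ∀ I : Set ℝ, Measurable fun p : R3 × R3 =>
      ∫⁻ t in I, h (p.1 + t • (p.2 - p.1)) := by
    intro I
    apply Measurable.lintegral_prod_right' (f := fun q : (R3 × R3) × ℝ =>
      h (q.1.1 + q.2 • (q.1.2 - q.1.1)))
    apply hhm.comp
    fun_prop
  have h2 : ∫⁻ y in B, ∫⁻ x in B, ∫⁻ t in Icc (1 / 2 : ℝ) 1, h (y + t • (x - y)) < ⊤ :=
    (lintegral_segment_le hhm measurableSet_Icc measurable_id fun t ht => ht.1).trans_lt
      (hfinI _ (by simp))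
  -- For `t ≤ 1/2` the dilation in `x` degenerates, so the endpoints exchange roles: `y + t (x - y)
  -- = x + (1 - t) (y - x)`, with factor `1 - t ≥ 1/2`.
  have h1 : ∫⁻ y in B, ∫⁻ x in B, ∫⁻ t in Icc (0 : ℝ) (1 / 2), h (y + t • (x - y)) < ⊤ := by
    rw [lintegral_lintegral_swap (hmeas _).aemeasurable]
    have := (lintegral_segment_le (B := B) (I := Icc (0 : ℝ) (1 / 2)) (τ := fun t => 1 - t) hhm
      measurableSet_Icc (by fun_prop) fun t ht => by linarith [ht.2]).trans_lt (hfinI _ (by simp))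
    refine lt_of_le_of_lt (le_of_eq ?_) this
    refine lintegral_congr fun y => lintegral_congr fun x => lintegral_congr fun t => ?_
    congr 1
    rw [sub_smul, one_smul, smul_sub, smul_sub]
    abel
  have htot : ∫⁻ y in B, ∫⁻ x in B, ∫⁻ t in Icc (0 : ℝ) 1, h (y + t • (x - y)) < ⊤ := by
    have hsplit : ∀ y x : R3, ∫⁻ t in Icc (0 : ℝ) 1, h (y + t • (x - y)) ≤
        (∫⁻ t in Icc (0 : ℝ) (1 / 2), h (y + t • (x - y)))
          + ∫⁻ t in Icc (1 / 2 : ℝ) 1, h (y + t • (x - y)) := by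
      intro y x
      rw [← Icc_union_Icc_eq_Icc (a := (0 : ℝ)) (b := 1 / 2) (c := 1) (by norm_num) (by norm_num)]
      exact lintegral_union_le _ _ _
    calc _ ≤ ∫⁻ y in B, ∫⁻ x in B, ((∫⁻ t in Icc (0 : ℝ) (1 / 2), h (y + t • (x - y)))
          + ∫⁻ t in Icc (1 / 2 : ℝ) 1, h (y + t • (x - y))) :=
          lintegral_mono fun y => lintegral_mono fun x => hsplit y x
      _ = ∫⁻ y in B, ((∫⁻ x in B, ∫⁻ t in Icc (0 : ℝ) (1 / 2), h (y + t • (x - y)))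
          + ∫⁻ x in B, ∫⁻ t in Icc (1 / 2 : ℝ) 1, h (y + t • (x - y))) := by
          refine lintegral_congr fun y => ?_
          exact lintegral_add_left ((hmeas _).comp measurable_prodMk_left) _
      _ = _ := lintegral_add_left (Measurable.lintegral_prod_right' (hmeas _)) _
      _ < ⊤ := ENNReal.add_lt_top.2 ⟨h1, h2⟩
  have hae := ae_lt_top (Measurable.lintegral_prod_right' (ν := volume.restrict B)
    (hmeas (Icc (0 : ℝ) 1))) htot.ne
  have hne : (ae (volume.restrict B)).NeBot := by
    rw [ae_restrict_neBot]
    exact (Metric.measure_ball_pos volume x₀ hr).ne'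
  obtain ⟨y, hy, hyB⟩ := (hae.and (ae_restrict_mem hBm)).exists
  refine ⟨y, hyB, ?_⟩
  filter_upwards [ae_lt_top ((hmeas (Icc (0 : ℝ) 1)).comp measurable_prodMk_left) hy.ne,
    ae_restrict_mem hBm] with x hx hxB
  refine lt_of_le_of_lt (le_of_eq (setLIntegral_congr_fun measurableSet_Icc fun t ht => ?_)) hx
  have : y + t • (x - y) ∈ B := by
    have := (convex_ball x₀ r).add_smul_sub_mem hyB hxB ht
    exact this
  simp [hh, indicator_of_mem this]

theorem enorm_sub_le_lintegral_segment {w : R3 → ℝ} (hw : ContDiff ℝ ∞ w) (x y : R3) :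
    ‖w x - w y‖ₑ ≤ ‖x - y‖ₑ * ∫⁻ t in Icc (0 : ℝ) 1, ‖fderiv ℝ w (y + t • (x - y))‖ₑ := by
  have hl : ∀ t : ℝ, HasDerivAt (fun t : ℝ => y + t • (x - y)) (x - y) t := fun t => by
    simpa using ((hasDerivAt_id t).smul_const (x - y)).const_add y
  have hd : ∀ t : ℝ, HasDerivAt (fun t : ℝ => w (y + t • (x - y)))
      (fderiv ℝ w (y + t • (x - y)) (x - y)) t := fun t =>
    (hw.differentiable (by simp) _).hasFDerivAt.comp_hasDerivAt t (hl t)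
  have hc : ContDiff ℝ 1 fun t : ℝ => w (y + t • (x - y)) := by
    apply (hw.of_le (by norm_cast)).comp
    fun_prop
  have := enorm_sub_le_lintegral_deriv_of_contDiffOn_Icc (a := 0) (b := 1) hc.contDiffOn zero_le_one
  simp only [one_smul, zero_smul, add_zero, add_sub_cancel] at this
  refine this.trans ?_
  rw [← lintegral_const_mul' _ _ enorm_ne_top]
  refine lintegral_mono fun t => ?_
  rw [(hd t).deriv, mul_comm]
  exact ContinuousLinearMap.le_opENorm _ _

/-! ### Convergence of potentials up to constants -/

/-- Normalise by the value at a suitable point `y`. The increments of `v n x - v n y` are bounded by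
integrals of `|∇(v (n+1) - v n)|` along the segment from `y` to `x`, and these are summable for
almost every `x`. -/
theorem exists_tendsto_sub_const_ball {v : ℕ → R3 → ℝ} (hv : ∀ n, ContDiff ℝ ∞ (v n)) {x₀ : R3}
    {r : ℝ} (hr : 0 < r)
    (hs : ∑' n, ∫⁻ x in Metric.ball x₀ r, ‖fderiv ℝ (fun y => v (n + 1) y - v n y) x‖ₑ ≠ ⊤) :
    ∃ d : ℕ → ℝ, ∀ᵐ x ∂volume.restrict (Metric.ball x₀ r),
      ∃ l, Tendsto (fun n => v n x - d n) atTop (𝓝 l) := by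
  have hw : ∀ n, ContDiff ℝ ∞ fun y => v (n + 1) y - v n y := fun n => (hv _).sub (hv n)
  have hm : ∀ n, Measurable fun x => ‖fderiv ℝ (fun y => v (n + 1) y - v n y) x‖ₑ := fun n =>
    ((hw n).continuous_fderiv (by simp)).measurable.enorm
  obtain ⟨y, -, hy⟩ := exists_lintegral_segment_lt_top (x₀ := x₀) hr
    (g := fun x => ∑' n, ‖fderiv ℝ (fun y => v (n + 1) y - v n y) x‖ₑ)
    (Measurable.tsum hm)
    (by rwa [lintegral_tsum fun n => (hm n).aemeasurable])
  refine ⟨fun n => v n y, ?_⟩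
  filter_upwards [hy] with x hx
  have hl : Measurable fun t : ℝ => y + t • (x - y) := by fun_prop
  rw [lintegral_tsum (f := fun n (t : ℝ) =>
    ‖fderiv ℝ (fun y => v (n + 1) y - v n y) (y + t • (x - y))‖ₑ)
    fun n => ((hm n).comp hl).aemeasurable] at hx
  refine cauchySeq_tendsto_of_complete (cauchySeq_of_edist_le_of_tsum_ne_top
    (fun n => ‖x - y‖ₑ * ∫⁻ t in Icc (0 : ℝ) 1,
      ‖fderiv ℝ (fun y => v (n + 1) y - v n y) (y + t • (x - y))‖ₑ) (fun n => ?_) ?_)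
  · rw [edist_comm, edist_eq_enorm_sub]
    refine le_trans (le_of_eq ?_) (enorm_sub_le_lintegral_segment (hw n) x y)
    congr 1
    ring
  · rw [ENNReal.tsum_mul_left]
    exact ENNReal.mul_ne_top enorm_ne_top hx.ne

/-- Each ball in `Ω` has its own normalising constants. On overlapping balls two choices differ by a
convergent sequence, so by connectedness the constants of one ball serve throughout `Ω`. -/
theorem exists_tendsto_sub_const {v : ℕ → R3 → ℝ} (hv : ∀ n, ContDiff ℝ ∞ (v n))
    (hΩ : IsOpen Ω) (hc : IsConnected Ω)
    (hs : ∑' n, ∫⁻ x in Ω, ‖fderiv ℝ (fun y => v (n + 1) y - v n y) x‖ₑ ≠ ⊤) :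
    ∃ c : ℕ → ℝ, ∀ᵐ x ∂volume.restrict Ω, ∃ l, Tendsto (fun n => v n x - c n) atTop (𝓝 l) := by
  have hball : ∀ x r, 0 < r → Metric.ball x r ⊆ Ω → ∃ d : ℕ → ℝ,
      ∀ᵐ y ∂volume.restrict (Metric.ball x r),
        ∃ l, Tendsto (fun n => v n y - d n) atTop (𝓝 l) := by
    intro x r hr hsub
    refine exists_tendsto_sub_const_ball hv hr (ne_top_of_le_ne_top hs ?_)
    exact ENNReal.tsum_le_tsum fun n => lintegral_mono_set hsub
  obtain ⟨x₀, hx₀⟩ := hc.nonempty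
  obtain ⟨r₀, hr₀, hb₀⟩ := Metric.isOpen_iff.1 hΩ x₀ hx₀
  obtain ⟨c, hcc⟩ := hball x₀ r₀ hr₀ hb₀
  refine ⟨c, ?_⟩
  -- The points near which the constants `c` work. This set is open and, relative to `Ω`, closed.
  set u : Set R3 := {x | ∃ r > 0, ∀ᵐ y ∂volume.restrict (Metric.ball x r),
    ∃ l, Tendsto (fun n => v n y - c n) atTop (𝓝 l)} with hu
  have huo : IsOpen u := by
    refine Metric.isOpen_iff.2 fun x ⟨r, hr, hx⟩ => ⟨r, hr, fun y hy => ?_⟩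
    rw [Metric.mem_ball] at hy
    exact ⟨r - dist y x, by linarith, ae_restrict_of_ae_restrict_of_subset
      (Metric.ball_subset_ball' (by linarith)) hx⟩
  have hsub : Ω ⊆ u := by
    refine hc.isPreconnected.subset_of_closure_inter_subset huo ⟨x₀, hx₀, r₀, hr₀, hcc⟩ ?_
    rintro x ⟨hxu, hxΩ⟩
    obtain ⟨r, hr, hb⟩ := Metric.isOpen_iff.1 hΩ x hxΩ
    obtain ⟨d, hd⟩ := hball x r hr hb
    obtain ⟨y, ⟨s, hs, hy⟩, hyx⟩ := Metric.mem_closure_iff.1 hxu r hr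
    have hne : (ae (volume.restrict (Metric.ball x r ∩ Metric.ball y s))).NeBot := by
      rw [ae_restrict_neBot]
      refine ((Metric.isOpen_ball.inter Metric.isOpen_ball).measure_pos volume
        ⟨y, ?_, Metric.mem_ball_self hs⟩).ne'
      rwa [Metric.mem_ball, dist_comm]
    -- The overlap has positive measure, so both normalisations converge at some point `z`. Hence `d
    -- n - c n` converges, to `l₂ - l₁`.
    obtain ⟨z, ⟨l₁, hl₁⟩, ⟨l₂, hl₂⟩⟩ := ((ae_restrict_of_ae_restrict_of_subset
      inter_subset_left hd).and (ae_restrict_of_ae_restrict_of_subset inter_subset_right hy)).exists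
    refine ⟨r, hr, ?_⟩
    filter_upwards [hd] with p ⟨l, hl⟩
    refine ⟨l + (l₂ - l₁), (hl.add (hl₂.sub hl₁)).congr fun n => ?_⟩
    ring
  rw [ae_restrict_iff' hΩ.measurableSet, ae_iff]
  refine measure_null_of_locally_null _ fun x hx => ?_
  have hxΩ : x ∈ Ω := by
    by_contra h
    exact hx fun h' => absurd h' h
  obtain ⟨r, hr, h⟩ := hsub hxΩ
  rw [ae_restrict_iff' measurableSet_ball, ae_iff] at h
  refine ⟨_ , inter_mem_nhdsWithin _ (Metric.ball_mem_nhds x hr), measure_mono_null ?_ h⟩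
  rintro y ⟨hy1, hy2⟩ h'
  exact hy1 fun _ => h' hy2

/-! ### The gauge projection -/

theorem gradient_contDiff {v : R3 → ℝ} (hv : ContDiff ℝ ∞ v) : ContDiff ℝ ∞ (gradient v) := by
  rw [contDiff_piLp 2]
  intro j
  simpa only [gradient_apply] using partialDeriv_contDiff hv j

theorem hasCompactSupport_gradient {v : R3 → ℝ} (hc : HasCompactSupport v) :
    HasCompactSupport (gradient v) :=
  (hc.fderiv ℝ).comp_left (g := (InnerProductSpace.toDual ℝ R3).symm) (map_zero _)

theorem memLp_gradient {v : R3 → ℝ} (hv : ContDiff ℝ ∞ v) (hc : HasCompactSupport v) :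
    MemLp (gradient v) 2 (volume.restrict Ω) :=
  (memLp_of_contDiff (gradient_contDiff hv) (hasCompactSupport_gradient hc) 2).restrict Ω

theorem gradient_add' {v w : R3 → ℝ} (hv : ContDiff ℝ ∞ v) (hw : ContDiff ℝ ∞ w) (x : R3) :
    gradient (fun y => v y + w y) x = gradient v x + gradient w x := by
  unfold gradient
  rw [fderiv_fun_add (hv.differentiable (by simp) x) (hw.differentiable (by simp) x), map_add]

theorem gradient_const_mul' {v : R3 → ℝ} (hv : ContDiff ℝ ∞ v) (c : ℝ) (x : R3) :
    gradient (fun y => c * v y) x = c • gradient v x := by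
  unfold gradient
  rw [fderiv_const_mul (hv.differentiable (by simp) x), map_smulₛₗ]
  simp

/-- Gradients of test functions on `ℝ³`, as elements of `L²(Ω)`. -/
def gradientSubmodule (Ω : Set R3) : Submodule ℝ (Lp R3 2 (volume.restrict Ω)) where
  carrier := {f | ∃ v : R3 → ℝ, ContDiff ℝ ∞ v ∧ HasCompactSupport v ∧
    f =ᵐ[volume.restrict Ω] gradient v}
  zero_mem' := ⟨fun _ => 0, contDiff_const, HasCompactSupport.zero, by
    filter_upwards [Lp.coeFn_zero R3 2 (volume.restrict Ω)] with x hx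
    rw [hx]
    simp [gradient]⟩
  add_mem' := by
    rintro f g ⟨v, hv, hvc, hf⟩ ⟨w, hw, hwc, hg⟩
    refine ⟨fun x => v x + w x, hv.add hw, hvc.add hwc, ?_⟩
    filter_upwards [Lp.coeFn_add f g, hf, hg] with x h1 h2 h3
    rw [h1, Pi.add_apply, h2, h3, gradient_add' hv hw]
  smul_mem' := by
    rintro c f ⟨v, hv, hvc, hf⟩
    refine ⟨fun x => c * v x, contDiff_const.mul hv, hvc.mul_left, ?_⟩
    filter_upwards [Lp.coeFn_smul c f, hf] with x h1 h2
    rw [h1, Pi.smul_apply, h2, gradient_const_mul' hv]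

/-- Orthogonal decomposition of a field in `L²(Ω)`: a limit of gradients plus a field that is
divergence free and tangential in the weak sense. -/
theorem exists_gradient_limit {A : R3 → R3} (hA : MemLp A 2 (volume.restrict Ω)) :
    ∃ (P : R3 → R3) (v : ℕ → R3 → ℝ), MemLp P 2 (volume.restrict Ω) ∧
      (∀ n, ContDiff ℝ ∞ (v n) ∧ HasCompactSupport (v n)) ∧
      (∀ n, eLpNorm (gradient (v n) - P) 2 (volume.restrict Ω) ≤ (2⁻¹ : ℝ≥0∞) ^ n) ∧
      ∀ w : R3 → ℝ, ContDiff ℝ ∞ w → HasCompactSupport w →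
        ∫ x in Ω, inner ℝ (A x - P x) (gradient w x) = 0 := by
  set K := (gradientSubmodule Ω).topologicalClosure with hK
  have hKc : IsClosed (K : Set (Lp R3 2 (volume.restrict Ω))) :=
    Submodule.isClosed_topologicalClosure _
  have : CompleteSpace K := hKc.completeSpace_coe
  set a := hA.toLp A with ha
  set P := K.starProjection a with hP
  have hPK : P ∈ closure (gradientSubmodule Ω : Set (Lp R3 2 (volume.restrict Ω))) := by
    rw [← Submodule.topologicalClosure_coe]
    exact K.starProjection_apply_mem a
  -- The rate `2⁻ⁿ` makes the gradients of successive differences summable, from which the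
  -- potentials will converge almost everywhere.
  have happ : ∀ n : ℕ, ∃ v : R3 → ℝ, (ContDiff ℝ ∞ v ∧ HasCompactSupport v) ∧
      eLpNorm (gradient v - (P : R3 → R3)) 2 (volume.restrict Ω) ≤ (2⁻¹ : ℝ≥0∞) ^ n := by
    intro n
    obtain ⟨f, ⟨v, hv, hc, hf⟩, hd⟩ := Metric.mem_closure_iff.1 hPK ((2⁻¹ : ℝ) ^ n) (by positivity)
    refine ⟨v, ⟨hv, hc⟩, ?_⟩
    have h1 : eLpNorm (gradient v - (P : R3 → R3)) 2 (volume.restrict Ω) = edist f P := by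
      rw [Lp.edist_def]
      exact eLpNorm_congr_ae (hf.symm.sub EventuallyEq.rfl)
    rw [h1, edist_dist, dist_comm]
    refine (ENNReal.ofReal_le_ofReal hd.le).trans (le_of_eq ?_)
    rw [ENNReal.ofReal_pow (by norm_num), ENNReal.ofReal_inv_of_pos (by norm_num)]
    simp
  choose v hv hvP using happ
  refine ⟨P, v, Lp.memLp P, hv, hvP, ?_⟩
  intro w hw hc
  set g := (memLp_gradient (Ω := Ω) hw hc).toLp _ with hg
  have hgK : g ∈ K := (gradientSubmodule Ω).le_topologicalClosure
    ⟨w, hw, hc, (memLp_gradient hw hc).coeFn_toLp⟩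
  have h0 : inner ℝ (a - P) g = 0 := by
    rw [real_inner_comm]
    exact (K.sub_starProjection_mem_orthogonal a) g hgK
  rw [L2.inner_def] at h0
  rw [← h0]
  refine integral_congr_ae ?_
  filter_upwards [Lp.coeFn_sub a P, hA.coeFn_toLp, (memLp_gradient (Ω := Ω) hw hc).coeFn_toLp]
    with x h1 h2 h3
  rw [h1, Pi.sub_apply, ha, h2, hg, h3]

theorem eLpNorm_tendsto_zero_of_le_pow {E : Type*} [NormedAddCommGroup E] {μ : Measure R3}
    {f : ℕ → R3 → E} {p : ℝ≥0∞} (h : ∀ n, eLpNorm (f n) p μ ≤ (2⁻¹ : ℝ≥0∞) ^ n) :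
    Tendsto (fun n => eLpNorm (f n) p μ) atTop (𝓝 0) :=
  tendsto_of_tendsto_of_tendsto_of_le_of_le tendsto_const_nhds
    (ENNReal.tendsto_pow_atTop_nhds_zero_of_lt_one (by simp)) (fun _ => bot_le) h

/-- Each gradient is orthogonal to `curl η`, and this is preserved in the `L²` limit. Removing `P`
from a potential therefore does not change its curl. -/
theorem isWeakCurl_zero_of_gradient_limit {P : R3 → R3} {v : ℕ → R3 → ℝ} (hΩ : IsOpen Ω)
    (hP : MemLp P 2 (volume.restrict Ω)) (hv : ∀ n, ContDiff ℝ ∞ (v n) ∧ HasCompactSupport (v n))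
    (h : Tendsto (fun n => eLpNorm (gradient (v n) - P) 2 (volume.restrict Ω)) atTop (𝓝 0)) :
    IsWeakCurl Ω P 0 := by
  refine ⟨MemLp.locallyIntegrableOn (by norm_num) hΩ hP,
    (locallyIntegrable_zero).locallyIntegrableOn _, fun η h1 h2 h3 => ?_⟩
  have t := tendsto_integral_bilin (p := 2) (q := 2) (innerSL ℝ (E := R3))
    (fun n => memLp_gradient (Ω := Ω) (hv n).1 (hv n).2) hP
    ((memLp_of_contDiff (contDiff_curl h1) (hasCompactSupport_curl h2) 2).restrict Ω) h
  have e : ∀ n, ∫ x in Ω, (innerSL ℝ (gradient (v n) x)) (curl η x) = 0 := by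
    intro n
    have := integral_inner_gradient_curl (hv n).1 h1 h2
    rwa [← setIntegral_inner_eq_integral ((tsupport_curl_subset η).trans h3)] at this
  simp only [e] at t
  have t0 : ∫ x in Ω, inner ℝ (P x) (curl η x) = 0 := tendsto_nhds_unique t tendsto_const_nhds
  simpa using t0

/-! ### The energy in terms of given weak derivatives -/

/-- The magnetic gradient computed with a given gradient `G` of `ψ`. -/
def magField (b : ℝ) (A : R3 → R3) (ψ : R3 → ℂ) (G : R3 → C3) (x : R3) : C3 :=
  WithLp.toLp 2 fun j => -Complex.I * G x j + ((b * A x j : ℝ) : ℂ) * ψ x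

/-- The non-negative part of the energy. -/
def posEnergy (Ω U : Set R3) (κ H : ℝ) (ψ : R3 → ℂ) (A : R3 → R3) (G : R3 → C3) (C : R3 → R3) :
    ℝ≥0∞ :=
  (∫⁻ x in Ω, ‖magField (κ * H) A ψ G x‖ₑ ^ 2)
    + ENNReal.ofReal (κ ^ 2 / 2) * (∫⁻ x in Ω, ‖ψ x‖ₑ ^ 4)
    + ENNReal.ofReal (κ ^ 2 * H ^ 2) * (∫⁻ x in U, ‖C x - beta‖ₑ ^ 2)

/-- The absolute value of the negative part of the energy. -/
def negEnergy (Ω : Set R3) (κ : ℝ) (ψ : R3 → ℂ) : ℝ≥0∞ :=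
  ENNReal.ofReal (κ ^ 2) * ∫⁻ x in Ω, ‖ψ x‖ₑ ^ 2

/-- By uniqueness almost everywhere, the chosen derivatives can be replaced by any given ones. With
the energy split in this way and its negative part finite, its sign is decided by a comparison in
`[0, ∞]`. -/
theorem energy_eq (hΩ : IsOpen Ω) (hU : IsOpen U) {κ H : ℝ} {ψ : R3 → ℂ} {A C : R3 → R3}
    {G : R3 → C3} (hG : IsWeakGrad Ω ψ G) (hC : IsWeakCurl U A C) :
    energy Ω U κ H ψ A = (posEnergy Ω U κ H ψ A G C : EReal) - (negEnergy Ω κ ψ : EReal) := by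
  have h1 : ∫⁻ x in Ω, ‖magneticGrad Ω (κ * H) A ψ x‖ₑ ^ 2 =
      ∫⁻ x in Ω, ‖magField (κ * H) A ψ G x‖ₑ ^ 2 := by
    refine lintegral_congr_ae ?_
    filter_upwards [hG.ae_eq_weakGrad hΩ] with x hx
    simp only [magneticGrad, magField, hx]
  have h2 : ∫⁻ x in U, ‖weakCurl U A x - beta‖ₑ ^ 2 = ∫⁻ x in U, ‖C x - beta‖ₑ ^ 2 := by
    refine lintegral_congr_ae ?_
    filter_upwards [hC.ae_eq_weakCurl hU] with x hx
    rw [hx]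
  unfold energy posEnergy negEnergy
  rw [h1, h2]

theorem lintegral_sq_lt_top {α E : Type*} [MeasurableSpace α] {μ : Measure α}
    [NormedAddCommGroup E] {f : α → E} (hf : MemLp f 2 μ) : ∫⁻ x, ‖f x‖ₑ ^ 2 ∂μ < ⊤ := by
  have := lintegral_rpow_enorm_lt_top_of_eLpNorm_lt_top (p := 2) (by simp) (by simp) hf.2
  simpa using this

theorem negEnergy_ne_top {κ : ℝ} {ψ : R3 → ℂ} (hψ : MemLp ψ 2 (volume.restrict Ω)) :
    negEnergy Ω κ ψ ≠ ⊤ :=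
  ENNReal.mul_ne_top ENNReal.ofReal_ne_top (lintegral_sq_lt_top hψ).ne

theorem ereal_sub_nonneg {p n : ℝ≥0∞} (hn : n ≠ ⊤) :
    0 ≤ (p : EReal) - (n : EReal) ↔ n ≤ p := by
  rw [EReal.sub_nonneg (by simp [hn]) (by simp), EReal.coe_ennreal_le_coe_ennreal_iff]

theorem ereal_sub_nonpos {p n : ℝ≥0∞} :
    (p : EReal) - (n : EReal) ≤ 0 ↔ p ≤ n := by
  rw [EReal.sub_nonpos, EReal.coe_ennreal_le_coe_ennreal_iff]

theorem energy_nonneg_iff (hΩ : IsOpen Ω) (hU : IsOpen U) {κ H : ℝ} {ψ : R3 → ℂ}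
    {A C : R3 → R3} {G : R3 → C3} (hψ : MemLp ψ 2 (volume.restrict Ω)) (hG : IsWeakGrad Ω ψ G)
    (hC : IsWeakCurl U A C) :
    0 ≤ energy Ω U κ H ψ A ↔ negEnergy Ω κ ψ ≤ posEnergy Ω U κ H ψ A G C := by
  rw [energy_eq hΩ hU hG hC, ereal_sub_nonneg (negEnergy_ne_top hψ)]

theorem energy_nonpos_iff (hΩ : IsOpen Ω) (hU : IsOpen U) {κ H : ℝ} {ψ : R3 → ℂ}
    {A C : R3 → R3} {G : R3 → C3} (hG : IsWeakGrad Ω ψ G) (hC : IsWeakCurl U A C) :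
    energy Ω U κ H ψ A ≤ 0 ↔ posEnergy Ω U κ H ψ A G C ≤ negEnergy Ω κ ψ := by
  rw [energy_eq hΩ hU hG hC, ereal_sub_nonpos]

theorem energy_normal (hΩ : IsOpen Ω) (hU : IsOpen U) {κ H : ℝ} {A : R3 → R3}
    (hA : IsWeakCurl U A fun _ => beta) : energy Ω U κ H 0 A = 0 := by
  rw [energy_eq hΩ hU isWeakGrad_zero hA]
  have : ∀ x, magField (κ * H) A 0 0 x = 0 := fun x => by
    ext j
    simp [magField]
  simp [posEnergy, negEnergy, this]

/-! ### Gauge transformations -/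

/-- A real vector, seen as a complex one. -/
def cplx (y : R3) : C3 := WithLp.toLp 2 fun j => (y j : ℂ)

theorem norm_cplx (y : R3) : ‖cplx y‖ = ‖y‖ := by
  rw [EuclideanSpace.norm_eq, EuclideanSpace.norm_eq]
  simp [cplx]

theorem continuous_cplx : Continuous cplx := by
  unfold cplx
  fun_prop

theorem magField_eq (b : ℝ) (A : R3 → R3) (ψ : R3 → ℂ) (G : R3 → C3) (x : R3) :
    magField b A ψ G x = (-Complex.I) • G x + ψ x • ((b : ℂ) • cplx (A x)) := by
  ext j
  simp [magField, cplx]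
  ring

/-- The gauge factor `exp(i b θ)`. -/
def phase (b : ℝ) (θ : R3 → ℝ) (x : R3) : ℂ := Complex.exp (((b * θ x : ℝ) : ℂ) * Complex.I)

theorem norm_phase (b : ℝ) (θ : R3 → ℝ) (x : R3) : ‖phase b θ x‖ = 1 :=
  Complex.norm_exp_ofReal_mul_I _

theorem measurable_phase (b : ℝ) {θ : R3 → ℝ} (hθ : Measurable θ) : Measurable (phase b θ) := by
  unfold phase
  fun_prop

/-- The Leibniz rule for a smooth real factor: the definition of the weak gradient is applied to the
test function `η f`. -/
theorem IsWeakGrad.integral_partialDeriv_smul_smul {ψ : R3 → ℂ} {G : R3 → C3}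
    (h : IsWeakGrad U ψ G) {f η : R3 → ℝ} (hf : ContDiff ℝ ∞ f) (h1 : ContDiff ℝ ∞ η)
    (h2 : HasCompactSupport η) (h3 : tsupport η ⊆ U) (j : Fin 3) :
    ∫ x in U, partialDeriv j η x • (f x • ψ x) =
      - ∫ x in U, η x • (f x • G x j + partialDeriv j f x • ψ x) := by
  have s1 : ContDiff ℝ ∞ fun x => η x * f x := h1.mul hf
  have s2 : HasCompactSupport fun x => η x * f x := h2.mul_right
  have s3 : tsupport (fun x => η x * f x) ⊆ U := (tsupport_mul_subset_left).trans h3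
  have e := h.2.2 _ s1 s2 s3 j
  have hd := partialDeriv_contDiff hf j
  have i1 : Integrable (fun x => partialDeriv j (fun y => η y * f y) x • ψ x)
      (volume.restrict U) :=
    (integrable_smul_of_tsupport_subset h.1 (partialDeriv_contDiff s1 j).continuous
      (hasCompactSupport_partialDeriv s2 j)
      ((tsupport_partialDeriv_subset _ j).trans s3)).integrableOn
  have i2 : Integrable (fun x => (η x * f x) • G x j) (volume.restrict U) :=
    (integrable_smul_of_tsupport_subset (LocallyIntegrableOn.C3_apply h.2.1 j) s1.continuous
      s2 s3).integrableOn
  have i3 : Integrable (fun x => (η x * partialDeriv j f x) • ψ x) (volume.restrict U) :=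
    (integrable_smul_of_tsupport_subset h.1 (h1.continuous.mul hd.continuous)
      h2.mul_right ((tsupport_mul_subset_left).trans h3)).integrableOn
  have e1 : ∀ x, partialDeriv j η x • (f x • ψ x) =
      partialDeriv j (fun y => η y * f y) x • ψ x - (η x * partialDeriv j f x) • ψ x := by
    intro x
    rw [partialDeriv_mul h1 hf, ← sub_smul, smul_smul]
    congr 1
    ring
  have e2 : ∀ x, η x • (f x • G x j + partialDeriv j f x • ψ x) =
      (η x * f x) • G x j + (η x * partialDeriv j f x) • ψ x := by
    intro x
    rw [smul_add, smul_smul, smul_smul]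
  simp only [← Complex.real_smul] at e
  rw [integral_congr_ae (Eventually.of_forall e1), integral_congr_ae (Eventually.of_forall e2),
    integral_sub i1 i3, integral_add i2 i3, e]
  ring

theorem phase_eq (b : ℝ) (θ : R3 → ℝ) (x : R3) :
    phase b θ x = (Real.cos (b * θ x) : ℂ) + (Real.sin (b * θ x) : ℂ) * Complex.I := by
  rw [phase, Complex.exp_mul_I, Complex.ofReal_cos, Complex.ofReal_sin]

/-- Test functions are real, so the phase is split into cosine and sine and the real Leibniz rule is
used for each. -/
theorem IsWeakGrad.integral_phase {ψ : R3 → ℂ} {G : R3 → C3}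
    (h : IsWeakGrad U ψ G) {θ η : R3 → ℝ} (b : ℝ) (hθ : ContDiff ℝ ∞ θ) (h1 : ContDiff ℝ ∞ η)
    (h2 : HasCompactSupport η) (h3 : tsupport η ⊆ U) (j : Fin 3) :
    ∫ x in U, partialDeriv j η x • (phase b θ x * ψ x) =
      - ∫ x in U, η x • (phase b θ x * (G x j + Complex.I * (b * partialDeriv j θ x : ℝ) * ψ x)) := by
  have hbθ : ContDiff ℝ ∞ fun x => b * θ x := contDiff_const.mul hθ
  have hc : ContDiff ℝ ∞ fun x => Real.cos (b * θ x) := Real.contDiff_cos.comp hbθ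
  have hs : ContDiff ℝ ∞ fun x => Real.sin (b * θ x) := Real.contDiff_sin.comp hbθ
  have hdθ : ∀ x, HasFDerivAt (fun x => b * θ x) (b • fderiv ℝ θ x) x := fun x =>
    (hθ.differentiable (by simp) x).hasFDerivAt.const_mul b
  have hdc : ∀ x, partialDeriv j (fun x => Real.cos (b * θ x)) x =
      -(Real.sin (b * θ x)) * (b * partialDeriv j θ x) := by
    intro x
    unfold partialDeriv
    rw [(hdθ x).cos.fderiv]
    simp
  have hds : ∀ x, partialDeriv j (fun x => Real.sin (b * θ x)) x =
      Real.cos (b * θ x) * (b * partialDeriv j θ x) := by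
    intro x
    unfold partialDeriv
    rw [(hdθ x).sin.fderiv]
    simp
  have ec := h.integral_partialDeriv_smul_smul hc h1 h2 h3 j
  have es := h.integral_partialDeriv_smul_smul hs h1 h2 h3 j
  have hdη := partialDeriv_contDiff h1 j
  have ia : ∀ f : R3 → ℝ, ContDiff ℝ ∞ f →
      Integrable (fun x => partialDeriv j η x • (f x • ψ x)) (volume.restrict U) := by
    intro f hf
    simp only [smul_smul]
    exact (integrable_smul_of_tsupport_subset h.1 (hdη.continuous.mul hf.continuous)
      (hasCompactSupport_partialDeriv h2 j).mul_right ((tsupport_mul_subset_left).trans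
      ((tsupport_partialDeriv_subset _ j).trans h3))).integrableOn
  have ib : ∀ f : R3 → ℝ, ContDiff ℝ ∞ f →
      Integrable (fun x => η x • (f x • G x j + partialDeriv j f x • ψ x))
        (volume.restrict U) := by
    intro f hf
    simp only [smul_add, smul_smul]
    refine Integrable.add ?_ ?_
    · exact (integrable_smul_of_tsupport_subset (LocallyIntegrableOn.C3_apply h.2.1 j)
        (h1.continuous.mul hf.continuous)
        h2.mul_right ((tsupport_mul_subset_left).trans h3)).integrableOn
    · exact (integrable_smul_of_tsupport_subset h.1
        (h1.continuous.mul (partialDeriv_contDiff hf j).continuous)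
        h2.mul_right ((tsupport_mul_subset_left).trans h3)).integrableOn
  have e1 : ∀ x, partialDeriv j η x • (phase b θ x * ψ x) =
      partialDeriv j η x • (Real.cos (b * θ x) • ψ x) +
        Complex.I * (partialDeriv j η x • (Real.sin (b * θ x) • ψ x)) := by
    intro x
    rw [phase_eq]
    simp only [Complex.real_smul]
    ring
  have e2 : ∀ x, η x • (phase b θ x * (G x j + Complex.I * (b * partialDeriv j θ x : ℝ) * ψ x)) =
      η x • (Real.cos (b * θ x) • G x j + partialDeriv j (fun x => Real.cos (b * θ x)) x • ψ x) +
        Complex.I * (η x • (Real.sin (b * θ x) • G x j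
          + partialDeriv j (fun x => Real.sin (b * θ x)) x • ψ x)) := by
    intro x
    rw [phase_eq, hdc, hds]
    simp only [Complex.real_smul]
    push_cast
    linear_combination (η x : ℂ) * Complex.sin (b * θ x) * b * partialDeriv j θ x * ψ x *
      Complex.I_sq
  rw [integral_congr_ae (Eventually.of_forall e1), integral_congr_ae (Eventually.of_forall e2),
    integral_add (ia _ hc) ((ia _ hs).const_mul _), integral_add (ib _ hc) ((ib _ hs).const_mul _),
    integral_const_mul, integral_const_mul, ec, es]
  ring

/-- For the smooth functions `v n` this is the Leibniz rule. In the limit the phases converge almost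
everywhere and have modulus one, so dominated convergence applies to the terms whose other factor is
fixed. The remaining error contains `∇(v n) - P`, which tends to zero in `L²`. -/
theorem isWeakGrad_phase {P : R3 → R3} {v : ℕ → R3 → ℝ} {χ : R3 → ℝ} (hΩ : IsOpen Ω)
    (hP : MemLp P 2 (volume.restrict Ω)) (hv : ∀ n, ContDiff ℝ ∞ (v n)) (hvL : ∀ n,
      MemLp (gradient (v n)) 2 (volume.restrict Ω))
    (hvP : Tendsto (fun n => eLpNorm (gradient (v n) - P) 2 (volume.restrict Ω)) atTop (𝓝 0))
    (hχ : Measurable χ)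
    (hvχ : ∀ᵐ x ∂volume.restrict Ω, Tendsto (fun n => v n x) atTop (𝓝 (χ x)))
    {ψ : R3 → ℂ} {G : R3 → C3} {M : ℝ} (hψ : MemLp ψ 2 (volume.restrict Ω))
    (hM : ∀ᵐ x ∂volume.restrict Ω, ‖ψ x‖ ≤ M) (h : IsWeakGrad Ω ψ G)
    (hG : MemLp G 2 (volume.restrict Ω)) (b : ℝ) :
    MemLp (fun x => phase b χ x * ψ x) 2 (volume.restrict Ω) ∧
    MemLp (fun x => phase b χ x • (G x + (Complex.I * b * ψ x) • cplx (P x))) 2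
      (volume.restrict Ω) ∧
    IsWeakGrad Ω (fun x => phase b χ x * ψ x)
      (fun x => phase b χ x • (G x + (Complex.I * b * ψ x) • cplx (P x))) := by
  have hpm : AEStronglyMeasurable (phase b χ) (volume.restrict Ω) :=
    (measurable_phase b hχ).aestronglyMeasurable
  have m1 : MemLp (fun x => phase b χ x * ψ x) 2 (volume.restrict Ω) :=
    hψ.of_le (hpm.mul hψ.1) (Eventually.of_forall fun x => by simp [norm_phase])
  have hcP : AEStronglyMeasurable (fun x => cplx (P x)) (volume.restrict Ω) :=
    continuous_cplx.comp_aestronglyMeasurable hP.1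
  -- The bound on `ψ` enters here: it keeps `ψ P` square integrable.
  have m2' : MemLp (fun x => (Complex.I * b * ψ x) • cplx (P x)) 2 (volume.restrict Ω) := by
    refine MemLp.of_le_mul (c := |b| * M) hP ((hψ.1.const_mul _).smul hcP) ?_
    filter_upwards [hM] with x hx
    rw [norm_smul, norm_cplx]
    gcongr
    simp
    gcongr
  have m2 : MemLp (fun x => phase b χ x • (G x + (Complex.I * b * ψ x) • cplx (P x))) 2
      (volume.restrict Ω) := by
    refine (hG.add m2').of_le (hpm.smul (hG.add m2').1) (Eventually.of_forall fun x => ?_)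
    rw [norm_smul, norm_phase, one_mul]
    rfl
  refine ⟨m1, m2, MemLp.locallyIntegrableOn (by norm_num) hΩ m1,
    MemLp.locallyIntegrableOn (by norm_num) hΩ m2, fun η h1 h2 h3 j => ?_⟩
  have hphase : ∀ᵐ x ∂volume.restrict Ω,
      Tendsto (fun n => phase b (v n) x) atTop (𝓝 (phase b χ x)) := by
    filter_upwards [hvχ] with x hx
    unfold phase
    refine (Complex.continuous_exp.tendsto _).comp (Tendsto.mul_const _ ?_)
    exact (Complex.continuous_ofReal.tendsto _).comp (hx.const_mul b)
  have hpn : ∀ n, AEStronglyMeasurable (phase b (v n)) (volume.restrict Ω) := fun n =>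
    (measurable_phase b (hv n).continuous.measurable).aestronglyMeasurable
  have dct : ∀ f : R3 → ℂ, Integrable f (volume.restrict Ω) →
      Tendsto (fun n => ∫ x in Ω, phase b (v n) x * f x) atTop
        (𝓝 (∫ x in Ω, phase b χ x * f x)) := by
    intro f hf
    refine tendsto_integral_of_dominated_convergence (fun x => ‖f x‖) (fun n => (hpn n).mul hf.1)
      hf.norm (fun n => Eventually.of_forall fun x => by simp [norm_phase]) ?_
    filter_upwards [hphase] with x hx
    exact hx.mul_const _
  have iη : ∀ f : R3 → ℂ, LocallyIntegrableOn f Ω →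
      Integrable (fun x => η x • f x) (volume.restrict Ω) := fun f hf =>
    (integrable_smul_of_tsupport_subset hf h1.continuous h2 h3).integrableOn
  have iψ : Integrable (fun x => partialDeriv j η x • ψ x) (volume.restrict Ω) :=
    (integrable_smul_of_tsupport_subset h.1 (partialDeriv_contDiff h1 j).continuous
      (hasCompactSupport_partialDeriv h2 j)
      ((tsupport_partialDeriv_subset η j).trans h3)).integrableOn
  have iG := iη (fun x => G x j) (LocallyIntegrableOn.C3_apply h.2.1 j)
  have iP := iη (fun x => (Complex.I * b * ψ x) * P x j) (LocallyIntegrableOn.C3_apply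
    (MemLp.locallyIntegrableOn (by norm_num) hΩ m2') j)
  have hηψ : MemLp (fun x => ‖η x • ((b : ℂ) * ψ x)‖) 2 (volume.restrict Ω) := by
    obtain ⟨K, hK⟩ := h1.continuous.bounded_above_of_compact_support h2
    refine MemLp.norm (MemLp.of_le_mul (c := K * |b|) hψ
      (h1.continuous.aestronglyMeasurable.smul (hψ.1.const_mul _))
      (Eventually.of_forall fun x => ?_))
    rw [norm_smul, norm_mul, mul_assoc]
    simp only [Complex.norm_real, Real.norm_eq_abs]
    gcongr
    exact hK x
  have herr : Tendsto (fun n => ∫ x in Ω, phase b (v n) x *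
      (η x • (Complex.I * b * ψ x * ((partialDeriv j (v n) x - P x j : ℝ) : ℂ)))) atTop (𝓝 0) := by
    have t := tendsto_integral_bilin (p := 2) (q := 2) (ContinuousLinearMap.mul ℝ ℝ)
      (f := fun n x => ‖(gradient (v n) - P) x‖) (f₀ := fun _ => 0)
      (fun n => ((hvL n).sub hP).norm) MemLp.zero' hηψ ?_
    · simp only [ContinuousLinearMap.mul_apply', zero_mul, integral_zero] at t
      refine squeeze_zero_norm (fun n => ?_) t
      refine norm_integral_le_of_norm_le ?_ (Eventually.of_forall fun x => ?_)
      · exact (((hvL n).sub hP).norm).integrable_mul hηψ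
      · have : ‖partialDeriv j (v n) x - P x j‖ ≤ ‖(gradient (v n) - P) x‖ := by
          rw [← gradient_apply]
          exact PiLp.norm_apply_le ((gradient (v n) - P) x) j
        simp only [norm_mul, norm_smul, norm_phase, Complex.norm_I, one_mul, Complex.norm_real]
        calc ‖η x‖ * (‖b‖ * ‖ψ x‖ * ‖partialDeriv j (v n) x - P x j‖)
            = ‖partialDeriv j (v n) x - P x j‖ * (‖η x‖ * (‖b‖ * ‖ψ x‖)) := by ring
          _ ≤ _ := by gcongr
    · refine hvP.congr fun n => ?_
      rw [← eLpNorm_norm]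
      congr 1
      ext x
      simp
  have ip : ∀ n (f : R3 → ℂ), Integrable f (volume.restrict Ω) →
      Integrable (fun x => phase b (v n) x * f x) (volume.restrict Ω) := fun n f hf =>
    hf.bdd_mul (c := 1) (hpn n) (Eventually.of_forall fun x => (norm_phase b (v n) x).le)
  have ipχ : ∀ (f : R3 → ℂ), Integrable f (volume.restrict Ω) →
      Integrable (fun x => phase b χ x * f x) (volume.restrict Ω) := fun f hf =>
    hf.bdd_mul (c := 1) hpm (Eventually.of_forall fun x => (norm_phase b χ x).le)
  have iD : ∀ n, Integrable (fun x =>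
      η x • (Complex.I * b * ψ x * ((partialDeriv j (v n) x - P x j : ℝ) : ℂ)))
      (volume.restrict Ω) := by
    intro n
    have i1 : Integrable (fun x => (η x * partialDeriv j (v n) x) • ψ x) (volume.restrict Ω) :=
      (integrable_smul_of_tsupport_subset h.1
        (h1.continuous.mul (partialDeriv_contDiff (hv n) j).continuous)
        h2.mul_right ((tsupport_mul_subset_left).trans h3)).integrableOn
    refine ((i1.const_mul (Complex.I * b)).sub iP).congr (Eventually.of_forall fun x => ?_)
    simp only [Pi.sub_apply, Complex.real_smul]
    push_cast
    ring
  -- The Leibniz rule for `v n`, with `∇(v n)` written as `P` plus an error.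
  have hid : ∀ n, ∫ x in Ω, phase b (v n) x * (partialDeriv j η x • ψ x) =
      - ((∫ x in Ω, phase b (v n) x * (η x • G x j))
        + (∫ x in Ω, phase b (v n) x * (η x • (Complex.I * b * ψ x * P x j)))
        + (∫ x in Ω, phase b (v n) x *
          (η x • (Complex.I * b * ψ x * ((partialDeriv j (v n) x - P x j : ℝ) : ℂ))))) := by
    intro n
    have e := h.integral_phase b (hv n) h1 h2 h3 j
    simp only [← mul_smul_comm] at e ⊢
    rw [e, ← integral_add, ← integral_add]
    · congr 1
      refine integral_congr_ae (Eventually.of_forall fun x => ?_)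
      simp only [Complex.real_smul]
      push_cast
      ring
    · refine ((ip n _ iG).add (ip n _ iP)).congr (Eventually.of_forall fun x => ?_)
      simp only [Pi.add_apply, mul_smul_comm]
    · simpa only [mul_smul_comm] using ip n _ (iD n)
    · simpa only [mul_smul_comm] using ip n _ iG
    · simpa only [mul_smul_comm] using ip n _ iP
  have t1 := dct _ iψ
  simp only [hid] at t1
  have t2 := (((dct _ iG).add (dct _ iP)).add herr).neg
  have key := tendsto_nhds_unique t1 t2
  rw [add_zero, ← integral_add (ipχ _ iG) (ipχ _ iP)] at key
  simp only [Complex.real_smul] at key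
  calc ∫ x in Ω, (partialDeriv j η x : ℂ) * (phase b χ x * ψ x)
      = ∫ x in Ω, phase b χ x * (partialDeriv j η x * ψ x) := by
        refine integral_congr_ae (Eventually.of_forall fun x => ?_)
        ring
    _ = _ := key
    _ = _ := by
        congr 1
        refine integral_congr_ae (Eventually.of_forall fun x => ?_)
        simp [cplx]
        ring

/-- Gauge covariance: differentiating the phase contributes `b P ψ`, which cancels the change of
potential from `A` to `A - P`, so the magnetic gradient is merely multiplied by the phase. -/
theorem norm_magField_phase (b : ℝ) (A P : R3 → R3) (χ : R3 → ℝ) (ψ : R3 → ℂ) (G : R3 → C3)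
    (x : R3) :
    ‖magField b (fun x => A x - P x) (fun x => phase b χ x * ψ x)
      (fun x => phase b χ x • (G x + (Complex.I * b * ψ x) • cplx (P x))) x‖ =
      ‖magField b A ψ G x‖ := by
  have : magField b (fun x => A x - P x) (fun x => phase b χ x * ψ x)
      (fun x => phase b χ x • (G x + (Complex.I * b * ψ x) • cplx (P x))) x =
      phase b χ x • magField b A ψ G x := by
    ext j
    simp [magField, cplx]
    linear_combination (-phase b χ x * b * ψ x * P x j) * Complex.I_sq
  rw [this, norm_smul, norm_phase, one_mul]

theorem norm_fderiv_eq_norm_gradient (v : R3 → ℝ) (x : R3) : ‖fderiv ℝ v x‖ = ‖gradient v x‖ := by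
  unfold gradient
  rw [LinearIsometryEquiv.norm_map]

theorem tsum_lintegral_fderiv_ne_top {P : R3 → R3} {v : ℕ → R3 → ℝ} (hΩ : volume Ω ≠ ⊤)
    (hP : MemLp P 2 (volume.restrict Ω)) (hv : ∀ n, ContDiff ℝ ∞ (v n) ∧ HasCompactSupport (v n))
    (h : ∀ n, eLpNorm (gradient (v n) - P) 2 (volume.restrict Ω) ≤ (2⁻¹ : ℝ≥0∞) ^ n) :
    ∑' n, ∫⁻ x in Ω, ‖fderiv ℝ (fun y => v (n + 1) y - v n y) x‖ₑ ≠ ⊤ := by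
  have hm : ∀ n, MemLp (gradient (v n)) 2 (volume.restrict Ω) := fun n =>
    memLp_gradient (hv n).1 (hv n).2
  -- `K` is the square root of the volume of `Ω`, the constant in the bound of the `L¹` norm by the
  -- `L²` norm.
  set K : ℝ≥0∞ := (volume.restrict Ω) univ ^ (1 / (1 : ℝ≥0∞).toReal - 1 / (2 : ℝ≥0∞).toReal)
    with hK
  have hKt : K ≠ ⊤ := by
    refine ENNReal.rpow_ne_top_of_nonneg (by norm_num) ?_
    rwa [Measure.restrict_apply_univ]
  have hb : ∀ n, ∫⁻ x in Ω, ‖fderiv ℝ (fun y => v (n + 1) y - v n y) x‖ₑ ≤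
      (2⁻¹ : ℝ≥0∞) ^ n * (2 * K) := by
    intro n
    have e : ∀ x, ‖fderiv ℝ (fun y => v (n + 1) y - v n y) x‖ₑ =
        ‖((gradient (v (n + 1)) - P) - (gradient (v n) - P)) x‖ₑ := by
      intro x
      rw [← ofReal_norm, ← ofReal_norm, norm_fderiv_eq_norm_gradient]
      congr 2
      unfold gradient
      rw [fderiv_fun_sub ((hv _).1.differentiable (by simp) x)
        ((hv _).1.differentiable (by simp) x), map_sub]
      simp
    simp only [e]
    rw [← eLpNorm_one_eq_lintegral_enorm]
    have m1 := ((hm (n + 1)).sub hP)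
    have m2 := ((hm n).sub hP)
    refine (eLpNorm_le_eLpNorm_mul_rpow_measure_univ (p := 1) (q := 2) (by norm_num)
      (m1.sub m2).1).trans ?_
    rw [← hK, ← mul_assoc]
    gcongr
    calc _ ≤ _ := eLpNorm_sub_le m1.1 m2.1 (by norm_num)
      _ ≤ (2⁻¹ : ℝ≥0∞) ^ (n + 1) + (2⁻¹ : ℝ≥0∞) ^ n := add_le_add (h _) (h _)
      _ ≤ (2⁻¹ : ℝ≥0∞) ^ n + (2⁻¹ : ℝ≥0∞) ^ n := by
        gcongr ?_ + _
        exact pow_le_pow_right_of_le_one' (by simp) (Nat.le_succ n)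
      _ = _ := by rw [mul_two]
  refine ne_top_of_le_ne_top ?_ (ENNReal.tsum_le_tsum hb)
  rw [ENNReal.tsum_mul_right, ENNReal.tsum_geometric]
  refine ENNReal.mul_ne_top ?_ (ENNReal.mul_ne_top (by simp) hKt)
  simp

/-- Any potential on `Ω` can be brought into the gauge `MemGauge`, and the gauge function can be
chosen as a genuine measurable function. -/
theorem exists_gauge (hΩ : IsOpen Ω) (hc : IsConnected Ω) (hb : Bornology.IsBounded Ω)
    {A C : R3 → R3} (hA : MemLp A 2 (volume.restrict Ω)) (hAC : IsWeakCurl Ω A C)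
    (hC : MemLp C 2 (volume.restrict Ω)) :
    ∃ (A' : R3 → R3) (χ : R3 → ℝ), MemGauge Ω A' ∧ IsWeakCurl Ω A' C ∧
      ∀ (b M : ℝ) (ψ : R3 → ℂ) (G : R3 → C3), MemLp ψ 2 (volume.restrict Ω) →
        (∀ᵐ x ∂volume.restrict Ω, ‖ψ x‖ ≤ M) → IsWeakGrad Ω ψ G →
        MemLp G 2 (volume.restrict Ω) →
        MemLp (fun x => phase b χ x * ψ x) 2 (volume.restrict Ω) ∧
        ∃ G', IsWeakGrad Ω (fun x => phase b χ x * ψ x) G' ∧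
          MemLp G' 2 (volume.restrict Ω) ∧
          ∀ x, ‖magField b A' (fun x => phase b χ x * ψ x) G' x‖ = ‖magField b A ψ G x‖ := by
  obtain ⟨P, v, hP, hv, hvP, horth⟩ := exists_gradient_limit hA
  have hlim := eLpNorm_tendsto_zero_of_le_pow hvP
  obtain ⟨c, hcv⟩ := exists_tendsto_sub_const (fun n => (hv n).1) hΩ hc
    (tsum_lintegral_fderiv_ne_top hb.measure_lt_top.ne hP hv hvP)
  -- Subtracting constants secures convergence of the potentials and leaves their gradients
  -- unchanged.
  have hv' : ∀ n, ContDiff ℝ ∞ fun x => v n x - c n := fun n => (hv n).1.sub contDiff_const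
  have hg : ∀ n, gradient (fun x => v n x - c n) = gradient (v n) := fun n => by
    ext1 x
    simp only [gradient, fderiv_sub_const]
  obtain ⟨χ, hχ, hvχ⟩ := measurable_limit_of_tendsto_metrizable_ae
    (fun n => (hv' n).continuous.aemeasurable) hcv
  have hcurlP := isWeakCurl_zero_of_gradient_limit hΩ hP hv hlim
  have hcurl : IsWeakCurl Ω (fun x => A x - P x) C := by
    have := hAC.add (hcurlP.const_smul (-1))
    simpa [sub_eq_add_neg] using this
  refine ⟨fun x => A x - P x, χ, ⟨hA.sub hP, ⟨C, hcurl, hC⟩, horth⟩, hcurl, ?_⟩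
  intro b M ψ G hψ hM h hG
  obtain ⟨r1, r2, r3⟩ := isWeakGrad_phase hΩ hP hv'
    (fun n => by rw [hg]; exact memLp_gradient (hv n).1 (hv n).2)
    (by simpa only [hg] using hlim) hχ hvχ hψ hM h hG b
  exact ⟨r1, _, r3, r2, norm_magField_phase b A P χ ψ G⟩

/-! ### Existence of the normal potential -/

theorem memLp_F (hb : Bornology.IsBounded Ω) : MemLp F 2 (volume.restrict Ω) := by
  have hk : IsCompact (closure Ω) := hb.isCompact_closure
  obtain ⟨K, hK⟩ := hk.exists_bound_of_continuousOn contDiff_F.continuous.continuousOn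
  have : IsFiniteMeasure (volume.restrict (closure Ω)) := ⟨by
    rw [Measure.restrict_apply_univ]
    exact hk.measure_lt_top⟩
  refine MemLp.mono_measure (Measure.restrict_mono subset_closure le_rfl)
    (MemLp.of_bound contDiff_F.continuous.aestronglyMeasurable K ?_)
  filter_upwards [ae_restrict_mem isClosed_closure.measurableSet] with x hx
  exact hK x hx

/-- The gauge projection of `F` on `Ω`: it removes a limit of gradients and keeps the curl. -/
theorem exists_isNormalPotential (hΩ : IsOpen Ω) (hb : Bornology.IsBounded Ω) :
    ∃ FΩ, IsNormalPotential Ω FΩ := by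
  obtain ⟨P, v, hP, hv, hvP, horth⟩ := exists_gradient_limit (memLp_F hb)
  have hcurlP := isWeakCurl_zero_of_gradient_limit hΩ hP hv (eLpNorm_tendsto_zero_of_le_pow hvP)
  have hcurl : IsWeakCurl Ω (fun x => F x - P x) fun _ => beta := by
    have := (isWeakCurl_F (U := Ω)).add (hcurlP.const_smul (-1))
    simpa [sub_eq_add_neg] using this
  have : IsFiniteMeasure (volume.restrict Ω) := ⟨by
    rw [Measure.restrict_apply_univ]
    exact hb.measure_lt_top⟩
  exact ⟨fun x => F x - P x, ⟨(memLp_F hb).sub hP, ⟨_, hcurl, memLp_const _⟩, horth⟩, hcurl⟩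

/-! ### Mollification -/

/-- A sequence of bump functions shrinking to the origin. -/
def bump (n : ℕ) : ContDiffBump (0 : R3) where
  rIn := 1 / ((n : ℝ) + 1)
  -- The fixed ratio `2` of outer to inner radius is what the almost everywhere convergence of
  -- mollifications requires.
  rOut := 2 / ((n : ℝ) + 1)
  rIn_pos := by positivity
  rIn_lt_rOut := by gcongr; norm_num

open scoped Convolution

/-- The mollification of `f` at scale `1 / n`. -/
def mollify (n : ℕ) (f : R3 → ℂ) : R3 → ℂ :=
  (bump n).normed volume ⋆[ContinuousLinearMap.lsmul ℝ ℝ, volume] f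

theorem tendsto_bump_rOut : Tendsto (fun n => (bump n).rOut) atTop (𝓝 0) :=
  tendsto_const_div_atTop_nhds_zero_nat 2 |>.comp (tendsto_add_atTop_nat 1) |>.congr fun n => by
    simp [bump]

theorem integrable_mollify {f : R3 → ℂ} (hf : Integrable f) (n : ℕ) :
    Integrable (mollify n f) :=
  Integrable.integrable_convolution _ ((bump n).integrable_normed) hf

theorem integral_norm_mollify_le {f : R3 → ℂ} (hf : Integrable f) (n : ℕ) :
    ∫ x, ‖mollify n f x‖ ≤ ∫ x, ‖f x‖ := by
  have h1 : ∀ x, ‖mollify n f x‖ ≤ ((bump n).normed volume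
      ⋆[ContinuousLinearMap.lsmul ℝ ℝ, volume] fun y => ‖f y‖) x := by
    intro x
    refine (norm_integral_le_integral_norm _).trans (le_of_eq ?_)
    refine integral_congr_ae (Eventually.of_forall fun t => ?_)
    simp [abs_of_nonneg ((bump n).nonneg_normed t)]
  calc ∫ x, ‖mollify n f x‖ ≤ ∫ x, ((bump n).normed volume
      ⋆[ContinuousLinearMap.lsmul ℝ ℝ, volume] fun y => ‖f y‖) x :=
        integral_mono (integrable_mollify hf n).norm
          (Integrable.integrable_convolution _ ((bump n).integrable_normed) hf.norm) h1
    _ = ∫ x, ‖f x‖ := by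
        rw [integral_convolution _ ((bump n).integrable_normed) hf.norm]
        simp [(bump n).integral_normed]

theorem ae_tendsto_mollify {f : R3 → ℂ} (hf : Integrable f) :
    ∀ᵐ x, Tendsto (fun n => mollify n f x) atTop (𝓝 (f x)) := by
  refine ContDiffBump.ae_convolution_tendsto_right_of_locallyIntegrable (K := 2) tendsto_bump_rOut
    (Eventually.of_forall fun n => le_of_eq ?_) hf.locallyIntegrable
  simp only [bump]
  ring

/-- Write `fₙ` for the mollifications. The functions `|f| + |fₙ| - |fₙ - f|` are dominated by `2|f|`
and tend to `2|f|`. Since mollification does not increase the `L¹` norm, convergence of their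
integrals forces `∫ |fₙ - f|` to zero. -/
theorem tendsto_integral_norm_mollify_sub {f : R3 → ℂ} (hf : Integrable f) :
    Tendsto (fun n => ∫ x, ‖mollify n f x - f x‖) atTop (𝓝 0) := by
  have hi := integrable_mollify hf
  have t : Tendsto (fun n => ∫ x, (‖f x‖ + ‖mollify n f x‖ - ‖mollify n f x - f x‖)) atTop
      (𝓝 (∫ x, 2 * ‖f x‖)) := by
    refine tendsto_integral_of_dominated_convergence (fun x => 2 * ‖f x‖)
      (fun n => ((hf.norm.add (hi n).norm).sub ((hi n).sub hf).norm).1) (hf.norm.const_mul 2)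
      (fun n => Eventually.of_forall fun x => ?_) ?_
    · rw [Real.norm_eq_abs, abs_le]
      have h1 := norm_sub_le (mollify n f x) (f x)
      have h2 := norm_sub_norm_le (mollify n f x) (f x)
      constructor <;> linarith [norm_nonneg (f x)]
    · filter_upwards [ae_tendsto_mollify hf] with x hx
      have := (hx.norm.const_add ‖f x‖).sub (hx.sub_const (f x)).norm
      simpa [two_mul] using this
  have e : ∀ n, ∫ x, (‖f x‖ + ‖mollify n f x‖ - ‖mollify n f x - f x‖) =
      (∫ x, ‖f x‖) + (∫ x, ‖mollify n f x‖) - ∫ x, ‖mollify n f x - f x‖ := by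
    intro n
    rw [← integral_add hf.norm (hi n).norm]
    exact integral_sub (hf.norm.add (hi n).norm) ((hi n).sub hf).norm
  simp only [e, integral_const_mul] at t
  have t2 := t.const_sub (2 * ∫ x, ‖f x‖)
  rw [sub_self] at t2
  refine squeeze_zero (fun n => by positivity) (fun n => ?_) t2
  linarith [integral_norm_mollify_le hf n]

theorem contDiff_mollify {f : R3 → ℂ} (hf : Integrable f) (n : ℕ) :
    ContDiff ℝ ∞ (mollify n f) :=
  (bump n).hasCompactSupport_normed.contDiff_convolution_left _ (bump n).contDiff_normed
    hf.locallyIntegrable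

/-- Mollification commutes with weak derivatives away from the boundary. -/
theorem fderiv_mollify_indicator {ψ : R3 → ℂ} {G : R3 → C3} (hΩ : IsOpen Ω)
    (hψ : IntegrableOn ψ Ω) (h : IsWeakGrad Ω ψ G) {n : ℕ} {x : R3}
    (hx : Metric.closedBall x (bump n).rOut ⊆ Ω) (j : Fin 3) :
    fderiv ℝ (mollify n (Ω.indicator ψ)) x (EuclideanSpace.single j 1) =
      mollify n (Ω.indicator fun y => G y j) x := by
  have hf : Integrable (Ω.indicator ψ) := (integrable_indicator_iff hΩ.measurableSet).2 hψ
  set φ := (bump n).normed volume with hφ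
  have hφc : ContDiff ℝ ∞ φ := (bump n).contDiff_normed
  have hφs : HasCompactSupport φ := (bump n).hasCompactSupport_normed
  have hd := hφs.hasFDerivAt_convolution_left (𝕜 := ℝ) (μ := volume)
    (ContinuousLinearMap.lsmul ℝ ℝ (E := ℂ)) (hφc.of_le (by norm_cast)) hf.locallyIntegrable x
  have hr : ContDiff ℝ ∞ fun y : R3 => x - y := contDiff_const.sub contDiff_id
  -- The reflected kernel is itself an admissible test function, since its support lies in the
  -- closed ball around `x`.
  set η : R3 → ℝ := fun y => φ (x - y) with hη
  have hηc : ContDiff ℝ ∞ η := hφc.comp hr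
  have hηs : HasCompactSupport η := hφs.comp_homeomorph (Homeomorph.subLeft x)
  have hηt : tsupport η ⊆ Ω := by
    refine subset_trans ?_ hx
    refine closure_minimal (fun y hy => ?_) Metric.isClosed_closedBall
    have : x - y ∈ Function.support φ := hy
    rw [hφ, ContDiffBump.support_normed_eq, Metric.mem_ball, dist_zero_right] at this
    rw [Metric.mem_closedBall, dist_comm, dist_eq_norm]
    exact this.le
  have hpd : ∀ y, partialDeriv j η y = - fderiv ℝ φ (x - y) (EuclideanSpace.single j 1) := by
    intro y
    have h1 : HasFDerivAt (fun y : R3 => x - y) (-(ContinuousLinearMap.id ℝ R3)) y := by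
      simpa using (hasFDerivAt_id y).const_sub x
    have h2 := ((hφc.differentiable (by simp) (x - y)).hasFDerivAt.comp y h1).fderiv
    unfold partialDeriv
    change fderiv ℝ (φ ∘ fun y => x - y) y _ = _
    rw [h2]
    simp
  have e1 : ∫ y in Ω, (partialDeriv j η y : ℂ) * ψ y = - ∫ y in Ω, (η y : ℂ) * G y j :=
    h.2.2 η hηc hηs hηt j
  change fderiv ℝ (φ ⋆[ContinuousLinearMap.lsmul ℝ ℝ, volume] _) x _ =
    (φ ⋆[ContinuousLinearMap.lsmul ℝ ℝ, volume] _) x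
  rw [hd.fderiv, convolution_eq_swap, convolution_eq_swap]
  have hint : Integrable fun t => ((ContinuousLinearMap.lsmul ℝ ℝ (E := ℂ)).precompL R3)
      (fderiv ℝ φ (x - t)) (Ω.indicator ψ t) := by
    have hcs : HasCompactSupport (fderiv ℝ φ) := hφs.fderiv ℝ
    have hcc : Continuous (fderiv ℝ φ) := hφc.continuous_fderiv (by simp)
    have := (hcs.convolutionExists_left (μ := volume)
      ((ContinuousLinearMap.lsmul ℝ ℝ (E := ℂ)).precompL R3) hcc hf.locallyIntegrable x)
    exact this.integrable_swap
  rw [ContinuousLinearMap.integral_apply hint]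
  have e2 : ∀ t, ((ContinuousLinearMap.lsmul ℝ ℝ (E := ℂ)).precompL R3)
      (fderiv ℝ φ (x - t)) (Ω.indicator ψ t) (EuclideanSpace.single j 1) =
      Ω.indicator (fun y => -((partialDeriv j η y : ℂ) * ψ y)) t := by
    intro t
    rw [ContinuousLinearMap.precompL_apply]
    by_cases ht : t ∈ Ω
    · simp [indicator_of_mem ht, hpd]
    · simp [indicator_of_notMem ht]
  have e3 : ∀ t, (ContinuousLinearMap.lsmul ℝ ℝ (E := ℂ)) (φ (x - t))
      (Ω.indicator (fun y => G y j) t) = Ω.indicator (fun y => (η y : ℂ) * G y j) t := by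
    intro t
    by_cases ht : t ∈ Ω
    · simp [indicator_of_mem ht, hη]
    · simp [indicator_of_notMem ht]
  simp only [e2, e3]
  rw [integral_indicator hΩ.measurableSet, integral_indicator hΩ.measurableSet, integral_neg, e1,
    neg_neg]

/-! ### The chain rule -/

theorem tendsto_integral_of_norm_sub_le {u : ℕ → R3 → ℂ} {u₀ : R3 → ℂ} {b : ℕ → R3 → ℝ}
    (hu : ∀ᶠ n in atTop, Integrable (u n)) (hu₀ : Integrable u₀) (hb : ∀ n, Integrable (b n))
    (hle : ∀ n x, ‖u n x - u₀ x‖ ≤ b n x) (h : Tendsto (fun n => ∫ x, b n x) atTop (𝓝 0)) :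
    Tendsto (fun n => ∫ x, u n x) atTop (𝓝 (∫ x, u₀ x)) := by
  rw [tendsto_iff_norm_sub_tendsto_zero]
  refine squeeze_zero' (Eventually.of_forall fun n => norm_nonneg _) ?_ h
  filter_upwards [hu] with n hn
  rw [← integral_sub hn hu₀]
  exact norm_integral_le_of_norm_le (hb n) (Eventually.of_forall (hle n))

/-- The chain rule for weak gradients and a continuously differentiable contraction. -/
theorem isWeakGrad_comp {T : ℂ → ℂ} {D : ℂ → ℂ →L[ℝ] ℂ} (hT : ∀ z, HasFDerivAt T (D z) z)
    (hD : Continuous D) (hD1 : ∀ z, ‖D z‖ ≤ 1) (hT0 : T 0 = 0) (hΩ : IsOpen Ω) {ψ : R3 → ℂ}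
    {G : R3 → C3} (hψ : IntegrableOn ψ Ω) (hG : IntegrableOn G Ω) (h : IsWeakGrad Ω ψ G) :
    IsWeakGrad Ω (fun x => T (ψ x)) (fun x => WithLp.toLp 2 fun j => D (ψ x) (G x j)) := by
  have hTc : Continuous T := continuous_iff_continuousAt.2 fun z => (hT z).continuousAt
  have hTL : ∀ z w, ‖T z - T w‖ ≤ ‖z - w‖ := fun z w => by
    simpa using Convex.norm_image_sub_le_of_norm_hasFDerivWithin_le (s := univ) (C := 1)
      (fun y _ => (hT y).hasFDerivWithinAt) (fun y _ => hD1 y) convex_univ (mem_univ w) (mem_univ z)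
  have hTn : ∀ z, ‖T z‖ ≤ ‖z‖ := fun z => by simpa [hT0] using hTL z 0
  have hDa : ∀ z w, ‖D z w‖ ≤ ‖w‖ := fun z w => by
    simpa using (D z).le_of_opNorm_le (hD1 z) w
  have hGj : ∀ j, IntegrableOn (fun x => G x j) Ω := fun j =>
    ((EuclideanSpace.proj j : C3 →L[ℂ] ℂ).restrictScalars ℝ).integrable_comp hG
  have hDc : Continuous fun p : ℂ × ℂ => D p.1 p.2 :=
    (hD.comp continuous_fst).clm_apply continuous_snd
  have hDG : ∀ j, IntegrableOn (fun x => D (ψ x) (G x j)) Ω := fun j =>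
    Integrable.mono (hGj j) (hDc.comp_aestronglyMeasurable (hψ.1.prodMk (hGj j).1))
      (Eventually.of_forall fun x => hDa _ _)
  have hTψ : IntegrableOn (fun x => T (ψ x)) Ω :=
    Integrable.mono hψ (hTc.comp_aestronglyMeasurable hψ.1) (Eventually.of_forall fun x => hTn _)
  have hDG' : IntegrableOn (fun x => (WithLp.toLp 2 fun j => D (ψ x) (G x j) : C3)) Ω := by
    have : Integrable (fun x => fun j => D (ψ x) (G x j)) (volume.restrict Ω) :=
      Integrable.of_eval fun j => hDG j
    exact (PiLp.continuousLinearEquiv 2 ℝ (fun _ : Fin 3 => ℂ)).symm.toContinuousLinearMap.integrable_comp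
      this
  refine ⟨hTψ.locallyIntegrableOn, hDG'.locallyIntegrableOn, fun η h1 h2 h3 j => ?_⟩
  set f := Ω.indicator ψ with hf
  set g := Ω.indicator (fun y => G y j) with hg
  have fi : Integrable f := (integrable_indicator_iff hΩ.measurableSet).2 hψ
  have gi : Integrable g := (integrable_indicator_iff hΩ.measurableSet).2 (hGj j)
  have hη' := partialDeriv_contDiff h1 j
  have hη's := hasCompactSupport_partialDeriv h2 j
  obtain ⟨K, hK⟩ := h1.continuous.bounded_above_of_compact_support h2
  obtain ⟨K', hK'⟩ := hη'.continuous.bounded_above_of_compact_support hη's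
  have hfc : ∀ n, Continuous (mollify n f) := fun n => (contDiff_mollify fi n).continuous
  have hgc : ∀ n, Continuous (mollify n g) := fun n => (contDiff_mollify gi n).continuous
  -- When the mollification radius is small enough, mollification commutes with the derivative at
  -- every point of the support of `η`, and the classical chain rule applies.
  have hibp : ∀ᶠ n in atTop, ∫ x, partialDeriv j η x • T (mollify n f x) =
      - ∫ x, η x • D (mollify n f x) (mollify n g x) := by
    obtain ⟨δ, hδ, hsub⟩ := IsCompact.exists_cthickening_subset_open h2 hΩ h3
    filter_upwards [tendsto_bump_rOut.eventually_le_const hδ] with n hn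
    have hdf : ∀ x, HasFDerivAt (mollify n f) (fderiv ℝ (mollify n f) x) x := fun x =>
      ((contDiff_mollify fi n).differentiable (by simp) x).hasFDerivAt
    have hd : ∀ x, HasFDerivAt (fun x => T (mollify n f x))
        ((D (mollify n f x)).comp (fderiv ℝ (mollify n f) x)) x := fun x =>
      (hT _).comp x (hdf x)
    have hdc : Continuous fun x => fderiv ℝ (mollify n f) x :=
      (contDiff_mollify fi n).continuous_fderiv (by simp)
    have hdc' : Continuous fun x => fderiv ℝ (fun x => T (mollify n f x)) x
        (EuclideanSpace.single j 1) := by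
      simp only [(hd _).fderiv]
      exact ((hD.comp (hfc n)).clm_comp hdc).clm_apply continuous_const
    have key := integral_smul_fderiv_eq_neg_fderiv_smul_of_integrable (μ := volume) (𝕜 := ℝ)
      (f := η) (g := fun x => T (mollify n f x)) (v := EuclideanSpace.single j 1)
      ((hη'.continuous.smul (hTc.comp (hfc n))).integrable_of_hasCompactSupport hη's.smul_right)
      ((h1.continuous.smul hdc').integrable_of_hasCompactSupport h2.smul_right)
      ((h1.continuous.smul (hTc.comp (hfc n))).integrable_of_hasCompactSupport h2.smul_right)
      (fun x _ => h1.differentiable (by simp) x) (fun x _ => (hd x).differentiableAt)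
    rw [eq_comm, neg_eq_iff_eq_neg]
    refine (integral_congr_ae (Eventually.of_forall fun x => ?_)).trans key
    by_cases hx : x ∈ tsupport η
    · simp only [(hd x).fderiv, ContinuousLinearMap.comp_apply]
      rw [fderiv_mollify_indicator hΩ hψ h ((Metric.closedBall_subset_cthickening hx _).trans
        ((Metric.cthickening_mono hn _).trans hsub))]
    · simp [image_eq_zero_of_notMem_tsupport hx]
  have iη : ∀ u : R3 → ℂ, Integrable u → Integrable fun x => η x • u x := fun u hu =>
    hu.bdd_smul K h1.continuous.aestronglyMeasurable (Eventually.of_forall hK)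
  have iη' : ∀ u : R3 → ℂ, Integrable u → Integrable fun x => partialDeriv j η x • u x :=
    fun u hu => hu.bdd_smul K' hη'.continuous.aestronglyMeasurable (Eventually.of_forall hK')
  have iD : ∀ (a b : R3 → ℂ), Integrable a → Integrable b → Integrable fun x => D (a x) (b x) :=
    fun a b ha hb => hb.mono (hDc.comp_aestronglyMeasurable (ha.1.prodMk hb.1))
      (Eventually.of_forall fun x => hDa _ _)
  have iT : ∀ (a : R3 → ℂ), Integrable a → Integrable fun x => T (a x) :=
    fun a ha => ha.mono (hTc.comp_aestronglyMeasurable ha.1) (Eventually.of_forall fun x => hTn _)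
  have hfn := integrable_mollify fi
  have hgn := integrable_mollify gi
  have t1 : Tendsto (fun n => ∫ x, partialDeriv j η x • T (mollify n f x)) atTop
      (𝓝 (∫ x, partialDeriv j η x • T (f x))) := by
    refine tendsto_integral_of_norm_sub_le (b := fun n x => K' * ‖mollify n f x - f x‖)
      (Eventually.of_forall fun n => iη' _ (iT _ (hfn n))) (iη' _ (iT _ fi))
      (fun n => ((hfn n).sub fi).norm.const_mul K') (fun n x => ?_) ?_
    · rw [← smul_sub, norm_smul]
      exact mul_le_mul (hK' x) (hTL _ _) (norm_nonneg _) ((norm_nonneg _).trans (hK' x))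
    · simp only [integral_const_mul]
      simpa using (tendsto_integral_norm_mollify_sub fi).const_mul K'
  have t2 : Tendsto (fun n => ∫ x, η x • D (mollify n f x) (mollify n g x)) atTop
      (𝓝 (∫ x, η x • D (f x) (g x))) := by
    have i1 : ∀ n, Integrable fun x => ‖mollify n g x - g x‖ := fun n => ((hgn n).sub gi).norm
    have i2 : ∀ n, Integrable fun x => ‖D (mollify n f x) (g x) - D (f x) (g x)‖ := fun n =>
      ((iD _ _ (hfn n) gi).sub (iD _ _ fi gi)).norm
    -- Change one argument at a time: replacing `g` costs at most its `L¹` error, as `D` has norm at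
    -- most one, and replacing `f` is handled by dominated convergence.
    refine tendsto_integral_of_norm_sub_le (b := fun n x =>
        K * (‖mollify n g x - g x‖ + ‖D (mollify n f x) (g x) - D (f x) (g x)‖))
      (Eventually.of_forall fun n => iη _ (iD _ _ (hfn n) (hgn n))) (iη _ (iD _ _ fi gi))
      (fun n => ((i1 n).add (i2 n)).const_mul K) (fun n x => ?_) ?_
    · rw [← smul_sub, norm_smul]
      refine mul_le_mul (hK x) ?_ (norm_nonneg _) ((norm_nonneg _).trans (hK x))
      calc _ = ‖D (mollify n f x) (mollify n g x - g x)
            + (D (mollify n f x) (g x) - D (f x) (g x))‖ := by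
              rw [map_sub]
              congr 1
              ring
        _ ≤ _ := (norm_add_le _ _).trans (by gcongr; exact hDa _ _)
    · have e : ∀ n, ∫ x, K * (‖mollify n g x - g x‖ + ‖D (mollify n f x) (g x) - D (f x) (g x)‖) =
          K * ((∫ x, ‖mollify n g x - g x‖) + ∫ x, ‖D (mollify n f x) (g x) - D (f x) (g x)‖) :=
        fun n => by rw [integral_const_mul, integral_add (i1 n) (i2 n)]
      have t3 : Tendsto (fun n => ∫ x, ‖D (mollify n f x) (g x) - D (f x) (g x)‖) atTop
          (𝓝 (∫ _ : R3, (0 : ℝ))) := by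
        refine tendsto_integral_of_dominated_convergence (fun x => ‖g x‖ + ‖g x‖)
          (fun n => (i2 n).1) (gi.norm.add gi.norm) (fun n => Eventually.of_forall fun x => ?_) ?_
        · rw [norm_norm]
          exact (norm_sub_le _ _).trans (add_le_add (hDa _ _) (hDa _ _))
        · filter_upwards [ae_tendsto_mollify fi] with x hx
          have hc : Continuous fun z => ‖D z (g x) - D (f x) (g x)‖ := by fun_prop
          have := (hc.tendsto (f x)).comp hx
          simpa [Function.comp_def] using this
      simp only [e]
      simpa using ((tendsto_integral_norm_mollify_sub gi).add t3).const_mul K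
  have key := tendsto_nhds_unique (t1.congr' hibp) t2.neg
  simp only [← Complex.real_smul]
  rw [setIntegral_smul_eq_integral ((tsupport_partialDeriv_subset η j).trans h3),
    setIntegral_smul_eq_integral (f := fun x => D (ψ x) (G x j)) h3]
  have e1 : ∀ x, partialDeriv j η x • T (ψ x) = partialDeriv j η x • T (f x) := by
    intro x
    by_cases hx : x ∈ Ω
    · rw [hf, indicator_of_mem hx]
    · rw [partialDeriv_eq_zero fun h => hx (h3 h), zero_smul, zero_smul]
  have e2 : ∀ x, η x • D (ψ x) (G x j) = η x • D (f x) (g x) := by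
    intro x
    by_cases hx : x ∈ Ω
    · rw [hf, hg, indicator_of_mem hx, indicator_of_mem hx]
    · rw [image_eq_zero_of_notMem_tsupport fun h => hx (h3 h), zero_smul, zero_smul]
  rw [integral_congr_ae (Eventually.of_forall e1), integral_congr_ae (Eventually.of_forall e2)]
  exact key

/-! ### A smooth truncation of the modulus -/

/-- The truncation multiplies `z` by this function of `|z|²`; it maps the modulus `r > 1` to
`2 - 1 / r`. -/
def truncFactor (s : ℝ) : ℝ := 2 / √(max s 1) - 1 / max s 1

/-- Both branches, `0` for `s ≤ 1` and `s⁻² - s^(-3/2)` for `s ≥ 1`, vanish at `s = 1`, which makes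
the truncation `C¹`. -/
def truncFactorDeriv (s : ℝ) : ℝ := 1 / (max s 1) ^ 2 - 1 / (max s 1 * √(max s 1))

theorem continuous_truncFactorDeriv : Continuous truncFactorDeriv := by
  have hm : ∀ s : ℝ, 0 < max s 1 := fun s => lt_of_lt_of_le one_pos (le_max_right _ _)
  unfold truncFactorDeriv
  refine Continuous.sub (continuous_const.div (by fun_prop) fun s => ?_)
    (continuous_const.div (by fun_prop) fun s => ?_)
  · exact (pow_pos (hm s) 2).ne'
  · exact (mul_pos (hm s) (Real.sqrt_pos.2 (hm s))).ne'

theorem hasDerivAt_truncFactor (s : ℝ) :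
    HasDerivAt truncFactor (truncFactorDeriv s) s := by
  have hm : ∀ s : ℝ, 0 < max s 1 := fun s => lt_of_lt_of_le one_pos (le_max_right _ _)
  have hne : ∀ s : ℝ, s ≠ 1 → HasDerivAt truncFactor (truncFactorDeriv s) s := by
    intro s hs
    rcases lt_or_gt_of_ne hs with h | h
    · have h0 : truncFactorDeriv s = 0 := by
        simp [truncFactorDeriv, max_eq_right h.le]
      rw [h0]
      refine (hasDerivAt_const s (1 : ℝ)).congr_of_eventuallyEq ?_
      filter_upwards [gt_mem_nhds h] with t ht
      simp only [truncFactor, max_eq_right ht.le]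
      norm_num
    · have hs0 : 0 < s := one_pos.trans h
      have hsq : HasDerivAt (fun t => 2 / √t - 1 / t) (truncFactorDeriv s) s := by
        have h1 := (Real.hasDerivAt_sqrt hs0.ne').inv (Real.sqrt_pos.2 hs0).ne'
        have h2 := hasDerivAt_inv hs0.ne'
        have h3 := (h1.const_mul 2).sub h2
        have hr : √s * √s = s := Real.mul_self_sqrt hs0.le
        have hr0 : √s ≠ 0 := (Real.sqrt_pos.2 hs0).ne'
        convert! h3 using 1
        · ext t
          simp [div_eq_mul_inv]
        · rw [truncFactorDeriv, max_eq_left h.le, Real.sq_sqrt hs0.le]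
          field_simp
          ring
      refine hsq.congr_of_eventuallyEq ?_
      filter_upwards [lt_mem_nhds h] with t ht
      simp only [truncFactor, max_eq_left ht.le]
  have hc1 : Continuous truncFactor := by
    unfold truncFactor
    refine Continuous.sub (continuous_const.div (by fun_prop) fun s => ?_)
      (continuous_const.div (by fun_prop) fun s => (hm s).ne')
    exact (Real.sqrt_pos.2 (hm s)).ne'
  by_cases hs : s = 1
  · subst hs
    -- At the junction the derivative is the limit of the derivatives at neighbouring points.
    exact hasDerivAt_of_hasDerivAt_of_ne (fun y hy => hne y hy) hc1.continuousAt
      continuous_truncFactorDeriv.continuousAt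
  · exact hne s hs

theorem truncFactor_sq_of_le {r : ℝ} (h0 : 0 ≤ r) (h : r ≤ 1) : truncFactor (r ^ 2) = 1 := by
  rw [truncFactor, max_eq_right (by nlinarith)]
  norm_num

theorem truncFactorDeriv_sq_of_le {r : ℝ} (h0 : 0 ≤ r) (h : r ≤ 1) :
    truncFactorDeriv (r ^ 2) = 0 := by
  rw [truncFactorDeriv, max_eq_right (by nlinarith)]
  norm_num

theorem truncFactor_sq_of_ge {r : ℝ} (h : 1 ≤ r) : truncFactor (r ^ 2) = 2 / r - 1 / r ^ 2 := by
  rw [truncFactor, max_eq_left (by nlinarith), Real.sqrt_sq (by linarith)]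

theorem truncFactorDeriv_sq_of_ge {r : ℝ} (h : 1 ≤ r) :
    truncFactorDeriv (r ^ 2) = 1 / r ^ 4 - 1 / r ^ 3 := by
  rw [truncFactorDeriv, max_eq_left (by nlinarith), Real.sqrt_sq (by linarith)]
  ring

/-- A `C¹` truncation of the modulus, equivariant under changes of phase. -/
def trunc (z : ℂ) : ℂ := truncFactor (‖z‖ ^ 2) • z

/-- The derivative of `trunc`. -/
def truncDeriv (z : ℂ) : ℂ →L[ℝ] ℂ :=
  truncFactor (‖z‖ ^ 2) • ContinuousLinearMap.id ℝ ℂ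
    + (truncFactorDeriv (‖z‖ ^ 2) • ((2 : ℝ) • innerSL ℝ z)).smulRight z

theorem truncDeriv_apply (z w : ℂ) : truncDeriv z w =
    truncFactor (‖z‖ ^ 2) • w + (2 * truncFactorDeriv (‖z‖ ^ 2) * inner ℝ z w) • z := by
  have : truncDeriv z w = truncFactor (‖z‖ ^ 2) • w
      + (truncFactorDeriv (‖z‖ ^ 2) * (2 * inner ℝ z w)) • z := rfl
  rw [this]
  congr 2
  ring

theorem hasFDerivAt_trunc (z : ℂ) : HasFDerivAt trunc (truncDeriv z) z := by
  have h1 : HasFDerivAt (fun z : ℂ => ‖z‖ ^ 2) ((2 : ℝ) • innerSL ℝ z) z := by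
    convert! (hasStrictFDerivAt_norm_sq z).hasFDerivAt using 1
    rw [← Nat.cast_smul_eq_nsmul ℝ]
    rfl
  have h2 := (hasDerivAt_truncFactor (‖z‖ ^ 2)).comp_hasFDerivAt z h1
  exact h2.smul (hasFDerivAt_id z)

theorem continuous_truncDeriv : Continuous truncDeriv := by
  have hc1 : Continuous truncFactor := continuous_iff_continuousAt.2 fun s =>
    (hasDerivAt_truncFactor s).continuousAt
  have hc2 := continuous_truncFactorDeriv
  unfold truncDeriv
  have hn : Continuous fun z : ℂ => ‖z‖ ^ 2 := by fun_prop
  refine ((hc1.comp hn).smul continuous_const).add ?_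
  have hi : Continuous fun z : ℂ => truncFactorDeriv (‖z‖ ^ 2) • ((2 : ℝ) • innerSL ℝ z) :=
    (hc2.comp hn).smul (((innerSL ℝ (E := ℂ)).continuous).const_smul (2 : ℝ))
  exact ((ContinuousLinearMap.smulRightL ℝ ℂ ℂ).continuous.comp hi).clm_apply continuous_id

/-- At modulus `r > 1` the derivative stretches tangential vectors by `2/r - 1/r² = 1 - (1 - 1/r)²`
and radial ones by `1/r²`, the derivative of `2 - 1/r`. The identity `e` below is the tangential
bound with a non-positive radial correction. -/
theorem norm_truncDeriv_le (z : ℂ) : ‖truncDeriv z‖ ≤ 1 := by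
  refine ContinuousLinearMap.opNorm_le_bound _ zero_le_one fun w => ?_
  rw [one_mul, truncDeriv_apply]
  rcases le_or_gt ‖z‖ 1 with h | h
  · rw [truncFactor_sq_of_le (norm_nonneg z) h, truncFactorDeriv_sq_of_le (norm_nonneg z) h]
    simp
  · rw [truncFactor_sq_of_ge h.le, truncFactorDeriv_sq_of_ge h.le]
    set r := ‖z‖ with hr
    set i := inner ℝ z w with hi
    have hr0 : 0 < r := one_pos.trans h
    rw [← abs_of_nonneg (norm_nonneg w), ← abs_of_nonneg (norm_nonneg (_ + _)), ← sq_le_sq,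
      norm_add_sq_real, norm_smul, norm_smul, inner_smul_left, inner_smul_right,
      real_inner_comm, ← hi, ← hr]
    have e : (‖2 / r - 1 / r ^ 2‖ * ‖w‖) ^ 2
        + 2 * ((starRingEnd ℝ) (2 / r - 1 / r ^ 2) * (2 * (1 / r ^ 4 - 1 / r ^ 3) * i * i))
        + (‖2 * (1 / r ^ 4 - 1 / r ^ 3) * i‖ * r) ^ 2
        = (2 / r - 1 / r ^ 2) ^ 2 * ‖w‖ ^ 2 - 4 * i ^ 2 * (r - 1) / r ^ 5 := by
      rw [mul_pow, mul_pow, Real.norm_eq_abs, Real.norm_eq_abs, sq_abs, sq_abs]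
      simp only [conj_trivial]
      field_simp
      ring
    rw [e]
    have h1 : 0 ≤ 4 * i ^ 2 * (r - 1) / r ^ 5 := by
      have : 0 ≤ r - 1 := by linarith
      positivity
    have h2 : (2 / r - 1 / r ^ 2) ^ 2 ≤ 1 := by
      have e2 : 2 / r - 1 / r ^ 2 = 1 - (1 - 1 / r) ^ 2 := by field_simp; ring
      have h3 : 1 / r ≤ 1 := by rw [div_le_one hr0]; exact h.le
      have h4 : 0 < 1 / r := by positivity
      rw [e2]
      apply pow_le_one₀ <;> nlinarith
    nlinarith [sq_nonneg ‖w‖]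

theorem trunc_zero : trunc 0 = 0 := by simp [trunc]

theorem norm_trunc_of_le {z : ℂ} (h : ‖z‖ ≤ 1) : ‖trunc z‖ = ‖z‖ := by
  rw [trunc, truncFactor_sq_of_le (norm_nonneg z) h, one_smul]

theorem norm_trunc_of_ge {z : ℂ} (h : 1 ≤ ‖z‖) : ‖trunc z‖ = 2 - 1 / ‖z‖ := by
  have h0 : 0 < ‖z‖ := one_pos.trans_le h
  have e : truncFactor (‖z‖ ^ 2) * ‖z‖ = 2 - 1 / ‖z‖ := by
    rw [truncFactor_sq_of_ge h]
    field_simp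
  have h1 : 1 / ‖z‖ ≤ 1 := by rw [div_le_one h0]; exact h
  rw [trunc, norm_smul, Real.norm_eq_abs]
  calc |truncFactor (‖z‖ ^ 2)| * ‖z‖ = |truncFactor (‖z‖ ^ 2) * ‖z‖| := by
        rw [abs_mul, abs_norm]
    _ = 2 - 1 / ‖z‖ := by rw [e, abs_of_nonneg (by linarith)]

theorem norm_trunc_le_two (z : ℂ) : ‖trunc z‖ ≤ 2 := by
  rcases le_total ‖z‖ 1 with h | h
  · rw [norm_trunc_of_le h]; linarith
  · rw [norm_trunc_of_ge h]
    have : 0 ≤ 1 / ‖z‖ := by positivity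
    linarith

theorem norm_trunc_le (z : ℂ) : ‖trunc z‖ ≤ ‖z‖ := by
  rcases le_total ‖z‖ 1 with h | h
  · rw [norm_trunc_of_le h]
  · rw [norm_trunc_of_ge h]
    have h0 : 0 < ‖z‖ := one_pos.trans_le h
    have : ‖z‖ - (2 - 1 / ‖z‖) = (‖z‖ - 1) ^ 2 / ‖z‖ := by field_simp; ring
    have h2 : 0 ≤ (‖z‖ - 1) ^ 2 / ‖z‖ := by positivity
    linarith

/-- Truncation lowers the potential `|z|⁴ / 2 - |z|²`. -/
theorem potential_trunc_le (z : ℂ) :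
    ‖trunc z‖ ^ 4 / 2 + ‖z‖ ^ 2 ≤ ‖z‖ ^ 4 / 2 + ‖trunc z‖ ^ 2 := by
  rcases le_total ‖z‖ 1 with h | h
  · rw [norm_trunc_of_le h]
  -- The function `s² / 2 - s` increases for `s ≥ 1`. The truncation lowers `s = |z|²` but keeps it
  -- in this range.
  · have h1 : 1 ≤ ‖trunc z‖ := by
      rw [norm_trunc_of_ge h]
      have : 1 / ‖z‖ ≤ 1 := by rw [div_le_one (one_pos.trans_le h)]; exact h
      linarith
    have h2 := norm_trunc_le z
    have a1 : ‖trunc z‖ ^ 2 ≤ ‖z‖ ^ 2 := by gcongr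
    have a2 : 1 ≤ ‖trunc z‖ ^ 2 := one_le_pow₀ h1
    nlinarith

/-- The potential is lowered strictly where the modulus exceeds one. -/
theorem norm_le_one_of_potential_trunc_eq {z : ℂ}
    (h : ‖z‖ ^ 4 / 2 + ‖trunc z‖ ^ 2 ≤ ‖trunc z‖ ^ 4 / 2 + ‖z‖ ^ 2) : ‖z‖ ≤ 1 := by
  by_contra! hz
  have h0 : 0 < ‖z‖ := one_pos.trans hz
  have h1 : 1 ≤ ‖trunc z‖ := by
    rw [norm_trunc_of_ge hz.le]
    have : 1 / ‖z‖ ≤ 1 := by rw [div_le_one h0]; exact hz.le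
    linarith
  have h2 : ‖trunc z‖ < ‖z‖ := by
    rw [norm_trunc_of_ge hz.le]
    have e : ‖z‖ - (2 - 1 / ‖z‖) = (‖z‖ - 1) ^ 2 / ‖z‖ := by field_simp; ring
    have : 0 < (‖z‖ - 1) ^ 2 / ‖z‖ := by
      have : 0 < ‖z‖ - 1 := by linarith
      positivity
    linarith
  have a1 : ‖trunc z‖ ^ 2 < ‖z‖ ^ 2 := by gcongr
  have a2 : 1 ≤ ‖trunc z‖ ^ 2 := one_le_pow₀ h1
  nlinarith

/-! ### Truncation of order parameters -/

/-- The gradient of the truncation. -/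
def truncGrad (ψ : R3 → ℂ) (G : R3 → C3) (x : R3) : C3 :=
  WithLp.toLp 2 fun j => truncDeriv (ψ x) (G x j)

theorem continuous_trunc : Continuous trunc :=
  continuous_iff_continuousAt.2 fun z => (hasFDerivAt_trunc z).continuousAt

theorem norm_toLp_le {u w : Fin 3 → ℂ} (h : ∀ j, ‖u j‖ ≤ ‖w j‖) :
    ‖(WithLp.toLp 2 u : C3)‖ ≤ ‖(WithLp.toLp 2 w : C3)‖ := by
  rw [EuclideanSpace.norm_eq, EuclideanSpace.norm_eq]
  apply Real.sqrt_le_sqrt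
  refine Finset.sum_le_sum fun j _ => ?_
  have := h j
  gcongr

theorem norm_truncDeriv_apply_le (z w : ℂ) : ‖truncDeriv z w‖ ≤ ‖w‖ := by
  simpa using (truncDeriv z).le_of_opNorm_le (norm_truncDeriv_le z) w

theorem isWeakGrad_trunc (hΩ : IsOpen Ω) (hv : volume Ω ≠ ⊤) {ψ : R3 → ℂ} {G : R3 → C3}
    (hψ : MemLp ψ 2 (volume.restrict Ω)) (hG : MemLp G 2 (volume.restrict Ω))
    (h : IsWeakGrad Ω ψ G) :
    MemLp (fun x => trunc (ψ x)) 2 (volume.restrict Ω) ∧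
      IsWeakGrad Ω (fun x => trunc (ψ x)) (truncGrad ψ G) ∧
      MemLp (truncGrad ψ G) 2 (volume.restrict Ω) := by
  have : IsFiniteMeasure (volume.restrict Ω) := ⟨by
    rw [Measure.restrict_apply_univ]; exact hv.lt_top⟩
  refine ⟨hψ.of_le (continuous_trunc.comp_aestronglyMeasurable hψ.1)
    (Eventually.of_forall fun x => norm_trunc_le _),
    isWeakGrad_comp hasFDerivAt_trunc continuous_truncDeriv norm_truncDeriv_le trunc_zero hΩ
      (hψ.integrable (by norm_num)) (hG.integrable (by norm_num)) h, ?_⟩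
  have hc : Continuous fun p : ℂ × C3 =>
      (WithLp.toLp 2 fun j => truncDeriv p.1 (p.2 j) : C3) := by
    refine (PiLp.continuous_toLp 2 _).comp (continuous_pi fun j => ?_)
    exact (continuous_truncDeriv.comp continuous_fst).clm_apply (by fun_prop)
  have hpair : AEStronglyMeasurable (fun x => (ψ x, G x)) (volume.restrict Ω) :=
    hψ.1.prodMk hG.1
  have hm : AEStronglyMeasurable (truncGrad ψ G) (volume.restrict Ω) :=
    (hc.comp_aestronglyMeasurable hpair).congr (Eventually.of_forall fun x => rfl)
  refine hG.of_le hm (Eventually.of_forall fun x => ?_)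
  exact norm_toLp_le (u := fun j => truncDeriv (ψ x) (G x j)) (w := fun j => G x j)
    fun j => norm_truncDeriv_apply_le _ _

/-- The diamagnetic property of the truncation. -/
theorem norm_magField_trunc_le (b : ℝ) (A : R3 → R3) (ψ : R3 → ℂ) (G : R3 → C3) (x : R3) :
    ‖magField b A (fun x => trunc (ψ x)) (truncGrad ψ G) x‖ ≤ ‖magField b A ψ G x‖ := by
  refine norm_toLp_le fun j => ?_
  set m : ℂ := -Complex.I * G x j + ((b * A x j : ℝ) : ℂ) * ψ x with hm
  -- Up to the factor `i`, `m` is the covariant derivative of `ψ`. The covariant derivative of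
  -- `trunc ψ` turns out to be `truncDeriv (ψ x)` applied to it, and this map is a contraction.
  have e1 : Complex.I * m = G x j + (b * A x j) • (Complex.I * ψ x) := by
    rw [hm, Complex.real_smul]
    linear_combination (-G x j) * Complex.I_sq
  -- The infinitesimal form of rotation equivariance: `iψ` is orthogonal to `ψ`, so the radial term
  -- drops out.
  have e2 : truncDeriv (ψ x) (Complex.I * ψ x) = Complex.I * trunc (ψ x) := by
    have : inner ℝ (ψ x) (Complex.I * ψ x) = 0 := by
      simp [Complex.inner]
      ring
    rw [truncDeriv_apply, this, trunc]
    simp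
    ring
  have e3 : -Complex.I * truncGrad ψ G x j + ((b * A x j : ℝ) : ℂ) * trunc (ψ x) =
      -Complex.I * truncDeriv (ψ x) (Complex.I * m) := by
    rw [e1, map_add, map_smul, e2, Complex.real_smul]
    simp only [truncGrad]
    linear_combination (((b * A x j : ℝ) : ℂ) * trunc (ψ x)) * Complex.I_sq
  rw [e3, norm_mul]
  calc _ ≤ ‖-Complex.I‖ * ‖Complex.I * m‖ := by
        gcongr
        exact norm_truncDeriv_apply_le _ _
    _ = ‖m‖ := by simp

/-- The quartic term of one function is paired with the quadratic term of another, so that potential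
energies can be compared in `[0, ∞]` without subtraction. -/
theorem lintegral_potential_eq {κ : ℝ} {φ ψ : R3 → ℂ}
    (hφ : AEStronglyMeasurable φ (volume.restrict Ω)) :
    ENNReal.ofReal (κ ^ 2 / 2) * (∫⁻ x in Ω, ‖φ x‖ₑ ^ 4) + negEnergy Ω κ ψ =
      ∫⁻ x in Ω, ENNReal.ofReal (κ ^ 2 * (‖φ x‖ ^ 4 / 2 + ‖ψ x‖ ^ 2)) := by
  rw [negEnergy, ← lintegral_const_mul' _ _ ENNReal.ofReal_ne_top,
    ← lintegral_const_mul' _ _ ENNReal.ofReal_ne_top, ← lintegral_add_left']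
  · refine lintegral_congr fun x => ?_
    rw [← ofReal_norm, ← ofReal_norm, ← ENNReal.ofReal_pow (norm_nonneg _),
      ← ENNReal.ofReal_pow (norm_nonneg _), ← ENNReal.ofReal_mul (by positivity),
      ← ENNReal.ofReal_mul (by positivity), ← ENNReal.ofReal_add (by positivity) (by positivity)]
    congr 1
    ring
  · exact (hφ.enorm.pow_const 4).const_mul _

/-- Since `|trunc ψ|⁴ ≤ 4|ψ|²`, this term is finite even if `|ψ|⁴` is not integrable. It can
therefore be cancelled from inequalities in `[0, ∞]`. -/
theorem quartic_trunc_ne_top {κ : ℝ} {ψ : R3 → ℂ} (hψ : MemLp ψ 2 (volume.restrict Ω)) :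
    ENNReal.ofReal (κ ^ 2 / 2) * (∫⁻ x in Ω, ‖trunc (ψ x)‖ₑ ^ 4) ≠ ⊤ := by
  refine ENNReal.mul_ne_top ENNReal.ofReal_ne_top (ne_top_of_le_ne_top
    (ENNReal.mul_ne_top (a := 4) (by simp) (lintegral_sq_lt_top hψ).ne) ?_)
  rw [← lintegral_const_mul' _ _ (by simp)]
  refine lintegral_mono fun x => ?_
  have h1 := norm_trunc_le (ψ x)
  have h2 := norm_trunc_le_two (ψ x)
  rw [← ofReal_norm, ← ofReal_norm, ← ENNReal.ofReal_pow (norm_nonneg _),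
    ← ENNReal.ofReal_pow (norm_nonneg _), show (4 : ℝ≥0∞) = ENNReal.ofReal 4 by simp,
    ← ENNReal.ofReal_mul (by norm_num)]
  apply ENNReal.ofReal_le_ofReal
  calc ‖trunc (ψ x)‖ ^ 4 = ‖trunc (ψ x)‖ ^ 2 * ‖trunc (ψ x)‖ ^ 2 := by ring
    _ ≤ 2 ^ 2 * ‖ψ x‖ ^ 2 := by gcongr
    _ = _ := by norm_num

theorem lintegral_magField_trunc_le (b : ℝ) (A : R3 → R3) (ψ : R3 → ℂ) (G : R3 → C3) :
    ∫⁻ x in Ω, ‖magField b A (fun x => trunc (ψ x)) (truncGrad ψ G) x‖ₑ ^ 2 ≤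
      ∫⁻ x in Ω, ‖magField b A ψ G x‖ₑ ^ 2 := by
  refine lintegral_mono fun x => ?_
  have := norm_magField_trunc_le b A ψ G x
  rw [← ofReal_norm, ← ofReal_norm]
  gcongr

/-- Truncation raises neither the kinetic nor the potential energy. The argument adds the finite
quartic term of the truncation to both sides and then cancels it. -/
theorem negEnergy_le_posEnergy_of_trunc {κ H : ℝ} {A C : R3 → R3} {ψ : R3 → ℂ} {G : R3 → C3}
    (hψ : MemLp ψ 2 (volume.restrict Ω))
    (h : negEnergy Ω κ (fun x => trunc (ψ x)) ≤
      posEnergy Ω U κ H (fun x => trunc (ψ x)) A (truncGrad ψ G) C) :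
    negEnergy Ω κ ψ ≤ posEnergy Ω U κ H ψ A G C := by
  have hpot : ENNReal.ofReal (κ ^ 2 / 2) * (∫⁻ x in Ω, ‖trunc (ψ x)‖ₑ ^ 4) + negEnergy Ω κ ψ ≤
      ENNReal.ofReal (κ ^ 2 / 2) * (∫⁻ x in Ω, ‖ψ x‖ₑ ^ 4)
        + negEnergy Ω κ (fun x => trunc (ψ x)) := by
    rw [lintegral_potential_eq (continuous_trunc.comp_aestronglyMeasurable hψ.1),
      lintegral_potential_eq hψ.1]
    exact lintegral_mono fun x => ENNReal.ofReal_le_ofReal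
      (mul_le_mul_of_nonneg_left (potential_trunc_le _) (sq_nonneg κ))
  have hk := lintegral_magField_trunc_le (Ω := Ω) (κ * H) A ψ G
  have hq := quartic_trunc_ne_top (κ := κ) hψ
  unfold posEnergy at h ⊢
  rw [← ENNReal.add_le_add_iff_left hq]
  refine hpot.trans ((add_le_add_right h _).trans ?_)
  calc _ ≤ ENNReal.ofReal (κ ^ 2 / 2) * (∫⁻ x in Ω, ‖ψ x‖ₑ ^ 4) +
      ((∫⁻ x in Ω, ‖magField (κ * H) A ψ G x‖ₑ ^ 2) +
        ENNReal.ofReal (κ ^ 2 / 2) * (∫⁻ x in Ω, ‖trunc (ψ x)‖ₑ ^ 4) +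
        ENNReal.ofReal (κ ^ 2 * H ^ 2) * (∫⁻ x in U, ‖C x - beta‖ₑ ^ 2)) := by gcongr
    _ = _ := by ring

/-- The two hypotheses leave no room for a decrease of energy under truncation, so the potential
inequality is an equality almost everywhere; it would be strict where `|ψ| > 1`. -/
theorem norm_le_one_of_trunc {κ H : ℝ} (hκ : 0 < κ) {A C : R3 → R3} {ψ : R3 → ℂ} {G : R3 → C3}
    (hψ : MemLp ψ 2 (volume.restrict Ω))
    (h : negEnergy Ω κ (fun x => trunc (ψ x)) ≤
      posEnergy Ω U κ H (fun x => trunc (ψ x)) A (truncGrad ψ G) C)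
    (h0 : posEnergy Ω U κ H ψ A G C ≤ negEnergy Ω κ ψ) :
    ∀ᵐ x ∂volume.restrict Ω, ‖ψ x‖ ≤ 1 := by
  have hk := lintegral_magField_trunc_le (Ω := Ω) (κ * H) A ψ G
  have hq := quartic_trunc_ne_top (κ := κ) hψ
  have hN := negEnergy_ne_top (κ := κ) hψ
  have hle : ENNReal.ofReal (κ ^ 2 / 2) * (∫⁻ x in Ω, ‖ψ x‖ₑ ^ 4)
        + negEnergy Ω κ (fun x => trunc (ψ x)) ≤
      ENNReal.ofReal (κ ^ 2 / 2) * (∫⁻ x in Ω, ‖trunc (ψ x)‖ₑ ^ 4) + negEnergy Ω κ ψ := by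
    refine (add_le_add_right h _).trans (le_trans ?_ (add_le_add_right h0 _))
    unfold posEnergy
    calc _ ≤ ENNReal.ofReal (κ ^ 2 / 2) * (∫⁻ x in Ω, ‖ψ x‖ₑ ^ 4) +
      ((∫⁻ x in Ω, ‖magField (κ * H) A ψ G x‖ₑ ^ 2) +
        ENNReal.ofReal (κ ^ 2 / 2) * (∫⁻ x in Ω, ‖trunc (ψ x)‖ₑ ^ 4) +
        ENNReal.ofReal (κ ^ 2 * H ^ 2) * (∫⁻ x in U, ‖C x - beta‖ₑ ^ 2)) := by gcongr
      _ = _ := by ring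
  have hTm : AEStronglyMeasurable (fun x => trunc (ψ x)) (volume.restrict Ω) :=
    continuous_trunc.comp_aestronglyMeasurable hψ.1
  have hfin := ENNReal.add_ne_top.2 ⟨hq, hN⟩
  rw [lintegral_potential_eq hTm] at hfin
  rw [lintegral_potential_eq hTm, lintegral_potential_eq hψ.1] at hle
  have hmeas : AEMeasurable (fun x => ENNReal.ofReal (κ ^ 2 * (‖ψ x‖ ^ 4 / 2 + ‖trunc (ψ x)‖ ^ 2)))
      (volume.restrict Ω) := by
    refine (AEMeasurable.const_mul ?_ _).ennreal_ofReal
    exact ((hψ.1.norm.aemeasurable.pow_const 4).div_const 2).add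
      (hTm.norm.aemeasurable.pow_const 2)
  -- A pointwise inequality with the reverse inequality between finite integrals is an equality
  -- almost everywhere.
  have hae := ae_eq_of_ae_le_of_lintegral_le (Eventually.of_forall fun x =>
    ENNReal.ofReal_le_ofReal (mul_le_mul_of_nonneg_left (potential_trunc_le (ψ x)) (sq_nonneg κ)))
    hfin hmeas hle
  filter_upwards [hae] with x hx
  rw [ENNReal.ofReal_eq_ofReal_iff (by positivity) (by positivity)] at hx
  have := mul_left_cancel₀ (by positivity) hx
  exact norm_le_one_of_potential_trunc_eq this.ge

/-! ### Global minimality -/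

theorem isFiniteMeasure_restrict (hb : Bornology.IsBounded Ω) :
    IsFiniteMeasure (volume.restrict Ω) := ⟨by
  rw [Measure.restrict_apply_univ]
  exact hb.measure_lt_top⟩

theorem MemHdot1Div.isWeakCurl_F_add {a : R3 → R3} (ha : MemHdot1Div a) :
    ∃ C, IsWeakCurl univ a C ∧ MemLp C 2 volume ∧
      ∀ s : ℝ, IsWeakCurl univ (fun x => F x + s • a x) (fun x => beta + s • C x) := by
  obtain ⟨C, hC, hC2⟩ := ha.1.isWeakCurl
  exact ⟨C, hC, hC2, fun s => isWeakCurl_F.add (hC.const_smul s)⟩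

theorem isState_normal : IsState Ω 0 F := by
  refine ⟨⟨MemLp.zero, 0, isWeakGrad_zero, MemLp.zero⟩, ?_⟩
  simp only [sub_self]
  exact MemHdot1Div.zero

theorem glEnergy_normal (hΩ : IsOpen Ω) (κ H : ℝ) : glEnergy Ω κ H 0 F = 0 :=
  energy_normal hΩ isOpen_univ isWeakCurl_F

theorem isMinimizer_normal_iff (hΩ : IsOpen Ω) {κ H : ℝ} :
    IsMinimizer Ω κ H 0 F ↔ ∀ φ B, IsState Ω φ B → 0 ≤ glEnergy Ω κ H φ B := by
  rw [IsMinimizer, glEnergy_normal hΩ]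
  exact ⟨fun h => h.2, fun h => ⟨isState_normal, h⟩⟩

theorem IsState.exists_curl {ψ : R3 → ℂ} {A : R3 → R3} (h : IsState Ω ψ A) :
    ∃ C, IsWeakCurl univ (fun x => A x - F x) C ∧ MemLp C 2 volume ∧
      IsWeakCurl univ A (fun x => beta + C x) := by
  obtain ⟨C, h1, h2, h3⟩ := h.2.isWeakCurl_F_add
  refine ⟨C, h1, h2, ?_⟩
  have := h3 1
  simpa using this

theorem memLp_of_memHdot1 (hb : Bornology.IsBounded Ω) {a : R3 → R3} (ha : MemHdot1 a) :
    MemLp a 2 (volume.restrict Ω) := by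
  have := isFiniteMeasure_restrict hb
  exact (ha.1.restrict Ω).mono_exponent (by norm_num)

theorem IsState.memLp_potential (hb : Bornology.IsBounded Ω) {ψ : R3 → ℂ} {A : R3 → R3}
    (h : IsState Ω ψ A) : MemLp A 2 (volume.restrict Ω) := by
  have := (memLp_F hb).add (memLp_of_memHdot1 hb h.2.1)
  simpa [Pi.add_def] using this

theorem posEnergy_mono_set {V : Set R3} (hUV : U ⊆ V) {κ H : ℝ} {ψ : R3 → ℂ} {A C : R3 → R3}
    {G : R3 → C3} : posEnergy Ω U κ H ψ A G C ≤ posEnergy Ω V κ H ψ A G C := by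
  unfold posEnergy
  gcongr

theorem enorm_eq_of_norm_eq {E E' : Type*} [NormedAddCommGroup E] [NormedAddCommGroup E'] {x : E}
    {y : E'} (h : ‖x‖ = ‖y‖) : ‖x‖ₑ = ‖y‖ₑ := by
  rw [← ofReal_norm, ← ofReal_norm, h]

/-- A bounded order parameter and a potential on space can be replaced by a state of the modified
functional with the same moduli and at most the same energy. -/
theorem exists_stateMod (hΩ : IsOpen Ω) (hc : IsConnected Ω) (hb : Bornology.IsBounded Ω)
    {A C : R3 → R3} (hA : MemLp A 2 (volume.restrict Ω)) (hC : MemLp C 2 volume)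
    (hAC : IsWeakCurl univ A (fun x => beta + C x)) {κ H M : ℝ} {ψ : R3 → ℂ} {G : R3 → C3}
    (hψ : MemLp ψ 2 (volume.restrict Ω)) (hM : ∀ᵐ x ∂volume.restrict Ω, ‖ψ x‖ ≤ M)
    (hG : IsWeakGrad Ω ψ G) (hG2 : MemLp G 2 (volume.restrict Ω)) :
    ∃ ψ' A', IsStateMod Ω ψ' A' ∧ (∀ x, ‖ψ' x‖ = ‖ψ x‖) ∧
      (0 ≤ glEnergyMod Ω κ H ψ' A' →
        negEnergy Ω κ ψ ≤ posEnergy Ω univ κ H ψ A G (fun x => beta + C x)) ∧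
      (posEnergy Ω univ κ H ψ A G (fun x => beta + C x) ≤ negEnergy Ω κ ψ →
        glEnergyMod Ω κ H ψ' A' ≤ 0) := by
  have := isFiniteMeasure_restrict hb
  obtain ⟨A', χ, hA', hA'C, hg⟩ := exists_gauge hΩ hc hb hA (hAC.mono (subset_univ Ω))
    ((memLp_const beta).add (hC.restrict Ω))
  obtain ⟨m1, G', g1, g2, g3⟩ := hg (κ * H) M ψ G hψ hM hG hG2
  have hn : ∀ x, ‖phase (κ * H) χ x * ψ x‖ = ‖ψ x‖ := fun x => by
    rw [norm_mul, norm_phase, one_mul]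
  have e1 : negEnergy Ω κ (fun x => phase (κ * H) χ x * ψ x) = negEnergy Ω κ ψ := by
    unfold negEnergy
    simp only [fun x => enorm_eq_of_norm_eq (hn x)]
  -- The gauge change preserves every term over `Ω`; only the field energy outside `Ω` is discarded.
  have e2 : posEnergy Ω Ω κ H (fun x => phase (κ * H) χ x * ψ x) A' G' (fun x => beta + C x) ≤
      posEnergy Ω univ κ H ψ A G (fun x => beta + C x) := by
    refine le_trans (le_of_eq ?_) (posEnergy_mono_set (subset_univ Ω))
    unfold posEnergy
    simp only [fun x => enorm_eq_of_norm_eq (hn x), fun x => enorm_eq_of_norm_eq (g3 x)]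
  refine ⟨_, A', ⟨⟨m1, G', g1, g2⟩, hA'⟩, hn, fun h => ?_, fun h => ?_⟩
  · rw [glEnergyMod, energy_nonneg_iff hΩ hΩ m1 g1 hA'C, e1] at h
    exact h.trans e2
  · rw [glEnergyMod, energy_nonpos_iff hΩ hΩ g1 hA'C, e1]
    exact e2.trans h

theorem glEnergyMod_nonneg (hΩ : IsOpen Ω) {FΩ : R3 → R3} (hF : IsNormalPotential Ω FΩ) {κ H : ℝ}
    (h : IsMinimizerMod Ω κ H 0 FΩ) {ψ : R3 → ℂ} {A : R3 → R3} (hs : IsStateMod Ω ψ A) :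
    0 ≤ glEnergyMod Ω κ H ψ A := by
  have := h.2 ψ A hs
  rwa [glEnergyMod, energy_normal hΩ hΩ hF.2] at this

/-- The truncation has modulus at most `2`, so it can be transformed into a state of the modified
functional, whose energy is non-negative. -/
theorem negEnergy_trunc_le (hΩ : IsOpen Ω) (hc : IsConnected Ω) (hb : Bornology.IsBounded Ω)
    {FΩ : R3 → R3} (hF : IsNormalPotential Ω FΩ) {κ H : ℝ} (h : IsMinimizerMod Ω κ H 0 FΩ)
    {A C : R3 → R3} (hA : MemLp A 2 (volume.restrict Ω)) (hC : MemLp C 2 volume)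
    (hAC : IsWeakCurl univ A (fun x => beta + C x)) {ψ : R3 → ℂ} {G : R3 → C3}
    (hψ : MemLp ψ 2 (volume.restrict Ω)) (hG : IsWeakGrad Ω ψ G)
    (hG2 : MemLp G 2 (volume.restrict Ω)) :
    negEnergy Ω κ (fun x => trunc (ψ x)) ≤
      posEnergy Ω univ κ H (fun x => trunc (ψ x)) A (truncGrad ψ G) (fun x => beta + C x) := by
  obtain ⟨t1, t2, t3⟩ := isWeakGrad_trunc hΩ hb.measure_lt_top.ne hψ hG2 hG
  obtain ⟨ψ', A', hs, -, h1, -⟩ := exists_stateMod (κ := κ) (H := H) hΩ hc hb hA hC hAC t1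
    (Eventually.of_forall fun x => norm_trunc_le_two (ψ x)) t2 t3
  exact h1 (glEnergyMod_nonneg hΩ hF h hs)

theorem isMinimizer_of_mod (hΩ : IsOpen Ω) (hc : IsConnected Ω) (hb : Bornology.IsBounded Ω)
    {FΩ : R3 → R3} (hF : IsNormalPotential Ω FΩ) {κ H : ℝ} (h : IsMinimizerMod Ω κ H 0 FΩ) :
    IsMinimizer Ω κ H 0 F := by
  rw [isMinimizer_normal_iff hΩ]
  intro ψ A hs
  obtain ⟨C, -, hC, hAC⟩ := hs.exists_curl
  have hA := hs.memLp_potential hb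
  obtain ⟨⟨hψ, G, hG, hG2⟩, -⟩ := hs
  rw [glEnergy, energy_nonneg_iff hΩ isOpen_univ hψ hG hAC]
  exact negEnergy_le_posEnergy_of_trunc hψ
    (negEnergy_trunc_le hΩ hc hb hF h hA hC hAC hψ hG hG2)

theorem isUniqueMinimizer_of_mod (hΩ : IsOpen Ω) (hc : IsConnected Ω)
    (hb : Bornology.IsBounded Ω) {FΩ : R3 → R3} (hF : IsNormalPotential Ω FΩ) {κ H : ℝ}
    (hκ : 0 < κ) (hH : 0 < H) (h : IsUniqueMinimizerMod Ω κ H FΩ) : IsUniqueMinimizer Ω κ H := by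
  refine ⟨isMinimizer_of_mod hΩ hc hb hF h.1, ?_⟩
  rintro ψ A ⟨hs, hmin⟩
  have hE : glEnergy Ω κ H ψ A ≤ 0 := by
    have := hmin 0 F isState_normal
    rwa [glEnergy_normal hΩ] at this
  obtain ⟨C, haC, hC, hAC⟩ := hs.exists_curl
  have hA := hs.memLp_potential hb
  obtain ⟨⟨hψ, G, hG, hG2⟩, ha⟩ := hs
  rw [glEnergy, energy_nonpos_iff hΩ isOpen_univ hG hAC] at hE
  -- Now `ψ` itself is bounded, and the gauge change applies to it without truncation.
  have hM := norm_le_one_of_trunc hκ hψ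
    (negEnergy_trunc_le hΩ hc hb hF h.1 hA hC hAC hψ hG hG2) hE
  obtain ⟨ψ', A', hs', hn, -, hE'⟩ := exists_stateMod (κ := κ) (H := H) hΩ hc hb hA hC hAC hψ hM
    hG hG2
  -- The transformed state has energy at most zero, so it is a minimizer of the modified functional
  -- and uniqueness applies.
  have hψ' := (h.2 ψ' A' ⟨hs', fun φ B hφ =>
    (hE' hE).trans (glEnergyMod_nonneg hΩ hF h.1 hφ)⟩).1
  have hψ0 : ψ =ᵐ[volume.restrict Ω] 0 := by
    filter_upwards [hψ'] with x hx
    have := hn x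
    rw [hx] at this
    simpa using this.symm
  refine ⟨hψ0, ?_⟩
  have hneg : negEnergy Ω κ ψ = 0 := by
    have : ∫⁻ x in Ω, ‖ψ x‖ₑ ^ 2 = 0 := by
      refine (lintegral_congr_ae ?_).trans lintegral_zero
      filter_upwards [hψ0] with x hx
      rw [hx]
      simp
    rw [negEnergy, this, mul_zero]
  rw [hneg, nonpos_iff_eq_zero, posEnergy, add_eq_zero] at hE
  -- The negative part is zero, so every non-negative term vanishes. The field energy has the
  -- positive weight `κ² H²`.
  have hC0 : C =ᵐ[volume] 0 := by
    have h1 : ∫⁻ x, ‖C x‖ₑ ^ 2 = 0 := by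
      have := (mul_eq_zero.1 hE.2).resolve_left (by
        rw [ENNReal.ofReal_eq_zero, not_le]
        positivity)
      simpa using this
    rw [lintegral_eq_zero_iff' (hC.1.enorm.pow_const 2)] at h1
    filter_upwards [h1] with x hx
    simpa using hx
  filter_upwards [ha.ae_eq_zero haC hC0] with x hx
  exact sub_eq_zero.1 hx

/-! ### Local minimality -/

/-- The second derivative at zero is `2a`. The sum `f t + f (-t)` contains no cubic term, so `a + c
t² ≥ 0` for all `t ≠ 0`, which excludes `a < 0`. -/
theorem iteratedDeriv_two_nonneg {f : ℝ → ℝ} {a b c : ℝ}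
    (hf : ∀ s, f s = a * s ^ 2 + b * s ^ 3 + c * s ^ 4) (h0 : ∀ s, 0 ≤ f s) :
    0 ≤ iteratedDeriv 2 f 0 := by
  have h1 : ∀ s, HasDerivAt f (2 * a * s + 3 * b * s ^ 2 + 4 * c * s ^ 3) s := by
    intro s
    rw [funext hf]
    convert! (((hasDerivAt_pow 2 s).const_mul a).add ((hasDerivAt_pow 3 s).const_mul b)).add
      ((hasDerivAt_pow 4 s).const_mul c) using 1
    norm_num
    ring
  have h2 : HasDerivAt (deriv f) (2 * a) 0 := by
    rw [funext fun s => (h1 s).deriv]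
    convert! (((hasDerivAt_id (0 : ℝ)).const_mul (2 * a)).add
      ((hasDerivAt_pow 2 (0 : ℝ)).const_mul (3 * b))).add
      ((hasDerivAt_pow 3 (0 : ℝ)).const_mul (4 * c)) using 1
    norm_num
  rw [iteratedDeriv_succ, iteratedDeriv_one, h2.deriv]
  by_contra! hneg
  have ha : a < 0 := by linarith
  -- This `t` makes `c t² ≤ -a / 2`, so that `a + c t² ≤ a / 2 < 0`.
  set t : ℝ := √(-a / (2 * (|c| + 1))) with ht
  have htq : t ^ 2 = -a / (2 * (|c| + 1)) := by
    rw [ht, Real.sq_sqrt]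
    have : 0 < -a := by linarith
    positivity
  have htp : 0 < t ^ 2 := by
    rw [htq]
    have : 0 < -a := by linarith
    positivity
  have h3 := h0 t
  have h4 := h0 (-t)
  rw [hf] at h3 h4
  have h5 : 0 ≤ t ^ 2 * (a + c * t ^ 2) := by nlinarith
  have h6 : 0 ≤ a + c * t ^ 2 := nonneg_of_mul_nonneg_right h5 htp
  have h7 : c * t ^ 2 ≤ (|c| + 1) * t ^ 2 := by
    gcongr
    linarith [le_abs_self c]
  have h8 : (|c| + 1) * t ^ 2 = -a / 2 := by
    rw [htq]
    field_simp
  linarith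

theorem integral_sq_toReal {α E : Type*} [MeasurableSpace α] {μ : Measure α}
    [NormedAddCommGroup E] {f : α → E} (hf : AEStronglyMeasurable f μ) :
    (∫⁻ x, ‖f x‖ₑ ^ 2 ∂μ).toReal = ∫ x, ‖f x‖ ^ 2 ∂μ := by
  rw [integral_eq_lintegral_of_nonneg_ae (f := fun x => ‖f x‖ ^ 2)
    (Eventually.of_forall fun x => sq_nonneg _) (hf.norm.pow 2)]
  congr 1
  refine lintegral_congr fun x => ?_
  rw [ENNReal.ofReal_pow (norm_nonneg _), ofReal_norm]

theorem memLp_of_lintegral_sq {α E : Type*} [MeasurableSpace α] {μ : Measure α}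
    [NormedAddCommGroup E] {f : α → E} (hf : AEStronglyMeasurable f μ)
    (h : ∫⁻ x, ‖f x‖ₑ ^ 2 ∂μ < ⊤) : MemLp f 2 μ := by
  refine ⟨hf, ?_⟩
  rw [eLpNorm_lt_top_iff_lintegral_rpow_enorm_lt_top (by simp) (by simp)]
  simpa using h

theorem norm_smul_add_sq {E : Type*} [NormedAddCommGroup E] [InnerProductSpace ℂ E] (p q : E)
    (s : ℝ) : ‖(s : ℂ) • p + ((s : ℂ) ^ 2) • q‖ ^ 2 =
      s ^ 2 * ‖p‖ ^ 2 + s ^ 3 * (‖p + q‖ ^ 2 - ‖p‖ ^ 2 - ‖q‖ ^ 2) + s ^ 4 * ‖q‖ ^ 2 := by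
  rw [norm_add_sq (𝕜 := ℂ), norm_add_sq (𝕜 := ℂ) p q, norm_smul, norm_smul, inner_smul_left,
    inner_smul_right]
  have : RCLike.re ((starRingEnd ℂ) (s : ℂ) * ((s : ℂ) ^ 2 * inner ℂ p q)) =
      s ^ 3 * RCLike.re (inner ℂ p q : ℂ) := by
    rw [Complex.conj_ofReal, ← mul_assoc, show (s : ℂ) * (s : ℂ) ^ 2 = ((s ^ 3 : ℝ) : ℂ) by
      push_cast; ring]
    exact Complex.re_ofReal_mul _ _
  rw [this]
  simp only [norm_pow, Complex.norm_real, Real.norm_eq_abs, mul_pow, sq_abs]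
  ring

theorem MemHdot1Div.const_smul {a : R3 → R3} (ha : MemHdot1Div a) (s : ℝ) :
    MemHdot1Div fun x => s • a x := by
  obtain ⟨⟨ha6, u, D, hu, hD, hua, huD⟩, hdiv⟩ := ha
  refine ⟨⟨ha6.const_smul s, fun n x => s • u n x, fun x => s • D x,
    fun n => ⟨(hu n).1.const_smul s,
      (hu n).2.comp_left (g := fun y : R3 => s • y) (smul_zero s)⟩,
    hD.const_smul s, ?_, ?_⟩, ?_⟩
  · have e : ∀ n, eLpNorm ((fun x => s • u n x) - fun x => s • a x) 6 volume =
        ‖s‖ₑ * eLpNorm (u n - a) 6 volume := fun n => by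
      rw [← eLpNorm_const_smul]
      congr 1
      ext1 x
      simp [smul_sub]
    simp only [e]
    simpa using ENNReal.Tendsto.const_mul hua (Or.inr enorm_ne_top)
  · have e : ∀ n, eLpNorm (fderiv ℝ (fun x => s • u n x) - fun x => s • D x) 2 volume =
        ‖s‖ₑ * eLpNorm (fderiv ℝ (u n) - D) 2 volume := fun n => by
      rw [← eLpNorm_const_smul]
      congr 1
      ext1 x
      simp only [Pi.sub_apply, Pi.smul_apply, smul_sub]
      rw [fderiv_fun_const_smul ((hu n).1.differentiable (by simp) x)]
    simp only [e]
    simpa using ENNReal.Tendsto.const_mul huD (Or.inr enorm_ne_top)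
  · intro v hv hc
    simp only [inner_smul_left]
    rw [integral_const_mul, hdiv v hv hc, mul_zero]

theorem toReal_coe_sub_coe {x y : ℝ≥0∞} (hx : x ≠ ⊤) (hy : y ≠ ⊤) :
    ((x : EReal) - (y : EReal)).toReal = x.toReal - y.toReal := by
  rw [EReal.toReal_sub (by simpa using hx) (by simp) (by simpa using hy) (by simp),
    EReal.toReal_coe_ennreal, EReal.toReal_coe_ennreal]

theorem top_sub_coe_toReal {y : ℝ≥0∞} (hy : y ≠ ⊤) :
    (((⊤ : ℝ≥0∞) : EReal) - (y : EReal)).toReal = 0 := by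
  lift y to NNReal using hy
  rw [EReal.coe_ennreal_top, EReal.coe_nnreal_eq_coe_real, EReal.top_sub_coe, EReal.toReal_top]

theorem negEnergy_toReal {κ : ℝ} {ψ : R3 → ℂ} (hψ : MemLp ψ 2 (volume.restrict Ω)) :
    (negEnergy Ω κ ψ).toReal = κ ^ 2 * ∫ x in Ω, ‖ψ x‖ ^ 2 := by
  rw [negEnergy, ENNReal.toReal_mul, ENNReal.toReal_ofReal (sq_nonneg κ),
    integral_sq_toReal hψ.1]

/-- Along the line the magnetic gradient is `s p + s² q`, with `p` always in `L²` and `q = κ H φ a`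
possibly not. The energy is thus a non-negative quartic in `s` starting with `s²`, unless it is
infinite. -/
theorem hessNonneg_of_isMinimizer (hΩ : IsOpen Ω) (hb : Bornology.IsBounded Ω) {κ H : ℝ}
    (hκ : 0 < κ) (h : IsMinimizer Ω κ H 0 F) : HessNonneg Ω κ H := by
  rintro φ a ⟨hφ, G, hG, hG2⟩ ha
  rw [isMinimizer_normal_iff hΩ] at h
  obtain ⟨C, -, hC, hAC⟩ := ha.isWeakCurl_F_add
  set b := κ * H with hbdef
  let p : R3 → C3 := magField b F φ G
  let q : R3 → C3 := fun x => φ x • ((b : ℂ) • cplx (a x))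
  have hstate : ∀ s : ℝ, IsState Ω (fun x => (s : ℂ) * φ x) (fun x => F x + s • a x) := by
    intro s
    refine ⟨⟨hφ.const_mul _, _, hG.const_mul s, hG2.const_smul (s : ℂ)⟩, ?_⟩
    have : (fun x => F x + s • a x - F x) = fun x => s • a x := by
      ext1 x
      abel
    rw [this]
    exact ha.const_smul s
  have hpos : ∀ s : ℝ, 0 ≤ (glEnergy Ω κ H (fun x => (s : ℂ) * φ x)
      (fun x => F x + s • a x)).toReal := fun s => EReal.toReal_nonneg (h _ _ (hstate s))
  have hmag : ∀ (s : ℝ) x, magField b (fun x => F x + s • a x) (fun x => (s : ℂ) * φ x)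
      (fun x => (s : ℂ) • G x) x = (s : ℂ) • p x + ((s : ℂ) ^ 2) • q x := by
    intro s x
    ext j
    simp [magField, p, q, cplx]
    ring
  have hpm : MemLp p 2 (volume.restrict Ω) := by
    obtain ⟨K, hK⟩ := hb.isCompact_closure.exists_bound_of_continuousOn
      contDiff_F.continuous.continuousOn
    have hFm : AEStronglyMeasurable (fun x => φ x • ((b : ℂ) • cplx (F x)))
        (volume.restrict Ω) :=
      hφ.1.smul ((continuous_cplx.comp contDiff_F.continuous).aestronglyMeasurable.const_smul
        (b : ℂ))
    have h1 : MemLp (fun x => φ x • ((b : ℂ) • cplx (F x))) 2 (volume.restrict Ω) := by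
      refine MemLp.of_le_mul (c := |b| * K) hφ hFm ?_
      filter_upwards [ae_restrict_mem hΩ.measurableSet] with x hx
      rw [norm_smul, norm_smul, norm_cplx, Complex.norm_real, Real.norm_eq_abs, mul_comm]
      gcongr
      exact hK x (subset_closure hx)
    refine ((hG2.const_smul (-Complex.I)).add h1).ae_eq (Eventually.of_forall fun x => ?_)
    exact (magField_eq b F φ G x).symm
  have hqm : AEStronglyMeasurable q (volume.restrict Ω) :=
    hφ.1.smul ((continuous_cplx.comp_aestronglyMeasurable
      (memLp_of_memHdot1 hb ha.1).1).const_smul (b : ℂ))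
  have hE : ∀ s : ℝ, glEnergy Ω κ H (fun x => (s : ℂ) * φ x) (fun x => F x + s • a x) =
      (((∫⁻ x in Ω, ‖(s : ℂ) • p x + ((s : ℂ) ^ 2) • q x‖ₑ ^ 2)
        + ENNReal.ofReal (κ ^ 2 / 2) * (∫⁻ x in Ω, ‖(s : ℂ) * φ x‖ₑ ^ 4)
        + ENNReal.ofReal (κ ^ 2 * H ^ 2) * (∫⁻ x, ‖s • C x‖ₑ ^ 2) : ℝ≥0∞) : EReal)
      - (negEnergy Ω κ (fun x => (s : ℂ) * φ x) : EReal) := by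
    intro s
    rw [glEnergy, energy_eq hΩ isOpen_univ (hG.const_mul s) (hAC s), posEnergy]
    simp only [← hbdef, hmag, add_sub_cancel_left, Measure.restrict_univ]
  -- These two conditions characterise finiteness of the energy at any `s ≠ 0`.
  by_cases hfin : MemLp q 2 (volume.restrict Ω) ∧ ∫⁻ x in Ω, ‖φ x‖ₑ ^ 4 < ⊤
  · obtain ⟨hq, hφ4⟩ := hfin
    refine iteratedDeriv_two_nonneg
      (a := (∫ x in Ω, ‖p x‖ ^ 2) + κ ^ 2 * H ^ 2 * (∫ x, ‖C x‖ ^ 2)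
        - κ ^ 2 * ∫ x in Ω, ‖φ x‖ ^ 2)
      (b := ∫ x in Ω, (‖p x + q x‖ ^ 2 - ‖p x‖ ^ 2 - ‖q x‖ ^ 2))
      (c := (∫ x in Ω, ‖q x‖ ^ 2) + κ ^ 2 / 2 * (∫⁻ x in Ω, ‖φ x‖ₑ ^ 4).toReal)
      (fun s => ?_) hpos
    have hs : MemLp (fun x => (s : ℂ) • p x + ((s : ℂ) ^ 2) • q x) 2 (volume.restrict Ω) :=
      (hpm.const_smul (s : ℂ)).add (hq.const_smul ((s : ℂ) ^ 2))
    have h4 : ∫⁻ x in Ω, ‖(s : ℂ) * φ x‖ₑ ^ 4 = ENNReal.ofReal (s ^ 4) *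
        ∫⁻ x in Ω, ‖φ x‖ₑ ^ 4 := by
      rw [← lintegral_const_mul' _ _ ENNReal.ofReal_ne_top]
      refine lintegral_congr fun x => ?_
      rw [enorm_mul, mul_pow]
      congr 1
      rw [← ofReal_norm, Complex.norm_real, ← ENNReal.ofReal_pow (norm_nonneg _)]
      congr 1
      rw [Real.norm_eq_abs]
      exact Even.pow_abs (by decide) s
    have hC' : MemLp (fun x => s • C x) 2 volume := hC.const_smul s
    have i1 : (∫⁻ x in Ω, ‖(s : ℂ) • p x + ((s : ℂ) ^ 2) • q x‖ₑ ^ 2) ≠ ⊤ :=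
      (lintegral_sq_lt_top hs).ne
    have i2 : ENNReal.ofReal (κ ^ 2 / 2) * (∫⁻ x in Ω, ‖(s : ℂ) * φ x‖ₑ ^ 4) ≠ ⊤ := by
      rw [h4]
      exact ENNReal.mul_ne_top ENNReal.ofReal_ne_top
        (ENNReal.mul_ne_top ENNReal.ofReal_ne_top hφ4.ne)
    have i3 : ENNReal.ofReal (κ ^ 2 * H ^ 2) * (∫⁻ x, ‖s • C x‖ₑ ^ 2) ≠ ⊤ :=
      ENNReal.mul_ne_top ENNReal.ofReal_ne_top (lintegral_sq_lt_top hC').ne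
    have j1 := hpm.norm.integrable_sq
    have j2 := hq.norm.integrable_sq
    have j3 : Integrable (fun x => ‖p x + q x‖ ^ 2 - ‖p x‖ ^ 2 - ‖q x‖ ^ 2)
        (volume.restrict Ω) := ((hpm.add hq).norm.integrable_sq.sub j1).sub j2
    have e1 : ∫ x in Ω, ‖(s : ℂ) • p x + ((s : ℂ) ^ 2) • q x‖ ^ 2 = s ^ 2 * (∫ x in Ω, ‖p x‖ ^ 2)
        + s ^ 3 * (∫ x in Ω, (‖p x + q x‖ ^ 2 - ‖p x‖ ^ 2 - ‖q x‖ ^ 2))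
        + s ^ 4 * ∫ x in Ω, ‖q x‖ ^ 2 := by
      simp only [norm_smul_add_sq]
      rw [← integral_const_mul, ← integral_const_mul, ← integral_const_mul,
        ← integral_add (j1.const_mul _) (j3.const_mul _)]
      exact integral_add ((j1.const_mul _).add (j3.const_mul _)) (j2.const_mul _)
    have e2 : ∫ x, ‖s • C x‖ ^ 2 = s ^ 2 * ∫ x, ‖C x‖ ^ 2 := by
      rw [← integral_const_mul]
      refine integral_congr_ae (Eventually.of_forall fun x => ?_)
      simp only [norm_smul, mul_pow, Real.norm_eq_abs, sq_abs]
    have e3 : ∫ x in Ω, ‖(s : ℂ) * φ x‖ ^ 2 = s ^ 2 * ∫ x in Ω, ‖φ x‖ ^ 2 := by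
      rw [← integral_const_mul]
      refine integral_congr_ae (Eventually.of_forall fun x => ?_)
      simp only [norm_mul, mul_pow, Complex.norm_real, Real.norm_eq_abs, sq_abs]
    have hφs : MemLp (fun x => (s : ℂ) * φ x) 2 (volume.restrict Ω) := hφ.const_mul _
    rw [hE, toReal_coe_sub_coe (ENNReal.add_ne_top.2 ⟨ENNReal.add_ne_top.2 ⟨i1, i2⟩, i3⟩)
      (negEnergy_ne_top hφs), negEnergy_toReal hφs,
      ENNReal.toReal_add (ENNReal.add_ne_top.2 ⟨i1, i2⟩) i3, ENNReal.toReal_add i1 i2, h4,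
      ENNReal.toReal_mul, ENNReal.toReal_mul, ENNReal.toReal_mul,
      ENNReal.toReal_ofReal (by positivity), ENNReal.toReal_ofReal (by positivity),
      ENNReal.toReal_ofReal (by positivity), integral_sq_toReal hs.1, integral_sq_toReal hC'.1,
      e1, e2, e3]
    ring
  -- Here the energy is `+∞` for `s ≠ 0` and zero at `s = 0`. As `EReal.toReal` sends `⊤` to `0`,
  -- the differentiated function is identically zero.
  · have hzero : ∀ s : ℝ, (glEnergy Ω κ H (fun x => (s : ℂ) * φ x)
        (fun x => F x + s • a x)).toReal = 0 := by
      intro s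
      by_cases hs : s = 0
      · subst hs
        rw [hE]
        simp [negEnergy]
      · have hφs : MemLp (fun x => (s : ℂ) * φ x) 2 (volume.restrict Ω) := hφ.const_mul _
        have hs' : (s : ℂ) ≠ 0 := by exact_mod_cast hs
        rw [hE]
        convert top_sub_coe_toReal (negEnergy_ne_top (κ := κ) hφs) using 4
        -- A finite positive part would make both the kinetic and the quartic term finite, which
        -- puts `q` in `L²` and `φ` in `L⁴`.
        by_contra hne
        rw [← Ne, ENNReal.add_ne_top, ENNReal.add_ne_top] at hne
        obtain ⟨⟨f1, f2⟩, -⟩ := hne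
        refine hfin ⟨?_, ?_⟩
        · have m1 : MemLp (fun x => (s : ℂ) • p x + ((s : ℂ) ^ 2) • q x) 2
              (volume.restrict Ω) :=
            memLp_of_lintegral_sq ((hpm.1.const_smul (s : ℂ)).add
              (hqm.const_smul ((s : ℂ) ^ 2))) f1.lt_top
          refine ((m1.sub (hpm.const_smul (s : ℂ))).const_smul ((s : ℂ) ^ 2)⁻¹).ae_eq
            (Eventually.of_forall fun x => ?_)
          simp only [Pi.smul_apply, Pi.sub_apply, add_sub_cancel_left]
          rw [inv_smul_smul₀ (pow_ne_zero 2 hs')]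
        · have f3 : ∫⁻ x in Ω, ‖(s : ℂ) * φ x‖ₑ ^ 4 ≠ ⊤ := by
            intro htop
            apply f2
            rw [htop, ENNReal.mul_top]
            rw [Ne, ENNReal.ofReal_eq_zero, not_le]
            positivity
          have f4 : ∫⁻ x in Ω, ‖(s : ℂ) * φ x‖ₑ ^ 4 =
              ‖(s : ℂ)‖ₑ ^ 4 * ∫⁻ x in Ω, ‖φ x‖ₑ ^ 4 := by
            rw [← lintegral_const_mul' _ _ (ENNReal.pow_ne_top enorm_ne_top)]
            refine lintegral_congr fun x => ?_
            rw [enorm_mul, mul_pow]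
          rw [f4] at f3
          rw [lt_top_iff_ne_top]
          intro htop
          rw [htop, ENNReal.mul_top (pow_ne_zero 4 (by simpa using hs))] at f3
          exact f3 rfl
    exact iteratedDeriv_two_nonneg (a := 0) (b := 0) (c := 0) (by simpa using hzero) hpos

/-! ### Comparison of the critical fields -/

theorem lowerField_le_of_imp {P Q : ℝ → Prop} (h : ∀ H, 0 < H → P H → Q H) :
    lowerField Q ≤ lowerField P :=
  sInf_le_sInf (image_mono fun H hH => ⟨hH.1, h H hH.1 hH.2⟩)

theorem upperField_le_of_imp {P Q : ℝ → Prop} (h : ∀ H, 0 < H → P H → Q H) :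
    upperField Q ≤ upperField P :=
  sInf_le_sInf (image_mono fun _ hH =>
    ⟨hH.1, fun H' hlt => h H' (hH.1.trans hlt) (hH.2 H' hlt)⟩)

end GinzburgLandau
end


theorem proposition1p1 (Ω : Set GinzburgLandau.R3)
    (hΩ : GinzburgLandau.IsAdmissibleDomain Ω) (κ : ℝ) (hκ : 0 < κ) :
    (∃ FΩ, GinzburgLandau.IsNormalPotential Ω FΩ) ∧
    (∀ FΩ, GinzburgLandau.IsNormalPotential Ω FΩ →
      (GinzburgLandau.lowerHC3Loc Ω κ ≤ GinzburgLandau.lowerHC3 Ω κ ∧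
        GinzburgLandau.lowerHC3 Ω κ ≤ GinzburgLandau.lowerHC3Mod Ω κ FΩ) ∧
      (GinzburgLandau.upperHC3Loc Ω κ ≤ GinzburgLandau.upperHC3 Ω κ ∧
        GinzburgLandau.upperHC3 Ω κ ≤ GinzburgLandau.upperHC3Mod Ω κ FΩ)) := by
  have ho := hΩ.isOpen
  have hb := hΩ.isBounded
  have hc := hΩ.isConnected
  refine ⟨GinzburgLandau.exists_isNormalPotential ho hb, fun FΩ hF => ⟨⟨?_, ?_⟩, ?_, ?_⟩⟩
  · exact GinzburgLandau.lowerField_le_of_imp fun H _ h =>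
      GinzburgLandau.hessNonneg_of_isMinimizer ho hb hκ h
  · exact GinzburgLandau.lowerField_le_of_imp fun H _ h =>
      GinzburgLandau.isMinimizer_of_mod ho hc hb hF h
  · exact GinzburgLandau.upperField_le_of_imp fun H _ h =>
      GinzburgLandau.hessNonneg_of_isMinimizer ho hb hκ h.1
  · exact GinzburgLandau.upperField_le_of_imp fun H hH h =>
      GinzburgLandau.isUniqueMinimizer_of_mod ho hc hb hF hκ hH h
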